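/- Let $N\ge 1$, $\sigma\in(0,2)$, $T>0$, and write $Q_T=\mathbb R^N\times(0,T]$. Consider $$u_t-F\big(-(-\Delta)^{\sigma/2}u\big)=f(x,t)\ \text{ in } Q_T,\qquad u(x,0)=u_0(x)\ \text{ in }\mathbb R^N, \tag{1}$$ where, for bounded $C^2$ functions $\phi$, $-(-\Delta)^{\sigma/2}\phi(x)=\lim_{r\to0^+}\int_{|z|>r}(\phi(x+z)-\phi(x))\frac{c}{|z|^{N+\sigma}}\,dz$ with $c=\frac{2^{\sigma}\Gamma(\frac{N+\sigma}{2})}{\pi^{N/2}|\Gamma(-\frac{\sigma}{2})|}$. Assume * (A1) there is $L_F>0$ such that $F(l_1)-F(l_2)\le L_F\,(l_1-l_2)^+$ for all $l_1,l_2\in\mathbb R$ (so $F$ is Lipschitz and nondecreasing); * (A2) $f$ is bounded on $\mathbb R^N\times[0,T]$ and continuous on $Q_T$, and $u_0$ is bounded and continuous on $\mathbb R^N$. A bounded viscosity solution of (1) is a bounded continuous $u:\mathbb R^N\times[0,T]\to\mathbb R$ with $u(\cdot,0)=u_0$ such that for every bounded $C^2$ test function $\phi$ and every $(x_0,t_0)\in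 Q_T$: if $u-\phi$ has a global maximum (respectively minimum) over $Q_T$ at $(x_0,t_0)$, then $\phi_t-F(-(-\Delta)^{\sigma/2}\phi)\le f$ (respectively $\ge f$) at $(x_0,t_0)$. For $h>0$ let $\Delta_h\phi(x)=\sum_{k=1}^N\frac{\phi(x+he_k)-2\phi(x)+\phi(x-he_k)}{h^2}$ and, for bounded $\phi$, $$-(-\Delta_h)^{\sigma/2}\phi(x)=\frac1{|\Gamma(-\frac\sigma2)|}\int_0^\infty\big(e^{t\Delta_h}\phi(x)-\phi(x)\big)\frac{dt}{t^{1+\sigma/2}}.$$ Let $C_\sigma>0$ be the constant for which $\sum_{\mathbf j\in\mathbb Z^N\setminus\{0\}}\kappa_{\sigma,h,\mathbf j}=C_\sigma h^{-\sigma}$ for all $h>0$, where $\kappa_{\sigma,h,\mathbf j}=\frac{1}{h^\sigma|\Gamma(-\frac\sigma2)|}\int_0^\infty e^{-2Nt}\prod_{i=1}^N I_{|\mathbf j_i|}(2t)\,\frac{dt}{t^{1+\sigma/2}}$ and $I_m$ is the modified Bessel function of the first kind of order $m$. Then (1) has a unique bounded viscosity solution $u$. Moreover, for each $h>0$ let $\tau=\tau_h=T/M_h$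 with an integer $M_h\ge1$ satisfy the CFL condition $$\tau_h\le\frac{h^\sigma}{L_FC_\sigma},$$ and let $U_h:\mathbb R^N\times[0,T]\to\mathbb R$ solve the explicit forward-Euler scheme $$\frac{U_h(x,t)-U_h(x,t-\tau)}{\tau}=F\big(-(-\Delta_h)^{\sigma/2}U_h(x,t-\tau)\big)+f(x,t-\tau)\quad\text{for }x\in\mathbb R^N,\ t\in[\tau,T],$$ $$U_h(x,t)=u_0(x)\quad\text{for }x\in\mathbb R^N,\ t\in[0,\tau).$$ Then $U_h\to u$ locally uniformly on $\mathbb R^N\times[0,T]$ as $h\to0^+$. -/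

import Mathlib

open Set Filter Topology MeasureTheory

noncomputable section

namespace FracHJB

/-- The space `ℝ^N` with its Euclidean norm. -/
abbrev Space (N : ℕ) : Type := EuclideanSpace ℝ (Fin N)

/-! ### The fractional Laplacian -/

/-- The constant `c = 2^σ Γ((N+σ)/2) / (π^(N/2) |Γ(-σ/2)|)` in the singular integral. -/
def fracConst (N : ℕ) (σ : ℝ) : ℝ :=
  2 ^ σ * Real.Gamma ((N + σ) / 2) / (Real.pi ^ ((N : ℝ) / 2) * |Real.Gamma (-σ / 2)|)

/-- The truncated integral `∫_{|z| > r} (φ(x+z) - φ(x)) c / |z|^(N+σ) dz`. -/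
def truncFracLap {N : ℕ} (σ r : ℝ) (φ : Space N → ℝ) (x : Space N) : ℝ :=
  ∫ z in {z : Space N | r < ‖z‖}, (φ (x + z) - φ x) * (fracConst N σ / ‖z‖ ^ (N + σ))

/-- `-(-Δ)^(σ/2) φ (x)`, as the limit when `r → 0+` of the truncated singular integrals.
The limit exists for every bounded `C²` function `φ`. -/
def negFracLap {N : ℕ} (σ : ℝ) (φ : Space N → ℝ) (x : Space N) : ℝ :=
  limUnder (𝓝[>] (0 : ℝ)) (fun r => truncFracLap σ r φ x)

/-! ### Powers of the discrete Laplacian -/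

/-- The discrete Laplacian
`Δ_h φ(x) = ∑_k (φ(x + h e_k) - 2 φ(x) + φ(x - h e_k)) / h²`. -/
def discLap {N : ℕ} (h : ℝ) (φ : Space N → ℝ) (x : Space N) : ℝ :=
  ∑ k : Fin N, (φ (x + h • EuclideanSpace.single k (1 : ℝ)) - 2 * φ x
    + φ (x - h • EuclideanSpace.single k (1 : ℝ))) / h ^ 2

/-- The semigroup `e^{tΔ_h} φ(x) = ∑_n t^n / n! (Δ_h)^n φ(x)`. On bounded functions `Δ_h` is a
bounded operator, the series converges absolutely and gives the bounded solution of the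
semi-discrete heat equation `∂_t U = Δ_h U`, `U(·, 0) = φ`. -/
def discHeat {N : ℕ} (h t : ℝ) (φ : Space N → ℝ) (x : Space N) : ℝ :=
  ∑' n : ℕ, t ^ n / (n.factorial : ℝ) * ((discLap h)^[n] φ) x

/-- `-(-Δ_h)^(σ/2) φ(x) = 1/|Γ(-σ/2)| ∫_0^∞ (e^{tΔ_h} φ(x) - φ(x)) dt / t^(1+σ/2)`. -/
def negDiscFracLap {N : ℕ} (σ h : ℝ) (φ : Space N → ℝ) (x : Space N) : ℝ :=
  1 / |Real.Gamma (-σ / 2)| *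
    ∫ t in Ioi (0 : ℝ), (discHeat h t φ x - φ x) / t ^ (1 + σ / 2)

/-- The modified Bessel function of the first kind `I_m`, of integer order `m ≥ 0`. -/
def besselI (m : ℕ) (s : ℝ) : ℝ :=
  ∑' k : ℕ, (s / 2) ^ (2 * k + m) / ((k.factorial : ℝ) * ((k + m).factorial : ℝ))

/-- The kernel `G(j, t) = e^{-2Nt} ∏_i I_{|j_i|}(2t)`. -/
def discKernel {N : ℕ} (j : Fin N → ℤ) (t : ℝ) : ℝ :=
  Real.exp (-2 * N * t) * ∏ i : Fin N, besselI (j i).natAbs (2 * t)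

/-- The weight `κ_{σ,h,j} = h^{-σ} / |Γ(-σ/2)| ∫_0^∞ G(j, t) dt / t^(1+σ/2)`
of `-(-Δ_h)^(σ/2)` at the grid point `h j`. -/
def weight {N : ℕ} (σ h : ℝ) (j : Fin N → ℤ) : ℝ :=
  1 / h ^ σ * (1 / |Real.Gamma (-σ / 2)|) *
    ∫ t in Ioi (0 : ℝ), discKernel j t / t ^ (1 + σ / 2)

/-- The constant `C_σ` for which `∑_{j ≠ 0} κ_{σ,h,j} = C_σ / h^σ` for all `h > 0`,
that is, the total weight at `h = 1`. -/
def cflConst (N : ℕ) (σ : ℝ) : ℝ :=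
  ∑' j : {j : Fin N → ℤ // j ≠ 0}, weight σ 1 j.1

/-! ### The scheme -/

/-- The explicit scheme on the whole space:
`S(h,x,t,r,U) = (r - U(x,t-τ))/τ - F(-(-Δ_h)^(σ/2) U(x,t-τ)) - f(x,t-τ)` for `t ≥ τ`, and
`S(h,x,t,r,U) = r - u₀(x)` for `t < τ`. -/
def schemeOp {N : ℕ} (σ : ℝ) (F : ℝ → ℝ) (f : Space N → ℝ → ℝ) (u₀ : Space N → ℝ)
    (h τ : ℝ) (x : Space N) (t r : ℝ) (U : Space N → ℝ → ℝ) : ℝ :=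
  open Classical in
  if τ ≤ t then
    (r - U x (t - τ)) / τ - F (negDiscFracLap σ h (fun y => U y (t - τ)) x) - f x (t - τ)
  else r - u₀ x

/-- `U` solves the scheme in `ℝ^N × [0,T]`. -/
def SolvesScheme {N : ℕ} (σ T : ℝ) (F : ℝ → ℝ) (f : Space N → ℝ → ℝ) (u₀ : Space N → ℝ)
    (h τ : ℝ) (U : Space N → ℝ → ℝ) : Prop :=
  ∀ x : Space N, ∀ t ∈ Icc 0 T, schemeOp σ F f u₀ h τ x t (U x t) U = 0

/-! ### Viscosity solutions -/

/-- Test functions: `C²` and bounded on `ℝ^N × [0,T]`. -/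
def IsTest {N : ℕ} (T : ℝ) (φ : Space N → ℝ → ℝ) : Prop :=
  ContDiff ℝ 2 (fun p : Space N × ℝ => φ p.1 p.2) ∧
    ∃ C : ℝ, ∀ x : Space N, ∀ t ∈ Icc 0 T, |φ x t| ≤ C

/-- The residual `φ_t - F(-(-Δ)^(σ/2) φ) - f` at `(x,t)`. -/
def residual {N : ℕ} (σ : ℝ) (F : ℝ → ℝ) (f : Space N → ℝ → ℝ) (φ : Space N → ℝ → ℝ)
    (x : Space N) (t : ℝ) : ℝ :=
  deriv (fun s => φ x s) t - F (negFracLap σ (fun y => φ y t) x) - f x t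

/-- The viscosity subsolution inequality for `u_t - F(-(-Δ)^(σ/2) u) = f` in
`Q_T = ℝ^N × (0,T]`. -/
def ViscSub {N : ℕ} (σ T : ℝ) (F : ℝ → ℝ) (f : Space N → ℝ → ℝ)
    (u : Space N → ℝ → ℝ) : Prop :=
  ∀ φ : Space N → ℝ → ℝ, IsTest T φ → ∀ x₀ : Space N, ∀ t₀ ∈ Ioc 0 T,
    (∀ x : Space N, ∀ t ∈ Ioc 0 T, u x t - φ x t ≤ u x₀ t₀ - φ x₀ t₀) →
      residual σ F f φ x₀ t₀ ≤ 0

/-- The viscosity supersolution inequality for `u_t - F(-(-Δ)^(σ/2) u) = f` in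
`Q_T = ℝ^N × (0,T]`. -/
def ViscSuper {N : ℕ} (σ T : ℝ) (F : ℝ → ℝ) (f : Space N → ℝ → ℝ)
    (u : Space N → ℝ → ℝ) : Prop :=
  ∀ φ : Space N → ℝ → ℝ, IsTest T φ → ∀ x₀ : Space N, ∀ t₀ ∈ Ioc 0 T,
    (∀ x : Space N, ∀ t ∈ Ioc 0 T, u x₀ t₀ - φ x₀ t₀ ≤ u x t - φ x t) →
      0 ≤ residual σ F f φ x₀ t₀

/-- `u` is a bounded (continuous) viscosity solution of `u_t - F(-(-Δ)^(σ/2) u) = f` in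
`ℝ^N × (0,T]` with `u(·,0) = u₀`. -/
structure IsBddViscositySolution {N : ℕ} (σ T : ℝ) (F : ℝ → ℝ) (f : Space N → ℝ → ℝ)
    (u₀ : Space N → ℝ) (u : Space N → ℝ → ℝ) : Prop where
  continuousOn : ContinuousOn (fun p : Space N × ℝ => u p.1 p.2) (univ ×ˢ Icc 0 T)
  bounded : ∃ C : ℝ, ∀ x : Space N, ∀ t ∈ Icc 0 T, |u x t| ≤ C
  initial : ∀ x : Space N, u x 0 = u₀ x
  sub : ViscSub σ T F f u
  super : ViscSuper σ T F f u

end FracHJB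

end

/-! The argument is the half-relaxed limit method of Barles and Perthame: a monotone, stable and
consistent scheme converges once a comparison principle is available for semicontinuous sub- and
supersolutions. Existence of the viscosity solution comes out of the same argument, applied to a
scheme solution built by hand.

Monotonicity. On bounded functions, with no regularity in space, `e^{tΔ_h}` is the transition
semigroup of `N` independent continuous-time walks on the grid (`discHeat_eq_integral`), hence
positive and constant-preserving. Raising a function at a point `x` can lower `-(-Δ_h)^(σ/2)` at `x`
by at most `C_σ h^(-σ)` times the increase (`negDiscFracLap_sub_le`), and the CFL condition makes
the identity in the Euler step absorb this loss (`euler_step_mono`). Comparison with constants and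
with a smooth bump then gives bounds in the supremum norm and barriers at `t = 0` that are uniform
in `h` (`SolvesScheme.abs_apply_le`, `exists_barrier`).

Consistency. The singular kernel `c / |z|^(N+σ)` is the integral of the Gaussian heat kernel against
`t^(-1-σ/2) dt / |Γ(-σ/2)|`, so the continuous and the discrete operator are the same time integral
of two heat semigroups (`integral_mul_fracKer`). The grid walk converges in law to the Gaussian by
characteristic functions (`tendsto_integral_gridLaw`). Second differences of a test function are
dominated by the bounded penalty `|z|² / (1 + |z|²)`, whose mean under either law is at most `2Nt`;
this gives the integrable majorant `min C (C' t) / t^(1+σ/2)`.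

Comparison. Variables are doubled with bounded penalties. Test functions must be `C²` on the whole
space while `u` and `v` are only semicontinuous, so the nonlocal operator cannot be evaluated on `u`
and `v` themselves. The remedy is one smooth function inserted strictly between the penalized `u`
and a translate of `v` raised by `r⁴`. Both test functions equal it, up to explicit terms, away from
the contact point, and near that point it is glued to the touching functions by a bump of radius
`r`. In the difference of the two nonlocal terms the inserted function cancels up to a gluing error
that vanishes as `r → 0` (`doubling_inequality_aux`, `doubling_inequality`, `comparison`).

Conclusion. The upper half-relaxed limit is a subsolution (`viscSub_upperLimit`), and the sign
change `U ↦ -U`, `F ↦ -F(-·)` makes the lower one a supersolution. Comparison forces them to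
coincide, which yields a continuous solution and locally uniform convergence to it. -/

noncomputable section

namespace FracHJB

section

open scoped ENNReal NNReal
open ProbabilityTheory

/-! ### Shift operators on bounded functions and their exponentials -/

section Shift

variable {G : Type*} [AddCommGroup G]

/-- Bounded real functions on `G` with the supremum norm. -/
def BddFun (G : Type*) : Type _ := lp (fun _ : G => ℝ) ∞

instance (G : Type*) : NormedAddCommGroup (BddFun G) :=
  inferInstanceAs (NormedAddCommGroup (lp (fun _ : G => ℝ) ∞))

instance (G : Type*) : NormedSpace ℝ (BddFun G) :=
  inferInstanceAs (NormedSpace ℝ (lp (fun _ : G => ℝ) ∞))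

instance (G : Type*) : CompleteSpace (BddFun G) :=
  inferInstanceAs (CompleteSpace (lp (fun _ : G => ℝ) ∞))

/-- Evaluation at a point. -/
def BddFun.eval {G : Type*} (x : G) : BddFun G →L[ℝ] ℝ := lp.evalCLM ℝ (fun _ : G => ℝ) ∞ x

instance (G : Type*) : CoeFun (BddFun G) (fun _ => G → ℝ) := ⟨fun φ x => BddFun.eval x φ⟩

/-- A bounded function as an element of `BddFun`. -/
def BddFun.mk {G : Type*} (φ : G → ℝ) (hφ : ∃ C, ∀ x, |φ x| ≤ C) : BddFun G :=
  (⟨φ, memℓp_infty (by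
    obtain ⟨C, hC⟩ := hφ
    exact ⟨C, by rintro _ ⟨x, rfl⟩; exact hC x⟩)⟩ : lp (fun _ : G => ℝ) ∞)

@[simp] lemma BddFun.mk_apply {G : Type*} (φ : G → ℝ) (hφ : ∃ C, ∀ x, |φ x| ≤ C) (x : G) :
    (BddFun.mk φ hφ : BddFun G) x = φ x := rfl

lemma BddFun.abs_apply_le {G : Type*} (φ : BddFun G) (x : G) : |φ x| ≤ ‖φ‖ :=
  lp.norm_apply_le_norm (E := fun _ : G => ℝ) (p := ∞) (by simp) φ x

lemma BddFun.norm_le {G : Type*} {φ : BddFun G} {C : ℝ} (hC : 0 ≤ C) (h : ∀ x, |φ x| ≤ C) :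
    ‖φ‖ ≤ C :=
  lp.norm_le_of_forall_le (E := fun _ : G => ℝ) hC h

@[ext] lemma BddFun.ext {G : Type*} {φ ψ : BddFun G} (h : ∀ x, φ x = ψ x) : φ = ψ :=
  lp.ext (E := fun _ : G => ℝ) (p := ∞) (funext h)

/-- The shift operator `φ ↦ φ(· + v)`. -/
def shift (v : G) : BddFun G →L[ℝ] BddFun G :=
  LinearMap.mkContinuous
    { toFun := fun φ => BddFun.mk (fun x => φ (x + v)) ⟨‖φ‖, fun x => φ.abs_apply_le _⟩
      map_add' := fun φ ψ => by ext x; simp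
      map_smul' := fun c φ => by ext x; simp } 1 (fun φ => by
    rw [one_mul]
    exact BddFun.norm_le (norm_nonneg _) fun x => φ.abs_apply_le _)

@[simp] lemma shift_apply (v : G) (φ : BddFun G) (x : G) : shift v φ x = φ (x + v) := rfl

lemma shift_commute (v w : G) : Commute (shift v) (shift w) := by
  ext φ x
  simp [add_right_comm]

lemma shift_pow_apply (v : G) (n : ℕ) (φ : BddFun G) (x : G) :
    (shift v ^ n) φ x = φ (x + n • v) := by
  induction n generalizing x with
  | zero => simp
  | succ n ih =>
    rw [pow_succ', mul_apply_eq_comp, shift_apply, ih, add_smul, one_smul,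
      add_assoc, add_comm v]

lemma exp_add_of_commute_real {A : Type*} [NormedRing A] [NormedAlgebra ℝ A] [CompleteSpace A]
    {x y : A} (h : Commute x y) :
    NormedSpace.exp (x + y) = NormedSpace.exp x * NormedSpace.exp y :=
  letI : NormedAlgebra ℚ A := .restrictScalars ℚ ℝ A
  NormedSpace.exp_add_of_commute h

lemma exp_apply_hasSum {X : Type*} (A : BddFun X →L[ℝ] BddFun X) (φ : BddFun X) (x : X) :
    HasSum (fun n : ℕ => ((n.factorial : ℝ)⁻¹) * (A ^ n) φ x) (NormedSpace.exp A φ x) := by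
  have h := NormedSpace.exp_series_hasSum_exp' (𝕂 := ℝ) A
  have h2 := (ContinuousLinearMap.apply ℝ (BddFun X) φ).hasSum h
  have h3 := (BddFun.eval x).hasSum h2
  exact h3

lemma exp_smul_one' {X : Type*} (c : ℝ) :
    NormedSpace.exp (c • (1 : BddFun X →L[ℝ] BddFun X)) = Real.exp c • 1 := by
  have := NormedSpace.algebraMap_exp_comm (𝔸 := BddFun X →L[ℝ] BddFun X) c
  rw [Algebra.algebraMap_eq_smul_one, Algebra.algebraMap_eq_smul_one] at this
  rw [← this, Real.exp_eq_exp_ℝ]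

/-- The scalar part contributes the factor `e^{-s}`, and the `n`-th term of the remaining
exponential series is `s^n / n!` times a shift by `n • v`: these are the Poisson weights. -/
lemma exp_shift_sub_one_apply (s : ℝ≥0) (v : G) (φ : BddFun G) (x : G) :
    NormedSpace.exp ((s : ℝ) • (shift v - 1)) φ x = ∫ n, φ (x + n • v) ∂poissonMeasure s := by
  have h1 : (s : ℝ) • (shift v - 1) = (s : ℝ) • shift v + (-(s : ℝ)) • 1 := by
    rw [smul_sub, neg_smul, sub_eq_add_neg]
  rw [h1, exp_add_of_commute_real ((Commute.one_right _).smul_right _), exp_smul_one',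
    integral_poissonMeasure]
  have h := (exp_apply_hasSum ((s : ℝ) • shift v) φ x).mul_left (Real.exp (-(s : ℝ)))
  have e : (NormedSpace.exp ((s : ℝ) • shift v) * Real.exp (-(s : ℝ)) • 1) φ x
      = Real.exp (-(s : ℝ)) * NormedSpace.exp ((s : ℝ) • shift v) φ x := by
    rw [mul_smul_comm, mul_one]; rfl
  rw [e, ← h.tsum_eq]
  congr 1; ext n
  rw [smul_pow, smul_eq_mul]
  have e2 : ((s : ℝ) ^ n • shift v ^ n) φ x = (s : ℝ) ^ n * φ (x + n • v) := by
    rw [← shift_pow_apply]; rfl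
  rw [e2]
  ring

/-- The law of the difference of two independent Poisson variables with rate `s`. -/
def skellam (s : ℝ≥0) : Measure ℤ :=
  ((poissonMeasure s).prod (poissonMeasure s)).map (fun p : ℕ × ℕ => (p.1 : ℤ) - p.2)

instance (s : ℝ≥0) : IsProbabilityMeasure (skellam s) :=
  Measure.isProbabilityMeasure_map .of_discrete

/-- The generator of the continuous-time walk jumping by `± v`. -/
def walkGen (v : G) : BddFun G →L[ℝ] BddFun G := (shift v - 1) + (shift (-v) - 1)

lemma walkGen_commute (v w : G) : Commute (walkGen v) (walkGen w) := by
  have h : ∀ a b : G, Commute (shift a - 1) (shift b - 1) := fun a b =>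
    ((shift_commute a b).sub_right (Commute.one_right _)).sub_left (Commute.one_left _)
  exact ((h _ _).add_right (h _ _)).add_left ((h _ _).add_right (h _ _))

lemma integrable_of_bdd {X : Type*} [MeasurableSpace X] [Countable X] [MeasurableSingletonClass X]
    (μ : Measure X) [IsFiniteMeasure μ] {g : X → ℝ} {C : ℝ} (hg : ∀ x, |g x| ≤ C) :
    Integrable g μ :=
  Integrable.of_bound (measurable_of_countable g).aestronglyMeasurable C (ae_of_all _ hg)

/-- Forward and backward jumps commute, so the exponential factors and the jumps are counted by two
independent Poisson variables; only their difference matters. -/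
lemma exp_walkGen_apply (s : ℝ≥0) (v : G) (φ : BddFun G) (x : G) :
    NormedSpace.exp ((s : ℝ) • walkGen v) φ x = ∫ m, φ (x + m • v) ∂skellam s := by
  have hc : Commute ((s : ℝ) • (shift v - 1)) ((s : ℝ) • (shift (-v) - 1)) :=
    ((((shift_commute v (-v)).sub_right (Commute.one_right _)).sub_left
      (Commute.one_left _)).smul_right _).smul_left _
  rw [walkGen, smul_add, exp_add_of_commute_real hc, mul_apply_eq_comp,
    exp_shift_sub_one_apply, skellam, integral_map .of_discrete .of_discrete,
    integral_prod _ (integrable_of_bdd _ fun p => φ.abs_apply_le _)]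
  congr 1; ext a
  rw [exp_shift_sub_one_apply]
  congr 1; ext b
  congr 1
  simp only [sub_smul, smul_neg, natCast_zsmul]
  abel

/-- The generators of different directions commute, so the exponential of the sum is a product,
matching the product of the one-dimensional laws. -/
lemma exp_sum_walkGen_apply (s : ℝ≥0) {n : ℕ} (v : Fin n → G) (φ : BddFun G) (x : G) :
    NormedSpace.exp ((s : ℝ) • ∑ k, walkGen (v k)) φ x =
      ∫ j, φ (x + ∑ k, j k • v k) ∂(Measure.pi fun _ : Fin n => skellam s) := by
  induction n generalizing x φ with
  | zero =>
    simp [NormedSpace.exp_zero]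
  | succ n ih =>
    have hc : Commute ((s : ℝ) • walkGen (v 0)) ((s : ℝ) • ∑ k, walkGen (v (Fin.succ k))) :=
      ((Commute.sum_right _ _ _ fun k _ => walkGen_commute _ _).smul_right _).smul_left _
    rw [Fin.sum_univ_succ, smul_add, exp_add_of_commute_real hc,
      mul_apply_eq_comp, exp_walkGen_apply]
    have hm := (measurePreserving_piFinSuccAbove (fun _ : Fin (n + 1) => skellam s) 0).symm
    rw [← hm.integral_comp', integral_prod _ (integrable_of_bdd _ fun p => φ.abs_apply_le _)]
    congr 1; ext m
    rw [ih]
    congr 1; ext j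
    rw [Fin.sum_univ_succ, ← add_assoc]
    simp

end Shift

end

section

open scoped ENNReal NNReal
open ProbabilityTheory

/-! ### The discrete heat semigroup as the transition semigroup of a random walk -/

section DiscreteHeat

variable {N : ℕ}

/-- The discrete Laplacian as a bounded operator on bounded functions. -/
def discLapCLM (N : ℕ) (h : ℝ) : BddFun (Space N) →L[ℝ] BddFun (Space N) :=
  (1 / h ^ 2) • ∑ k : Fin N, walkGen (h • EuclideanSpace.single k (1 : ℝ))

lemma discLapCLM_apply (h : ℝ) (φ : BddFun (Space N)) (x : Space N) :
    discLapCLM N h φ x = discLap h (fun y => φ y) x := by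
  have e : discLapCLM N h φ x
      = (1 / h ^ 2) * ∑ k : Fin N, walkGen (h • EuclideanSpace.single k (1 : ℝ)) φ x := by
    simp [discLapCLM]
  rw [e, discLap, Finset.mul_sum]
  refine Finset.sum_congr rfl fun k _ => ?_
  have e2 : ∀ v : Space N, walkGen v φ x = (φ (x + v) - φ x) + (φ (x + -v) - φ x) := fun v => by
    simp [walkGen]
  rw [e2, ← sub_eq_add_neg x]
  ring

lemma discLap_iterate (h : ℝ) (φ : BddFun (Space N)) (n : ℕ) :
    (discLap h)^[n] (fun y => φ y) = fun x => (discLapCLM N h ^ n) φ x := by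
  induction n with
  | zero => simp
  | succ n ih =>
    rw [Function.iterate_succ_apply', ih]
    ext x
    rw [pow_succ', mul_apply_eq_comp, discLapCLM_apply]

lemma discHeat_eq_exp (h t : ℝ) (φ : BddFun (Space N)) (x : Space N) :
    discHeat h t (fun y => φ y) x = NormedSpace.exp (t • discLapCLM N h) φ x := by
  rw [discHeat, ← (exp_apply_hasSum (t • discLapCLM N h) φ x).tsum_eq]
  congr 1; ext n
  rw [congrFun (discLap_iterate h φ n) x]
  have e : ((t ^ n • discLapCLM N h ^ n) φ) x = t ^ n * (discLapCLM N h ^ n) φ x := by simp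
  rw [smul_pow, e]
  ring

/-- The law at time `s` of `N` independent continuous-time simple walks on `ℤ`. -/
def walk (N : ℕ) (s : ℝ≥0) : Measure (Fin N → ℤ) := Measure.pi fun _ : Fin N => skellam s

instance (N : ℕ) (s : ℝ≥0) : IsProbabilityMeasure (walk N s) := by
  unfold walk; infer_instance

/-- The grid point `h j`. -/
def gridPt (h : ℝ) (j : Fin N → ℤ) : Space N :=
  ∑ k, j k • (h • EuclideanSpace.single k (1 : ℝ))

lemma gridPt_apply (h : ℝ) (j : Fin N → ℤ) (i : Fin N) : gridPt h j i = j i * h := by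
  simp [gridPt, Finset.sum_apply, Pi.single_apply, mul_comm]

lemma gridPt_eq_zero_iff {h : ℝ} (hh : h ≠ 0) (j : Fin N → ℤ) : gridPt h j = 0 ↔ j = 0 := by
  constructor
  · intro H
    ext i
    have := gridPt_apply h j i
    rw [H] at this
    simpa [hh] using this.symm
  · rintro rfl
    simp [gridPt]

/-- Positivity and conservation of mass of the power series `e^{tΔ_h}` are read off from this
formula. The walk lives on a countable set, so `φ` need not be measurable; this matters because
scheme solutions carry no regularity in `x`. -/
lemma discHeat_eq_integral (h : ℝ) {t : ℝ} (ht : 0 ≤ t) {φ : Space N → ℝ}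
    (hφ : ∃ C, ∀ x, |φ x| ≤ C) (x : Space N) :
    discHeat h t φ x = ∫ j, φ (x + gridPt h j) ∂walk N (t / h ^ 2).toNNReal := by
  have := discHeat_eq_exp h t (BddFun.mk φ hφ) x
  simp only [BddFun.mk_apply] at this
  rw [this, discLapCLM, smul_smul]
  have e : t * (1 / h ^ 2) = ((t / h ^ 2).toNNReal : ℝ) := by
    rw [Real.coe_toNNReal _ (by positivity)]; ring
  rw [e]
  exact exp_sum_walkGen_apply _ _ (BddFun.mk φ hφ) x

lemma discHeat_zero (h : ℝ) (φ : Space N → ℝ) (x : Space N) : discHeat h 0 φ x = φ x := by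
  rw [discHeat, tsum_eq_single 0]
  · simp
  · intro n hn
    simp [hn]

lemma discLap_bdd (h : ℝ) {φ : Space N → ℝ} (hφ : ∃ C, ∀ x, |φ x| ≤ C) :
    ∃ C, ∀ x, |discLap h φ x| ≤ C := by
  refine ⟨‖discLapCLM N h (BddFun.mk φ hφ)‖, fun x => ?_⟩
  rw [← show (discLapCLM N h (BddFun.mk φ hφ)) x = discLap h φ x from discLapCLM_apply h _ x]
  exact BddFun.abs_apply_le _ x

lemma hasDerivAt_discHeat (h : ℝ) {φ : Space N → ℝ} (hφ : ∃ C, ∀ x, |φ x| ≤ C) (x : Space N)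
    (t : ℝ) : HasDerivAt (fun t => discHeat h t φ x) (discHeat h t (discLap h φ) x) t := by
  have e : (fun t => discHeat h t φ x)
      = fun t : ℝ => NormedSpace.exp (t • discLapCLM N h) (BddFun.mk φ hφ) x := by
    ext t
    exact discHeat_eq_exp h t (BddFun.mk φ hφ) x
  have h1 := hasDerivAt_exp_smul_const (𝕂 := ℝ) (discLapCLM N h) t
  have h2 := ((BddFun.eval x).comp
    (ContinuousLinearMap.apply ℝ (BddFun (Space N)) (BddFun.mk φ hφ))).hasFDerivAt.comp_hasDerivAt
      t h1
  have e2 : discLap h φ = fun y => (discLapCLM N h (BddFun.mk φ hφ)) y := by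
    ext y
    exact (discLapCLM_apply h (BddFun.mk φ hφ) y).symm
  rw [e, e2, discHeat_eq_exp]
  exact h2

lemma continuous_discHeat (h : ℝ) {φ : Space N → ℝ} (hφ : ∃ C, ∀ x, |φ x| ≤ C) (x : Space N) :
    Continuous fun t => discHeat h t φ x :=
  continuous_iff_continuousAt.2 fun t => (hasDerivAt_discHeat h hφ x t).continuousAt

lemma bdd_const (N : ℕ) (c : ℝ) : ∃ C, ∀ x : Space N, |(fun _ => c) x| ≤ C := ⟨|c|, fun _ => le_rfl⟩

lemma integrable_walk (h : ℝ) (s : ℝ≥0) {φ : Space N → ℝ} (hφ : ∃ C, ∀ x, |φ x| ≤ C)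
    (x : Space N) : Integrable (fun j => φ (x + gridPt h j)) (walk N s) := by
  obtain ⟨C, hC⟩ := hφ
  exact integrable_of_bdd _ fun j => hC _

lemma discHeat_mono (h : ℝ) {t : ℝ} (ht : 0 ≤ t) {φ ψ : Space N → ℝ}
    (hφ : ∃ C, ∀ x, |φ x| ≤ C) (hψ : ∃ C, ∀ x, |ψ x| ≤ C) (hle : ∀ x, φ x ≤ ψ x) (x : Space N) :
    discHeat h t φ x ≤ discHeat h t ψ x := by
  rw [discHeat_eq_integral h ht hφ, discHeat_eq_integral h ht hψ]
  exact integral_mono (integrable_walk _ _ hφ _) (integrable_walk _ _ hψ _) fun j => hle _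

lemma discHeat_const (h : ℝ) {t : ℝ} (ht : 0 ≤ t) (c : ℝ) (x : Space N) :
    discHeat h t (fun _ => c) x = c := by
  rw [discHeat_eq_integral h ht (bdd_const N c)]
  simp

/-- A bounded function whose discrete Laplacian is at most `C` grows at rate at most `C`. -/
lemma discHeat_le_add_mul (h : ℝ) {φ : Space N → ℝ} (hφ : ∃ C, ∀ x, |φ x| ≤ C) {C : ℝ}
    (hC : ∀ x, discLap h φ x ≤ C) (x : Space N) {t : ℝ} (ht : 0 ≤ t) :
    discHeat h t φ x ≤ φ x + C * t := by
  -- The time derivative is `e^{tΔ_h} Δ_h φ`, which is at most `e^{tΔ_h} C = C` by positivity and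
  -- preservation of constants.
  have hanti : AntitoneOn (fun t => discHeat h t φ x - C * t) (Ici 0) := by
    have hd : ∀ t, HasDerivAt (fun t => discHeat h t φ x - C * t)
        (discHeat h t (discLap h φ) x - C * 1) t := fun t =>
      (hasDerivAt_discHeat h hφ x t).sub ((hasDerivAt_id t).const_mul C)
    refine antitoneOn_of_deriv_nonpos (convex_Ici 0)
      (fun t _ => (hd t).continuousAt.continuousWithinAt)
      (fun t _ => (hd t).differentiableAt.differentiableWithinAt) fun t ht => ?_
    rw [(hd t).deriv]
    rw [interior_Ici] at ht
    have := discHeat_mono h (le_of_lt ht) (discLap_bdd h hφ) (bdd_const N C) hC x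
    rw [discHeat_const h (le_of_lt ht)] at this
    linarith
  have := hanti (mem_Ici.2 le_rfl) (mem_Ici.2 ht) ht
  simp only [discHeat_zero] at this
  linarith

lemma discLap_reflect (h : ℝ) (φ : Space N → ℝ) (x : Space N) :
    discLap h (fun y => φ (x + x - y)) = fun y => discLap h φ (x + x - y) := by
  ext y
  simp only [discLap]
  refine Finset.sum_congr rfl fun k _ => ?_
  rw [← sub_sub, sub_sub_eq_add_sub (x + x) y, add_sub_right_comm (x + x)]
  ring

/-- The walk is symmetric. Averaging with the reflected function replaces first differences by
second differences. -/
lemma discHeat_reflect (h t : ℝ) (φ : Space N → ℝ) (x : Space N) :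
    discHeat h t (fun y => φ (x + x - y)) x = discHeat h t φ x := by
  have : ∀ n, (discLap h)^[n] (fun y => φ (x + x - y)) =
      fun y => (discLap h)^[n] φ (x + x - y) := by
    intro n
    induction n with
    | zero => rfl
    | succ n ih => rw [Function.iterate_succ_apply', ih, Function.iterate_succ_apply',
        discLap_reflect]
  simp only [discHeat, this, add_sub_cancel_right]

lemma discLap_const_mul (h c : ℝ) (φ : Space N → ℝ) :
    discLap h (fun y => c * φ y) = fun y => c * discLap h φ y := by
  ext y
  simp only [discLap, Finset.mul_sum]
  exact Finset.sum_congr rfl fun k _ => by ring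

/-- Used with the real and imaginary parts of plane waves, this yields the characteristic function
of the grid walk. -/
lemma discHeat_eigen (h t : ℝ) {φ : Space N → ℝ} {l : ℝ} (hl : discLap h φ = fun y => l * φ y)
    (x : Space N) : discHeat h t φ x = Real.exp (t * l) * φ x := by
  have : ∀ n, (discLap h)^[n] φ = fun y => l ^ n * φ y := by
    intro n
    induction n with
    | zero => simp
    | succ n ih =>
      rw [Function.iterate_succ_apply', ih, discLap_const_mul, hl]
      ext y; ring
  simp only [discHeat, this]
  have hs := (NormedSpace.expSeries_div_hasSum_exp (t * l)).mul_right (φ x)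
  rw [← Real.exp_eq_exp_ℝ] at hs
  rw [← hs.tsum_eq]
  congr 1; ext n
  ring

/-! ### Transition probabilities of the walk in terms of Bessel functions -/

lemma walk_real_singleton (s : ℝ≥0) (j : Fin N → ℤ) :
    (walk N s).real {j} = ∏ k, (skellam s).real {j k} := by
  rw [walk, measureReal_def, Measure.pi_singleton, ENNReal.toReal_prod]
  rfl

/-- Summing over the value `k` of the second Poisson variable, the first one must equal `k + m`; the
resulting series of products of Poisson weights is the power series of `I_m`. -/
lemma skellam_real_natCast (s : ℝ≥0) (m : ℕ) :
    (skellam s).real {(m : ℤ)} = Real.exp (-2 * s) * besselI m (2 * s) := by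
  have h1 : (skellam s).real {(m : ℤ)}
      = ∫ p : ℕ × ℕ, (if p.1 = p.2 + m then (1 : ℝ) else 0)
          ∂((poissonMeasure s).prod (poissonMeasure s)) := by
    rw [← integral_indicator_one (measurableSet_singleton _), skellam,
      integral_map .of_discrete .of_discrete]
    congr 1; ext p
    simp only [indicator, mem_singleton_iff, Pi.one_apply]
    congr 1
    simp only [eq_iff_iff]
    omega
  have h2 : ∀ b : ℕ, ∫ a : ℕ, (if a = b + m then (1 : ℝ) else 0) ∂poissonMeasure s
      = Real.exp (-s) * s ^ (b + m) / (b + m).factorial := by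
    intro b
    rw [← poissonMeasure_real_singleton, ← integral_indicator_one (measurableSet_singleton _)]
    congr 1; ext a
    simp [indicator]
  rw [h1, integral_prod_symm _ (integrable_of_bdd (C := 1) _ fun p => by split_ifs <;> simp)]
  simp only [h2]
  rw [integral_poissonMeasure, besselI, ← tsum_mul_left]
  congr 1; ext k
  have e : Real.exp (-2 * s) = Real.exp (-s) * Real.exp (-s) := by
    rw [← Real.exp_add]; ring_nf
  rw [e, smul_eq_mul, mul_div_cancel_left₀ _ (two_ne_zero), pow_add, pow_add, pow_mul']
  field_simp

lemma skellam_neg (s : ℝ≥0) : (skellam s).map (fun m => -m) = skellam s := by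
  rw [skellam, Measure.map_map .of_discrete .of_discrete]
  conv_rhs => rw [← Measure.prod_swap, Measure.map_map .of_discrete .of_discrete]
  congr 1; ext p
  simp

lemma skellam_real_singleton (s : ℝ≥0) (m : ℤ) :
    (skellam s).real {m} = Real.exp (-2 * s) * besselI m.natAbs (2 * s) := by
  obtain h | h := m.natAbs_eq
  · rw [← skellam_real_natCast, ← h]
  · rw [← skellam_real_natCast]
    conv_lhs => rw [← skellam_neg, map_measureReal_apply .of_discrete (measurableSet_singleton _)]
    congr 1; ext a
    simp only [mem_preimage, mem_singleton_iff]
    omega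

/-- The link between the Bessel products defining `C_σ` and the random walk; afterwards the Bessel
series are no longer used. -/
lemma walk_real_singleton_eq_discKernel {t : ℝ} (ht : 0 ≤ t) (j : Fin N → ℤ) :
    (walk N t.toNNReal).real {j} = discKernel j t := by
  rw [walk_real_singleton]
  simp only [skellam_real_singleton, Real.coe_toNNReal _ ht]
  rw [Finset.prod_mul_distrib, discKernel, Finset.prod_const, Finset.card_univ, Fintype.card_fin,
    ← Real.exp_nat_mul]
  congr 2; ring

end DiscreteHeat

end

section

open scoped ENNReal NNReal
open ProbabilityTheory

/-! ### The discrete fractional Laplacian -/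

section DiscreteFracLap

variable {N : ℕ} {σ : ℝ}

/-- The normalizing constant `1 / |Γ(-σ/2)|`. -/
def heatConst (σ : ℝ) : ℝ := 1 / |Real.Gamma (-σ / 2)|

lemma heatConst_nonneg (σ : ℝ) : 0 ≤ heatConst σ := by unfold heatConst; positivity

/-- Near `0` the integrand is at most `B t^(-σ/2)`, integrable because `σ < 2`; at infinity it is at
most `A t^(-1-σ/2)`, integrable because `σ > 0`. This is the majorant for all the time integrals. -/
lemma integrableOn_min_div (hσ : σ ∈ Ioo (0 : ℝ) 2) {A B : ℝ} (hA : 0 ≤ A) (hB : 0 ≤ B) :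
    IntegrableOn (fun t : ℝ => min A (B * t) / t ^ (1 + σ / 2)) (Ioi 0) := by
  obtain ⟨h0, h2⟩ := hσ
  have hm : Measurable fun t : ℝ => min A (B * t) / t ^ (1 + σ / 2) := by fun_prop
  have hnn : ∀ t : ℝ, 0 < t → 0 ≤ min A (B * t) / t ^ (1 + σ / 2) := fun t ht => by positivity
  rw [← Ioc_union_Ioi_eq_Ioi zero_le_one]
  refine IntegrableOn.union ?_ ?_
  · have h1 : IntegrableOn (fun t : ℝ => B * t ^ (-(σ / 2))) (Ioc 0 1) := by
      have := (intervalIntegral.intervalIntegrable_rpow' (a := 0) (b := 1)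
        (r := -(σ / 2)) (by linarith)).const_mul B
      rwa [intervalIntegrable_iff_integrableOn_Ioc_of_le zero_le_one] at this
    refine Integrable.mono' h1 hm.aestronglyMeasurable ?_
    refine (ae_restrict_iff' measurableSet_Ioc).2 (ae_of_all _ fun t ht => ?_)
    rw [Real.norm_eq_abs, abs_of_nonneg (hnn t ht.1), div_le_iff₀ (Real.rpow_pos_of_pos ht.1 _),
      mul_assoc, ← Real.rpow_add ht.1]
    simp
  · have h1 : IntegrableOn (fun t : ℝ => A * t ^ (-(1 + σ / 2))) (Ioi 1) :=
      (integrableOn_Ioi_rpow_of_lt (by linarith) zero_lt_one).const_mul A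
    refine Integrable.mono' h1 hm.aestronglyMeasurable ?_
    refine (ae_restrict_iff' measurableSet_Ioi).2 (ae_of_all _ fun t ht => ?_)
    have ht0 : 0 < t := lt_trans zero_lt_one ht
    rw [Real.norm_eq_abs, abs_of_nonneg (hnn t ht0), Real.rpow_neg ht0.le, ← div_eq_mul_inv]
    gcongr
    exact min_le_left _ _

lemma discLap_neg (h : ℝ) (φ : Space N → ℝ) :
    discLap h (fun y => -φ y) = fun y => -discLap h φ y := by
  have := discLap_const_mul h (-1) φ
  simpa using this

lemma discHeat_neg (h t : ℝ) (φ : Space N → ℝ) (x : Space N) :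
    discHeat h t (fun y => -φ y) x = -discHeat h t φ x := by
  have : ∀ n, (discLap h)^[n] (fun y => -φ y) = fun y => -(discLap h)^[n] φ y := by
    intro n
    induction n with
    | zero => rfl
    | succ n ih => rw [Function.iterate_succ_apply', ih, Function.iterate_succ_apply', discLap_neg]
  simp only [discHeat, this, mul_neg, tsum_neg]

lemma bdd_neg {X : Type*} {φ : X → ℝ} (hφ : ∃ C, ∀ x, |φ x| ≤ C) : ∃ C, ∀ x, |-φ x| ≤ C := by
  simpa only [abs_neg] using hφ

/-- For a general bounded `φ` the constant `B` depends on `h`, so this only makes the integral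
converge at fixed `h`. The bound uniform in `h` is `abs_discHeat_sub_le_min`. -/
lemma abs_discHeat_sub_le (h : ℝ) {φ : Space N → ℝ} {C : ℝ} (hφ : ∀ x, |φ x| ≤ C) {B : ℝ}
    (hB : ∀ x, |discLap h φ x| ≤ B) (x : Space N) {t : ℝ} (ht : 0 ≤ t) :
    |discHeat h t φ x - φ x| ≤ min (2 * C) (B * t) := by
  refine le_min ?_ (abs_sub_le_iff.2 ⟨?_, ?_⟩)
  · have h1 := discHeat_mono h ht ⟨C, hφ⟩ (bdd_const N C) (fun x => (abs_le.1 (hφ x)).2) x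
    have h2 := discHeat_mono h ht (bdd_const N (-C)) ⟨C, hφ⟩ (fun x => (abs_le.1 (hφ x)).1) x
    rw [discHeat_const h ht] at h1 h2
    have := abs_le.1 (hφ x)
    rw [abs_le]
    constructor <;> linarith
  · have := discHeat_le_add_mul h ⟨C, hφ⟩ (fun x => (abs_le.1 (hB x)).2) x ht
    linarith
  · have := discHeat_le_add_mul h (bdd_neg ⟨C, hφ⟩) (C := B)
      (fun x => by rw [discLap_neg]; linarith [(abs_le.1 (hB x)).1]) x ht
    rw [discHeat_neg] at this
    linarith

lemma measurable_discHeat_div (σ h : ℝ) {φ : Space N → ℝ} (hφ : ∃ C, ∀ x, |φ x| ≤ C)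
    (x : Space N) : Measurable fun t : ℝ => (discHeat h t φ x - φ x) / t ^ (1 + σ / 2) := by
  have := (continuous_discHeat h hφ x).measurable
  fun_prop

lemma integrableOn_discHeat (hσ : σ ∈ Ioo (0 : ℝ) 2) (h : ℝ) {φ : Space N → ℝ}
    (hφ : ∃ C, ∀ x, |φ x| ≤ C) (x : Space N) :
    IntegrableOn (fun t : ℝ => (discHeat h t φ x - φ x) / t ^ (1 + σ / 2)) (Ioi 0) := by
  obtain ⟨B, hB⟩ := discLap_bdd h hφ
  have hφ' := hφ
  obtain ⟨C, hC⟩ := hφ'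
  have hB0 : 0 ≤ B := (abs_nonneg _).trans (hB x)
  have hC0 : 0 ≤ C := (abs_nonneg _).trans (hC x)
  refine Integrable.mono' (integrableOn_min_div hσ (by positivity : 0 ≤ 2 * C) hB0)
    (measurable_discHeat_div σ h hφ x).aestronglyMeasurable ?_
  refine (ae_restrict_iff' measurableSet_Ioi).2 (ae_of_all _ fun t ht => ?_)
  have ht0 : (0 : ℝ) < t := ht
  rw [Real.norm_eq_abs, abs_div, abs_of_nonneg (by positivity : 0 ≤ t ^ (1 + σ / 2))]
  gcongr
  exact abs_discHeat_sub_le h hC hB x ht0.le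

lemma negDiscFracLap_neg (σ h : ℝ) (φ : Space N → ℝ) (x : Space N) :
    negDiscFracLap σ h (fun y => -φ y) x = -negDiscFracLap σ h φ x := by
  simp only [negDiscFracLap, discHeat_neg]
  rw [← mul_neg, ← integral_neg]
  congr 2; ext t
  ring

lemma discHeat_add (h : ℝ) {t : ℝ} (ht : 0 ≤ t) {φ ψ : Space N → ℝ}
    (hφ : ∃ C, ∀ x, |φ x| ≤ C) (hψ : ∃ C, ∀ x, |ψ x| ≤ C) (x : Space N) :
    discHeat h t (fun y => φ y + ψ y) x = discHeat h t φ x + discHeat h t ψ x := by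
  have hs : ∃ C, ∀ x, |φ x + ψ x| ≤ C := by
    obtain ⟨C, hC⟩ := hφ
    obtain ⟨D, hD⟩ := hψ
    exact ⟨C + D, fun x => (abs_add_le _ _).trans (add_le_add (hC x) (hD x))⟩
  rw [discHeat_eq_integral h ht hφ, discHeat_eq_integral h ht hψ, discHeat_eq_integral h ht hs,
    integral_add (integrable_walk _ _ hφ _) (integrable_walk _ _ hψ _)]

lemma negDiscFracLap_add_const (σ h c : ℝ) {φ : Space N → ℝ} (hφ : ∃ C, ∀ x, |φ x| ≤ C)
    (x : Space N) : negDiscFracLap σ h (fun y => φ y + c) x = negDiscFracLap σ h φ x := by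
  simp only [negDiscFracLap]
  congr 1
  refine setIntegral_congr_fun measurableSet_Ioi fun t ht => ?_
  simp only [discHeat_add h (le_of_lt ht) hφ (bdd_const N c), discHeat_const h (le_of_lt ht)]
  congr 1; ring

/-- A uniform upper bound for the discrete fractional Laplacian. -/
lemma negDiscFracLap_le (hσ : σ ∈ Ioo (0 : ℝ) 2) (h : ℝ) {φ : Space N → ℝ}
    (hφ : ∃ C, ∀ x, |φ x| ≤ C) (x : Space N) {A B : ℝ} (hA : 0 ≤ A) (hB : 0 ≤ B)
    (h1 : ∀ y, φ y ≤ φ x + A) (h2 : ∀ y, discLap h φ y ≤ B) :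
    negDiscFracLap σ h φ x
      ≤ heatConst σ * ∫ t in Ioi (0 : ℝ), min A (B * t) / t ^ (1 + σ / 2) := by
  refine mul_le_mul_of_nonneg_left ?_ (heatConst_nonneg σ)
  refine setIntegral_mono_on (integrableOn_discHeat hσ h hφ x) (integrableOn_min_div hσ hA hB)
    measurableSet_Ioi fun t ht => ?_
  have ht0 : (0 : ℝ) < t := ht
  gcongr
  refine le_min ?_ ?_
  · have := discHeat_mono h ht0.le hφ (bdd_const N (φ x + A)) h1 x
    rw [discHeat_const h ht0.le] at this
    linarith
  · have := discHeat_le_add_mul h hφ h2 x ht0.le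
    linarith

/-! ### Return probabilities, the total jump weight and monotonicity -/

open Classical in
/-- The indicator function of a point. -/
def pointInd (z : Space N) : Space N → ℝ := fun y => if y = z then 1 else 0

lemma pointInd_bdd (z : Space N) : ∃ C, ∀ x, |pointInd z x| ≤ C :=
  ⟨1, fun x => by unfold pointInd; split_ifs <;> simp⟩

@[simp] lemma pointInd_self (z : Space N) : pointInd z z = 1 := by simp [pointInd]

lemma gridPt_injective {h : ℝ} (hh : h ≠ 0) :
    Function.Injective (gridPt h : (Fin N → ℤ) → Space N) := by
  intro i j hij
  ext k
  have := congrArg (fun z : Space N => z k) hij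
  simp only [gridPt_apply] at this
  exact_mod_cast mul_right_cancel₀ hh this

lemma discHeat_pointInd {h : ℝ} (hh : h ≠ 0) (x : Space N) (j : Fin N → ℤ) {t : ℝ} (ht : 0 ≤ t) :
    discHeat h t (pointInd (x + gridPt h j)) x = discKernel j (t / h ^ 2) := by
  rw [discHeat_eq_integral h ht (pointInd_bdd _),
    ← walk_real_singleton_eq_discKernel (by positivity),
    ← integral_indicator_one (measurableSet_singleton _)]
  congr 1; ext i
  simp only [pointInd, add_right_inj, (gridPt_injective hh).eq_iff, indicator, mem_singleton_iff,
    Pi.one_apply]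

lemma discHeat_pointInd_self {h : ℝ} (hh : h ≠ 0) (x : Space N) {t : ℝ} (ht : 0 ≤ t) :
    discHeat h t (pointInd x) x = discKernel (N := N) 0 (t / h ^ 2) := by
  have := discHeat_pointInd hh x 0 ht
  rwa [(gridPt_eq_zero_iff hh _).2 rfl, add_zero] at this

lemma hasSum_discKernel {t : ℝ} (ht : 0 ≤ t) :
    HasSum (fun j : Fin N → ℤ => discKernel j t) 1 := by
  have h := hasSum_integral_iUnion (μ := walk N t.toNNReal) (f := fun _ => (1 : ℝ))
    (s := fun j : Fin N → ℤ => {j}) (fun j => measurableSet_singleton j)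
    (fun i j hij => by simpa using hij) (integrable_const _).integrableOn
  simp only [iUnion_of_singleton, Measure.restrict_univ, integral_const, smul_eq_mul, mul_one,
    measureReal_restrict_apply_univ, probReal_univ,
    walk_real_singleton_eq_discKernel ht] at h
  exact h

lemma discKernel_nonneg {t : ℝ} (ht : 0 ≤ t) (j : Fin N → ℤ) : 0 ≤ discKernel j t := by
  rw [← walk_real_singleton_eq_discKernel ht]
  exact measureReal_nonneg

lemma hasSum_discKernel_ne {t : ℝ} (ht : 0 ≤ t) :
    HasSum (fun j : {j : Fin N → ℤ // j ≠ 0} => discKernel j.1 t) (1 - discKernel (N := N) 0 t) := by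
  have h := hasSum_discKernel (N := N) ht
  have := (hasSum_subtype_iff_indicator (s := {(0 : Fin N → ℤ)}ᶜ)
    (f := fun j : Fin N → ℤ => discKernel j t) (a := 1 - discKernel (N := N) 0 t)).2 (by
      have h2 := h.sub (hasSum_ite_eq (0 : Fin N → ℤ) (discKernel (N := N) 0 t))
      refine (congrArg (fun g => HasSum g _) (funext fun j => ?_)).mpr h2
      by_cases hj : j = 0 <;> simp [hj])
  exact this

/-- The total off-diagonal weight is the integral of the jump probability. -/
lemma cflConst_eq (hσ : σ ∈ Ioo (0 : ℝ) 2) :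
    cflConst N σ = heatConst σ *
      ∫ t in Ioi (0 : ℝ), (1 - discKernel (N := N) 0 t) / t ^ (1 + σ / 2) := by
  -- `1 - G(0, t)` is minus the increment of `e^{tΔ_1}` applied to the indicator of the origin, so
  -- its integrability is a case of `integrableOn_discHeat`.
  have hI : IntegrableOn (fun t : ℝ => (1 - discKernel (N := N) 0 t) / t ^ (1 + σ / 2))
      (Ioi 0) := by
    refine ((integrableOn_discHeat hσ 1 (pointInd_bdd (0 : Space N)) 0).neg).congr_fun
      (fun t ht => ?_) measurableSet_Ioi
    simp only [Pi.neg_apply, discHeat_pointInd_self one_ne_zero (0 : Space N) (le_of_lt ht),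
      pointInd_self]
    simp only [one_pow, div_one]
    ring
  have hmeas : ∀ j : Fin N → ℤ, AEStronglyMeasurable
      (fun t : ℝ => discKernel j t / t ^ (1 + σ / 2)) (volume.restrict (Ioi 0)) := fun j => by
    -- Measurability of the kernel in `t` is obtained from continuity of the semigroup, not from the
    -- Bessel series.
    have h1 : Measurable fun t : ℝ =>
        discHeat 1 t (pointInd ((0 : Space N) + gridPt 1 j)) 0 / t ^ (1 + σ / 2) := by
      have := (continuous_discHeat 1 (pointInd_bdd ((0 : Space N) + gridPt 1 j)) 0).measurable
      fun_prop
    refine h1.aestronglyMeasurable.congr ?_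
    refine (ae_restrict_iff' measurableSet_Ioi).2 (ae_of_all _ fun t ht => ?_)
    simp only [discHeat_pointInd one_ne_zero (0 : Space N) j (le_of_lt ht), one_pow, div_one]
  have hnn : ∀ (j : Fin N → ℤ) (t : ℝ), t ∈ Ioi (0 : ℝ) → 0 ≤ discKernel j t / t ^ (1 + σ / 2) :=
    fun j t ht => div_nonneg (discKernel_nonneg (le_of_lt ht) j)
      (Real.rpow_nonneg (le_of_lt ht) _)
  have hsum_le : ∀ (s : Finset {j : Fin N → ℤ // j ≠ 0}) (t : ℝ), t ∈ Ioi (0 : ℝ) →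
      ∑ j ∈ s, discKernel j.1 t / t ^ (1 + σ / 2)
        ≤ (1 - discKernel (N := N) 0 t) / t ^ (1 + σ / 2) := fun s t ht => by
    rw [← Finset.sum_div]
    have := Real.rpow_nonneg (le_of_lt ht : (0 : ℝ) ≤ t) (1 + σ / 2)
    gcongr
    exact sum_le_hasSum s (fun j _ => discKernel_nonneg (le_of_lt ht) _)
      (hasSum_discKernel_ne (le_of_lt ht))
  have hint : ∀ j : {j : Fin N → ℤ // j ≠ 0},
      IntegrableOn (fun t : ℝ => discKernel j.1 t / t ^ (1 + σ / 2)) (Ioi 0) := fun j => by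
    refine Integrable.mono' hI (hmeas j.1) ?_
    refine (ae_restrict_iff' measurableSet_Ioi).2 (ae_of_all _ fun t ht => ?_)
    rw [Real.norm_eq_abs, abs_of_nonneg (hnn _ _ ht)]
    simpa using hsum_le {j} t ht
  have hnorm : ∀ j : {j : Fin N → ℤ // j ≠ 0},
      ∫ t in Ioi (0 : ℝ), ‖discKernel j.1 t / t ^ (1 + σ / 2)‖
        = ∫ t in Ioi (0 : ℝ), discKernel j.1 t / t ^ (1 + σ / 2) := fun j =>
    setIntegral_congr_fun measurableSet_Ioi fun t ht => by
      simp only [Real.norm_eq_abs, abs_of_nonneg (hnn _ _ ht)]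
  have hsummable : Summable fun j : {j : Fin N → ℤ // j ≠ 0} =>
      ∫ t in Ioi (0 : ℝ), ‖discKernel j.1 t / t ^ (1 + σ / 2)‖ := by
    refine summable_of_sum_le (fun j => integral_nonneg fun _ => norm_nonneg _)
      (c := ∫ t in Ioi (0 : ℝ), (1 - discKernel (N := N) 0 t) / t ^ (1 + σ / 2)) fun s => ?_
    simp only [hnorm]
    rw [← integral_finsetSum _ fun j _ => hint j]
    exact setIntegral_mono_on (integrable_finsetSum _ fun j _ => hint j) hI measurableSet_Ioi
      (hsum_le s)
  have key := hasSum_integral_of_summable_integral_norm hint hsummable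
  have e : ∫ t in Ioi (0 : ℝ), ∑' j : {j : Fin N → ℤ // j ≠ 0}, discKernel j.1 t / t ^ (1 + σ / 2)
      = ∫ t in Ioi (0 : ℝ), (1 - discKernel (N := N) 0 t) / t ^ (1 + σ / 2) :=
    setIntegral_congr_fun measurableSet_Ioi fun t ht => by
      simp only [tsum_div_const, (hasSum_discKernel_ne (N := N) (le_of_lt ht)).tsum_eq]
  rw [e] at key
  have key2 := key.mul_left (heatConst σ)
  rw [← key2.tsum_eq, cflConst]
  congr 1; ext j
  simp [weight, heatConst]

/-- The substitution `t ↦ t / h²` contributes `h²` from the measure and `h^(-2-σ)` from the power.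
Hence `C_σ h^(-σ)` governs the operator on the grid of size `h`. -/
lemma cflConst_div_rpow_eq (hσ : σ ∈ Ioo (0 : ℝ) 2) {h : ℝ} (hh : 0 < h) :
    cflConst N σ / h ^ σ = heatConst σ *
      ∫ t in Ioi (0 : ℝ), (1 - discKernel (N := N) 0 (t / h ^ 2)) / t ^ (1 + σ / 2) := by
  have h2 : (0 : ℝ) < (h ^ 2)⁻¹ := by positivity
  have hc := integral_comp_mul_left_Ioi
    (fun t : ℝ => (1 - discKernel (N := N) 0 t) / t ^ (1 + σ / 2)) 0 h2
  rw [mul_zero, inv_inv, smul_eq_mul] at hc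
  have e : ∫ t in Ioi (0 : ℝ), (1 - discKernel (N := N) 0 (t / h ^ 2)) / t ^ (1 + σ / 2)
      = (1 / h ^ (2 + σ)) * ∫ t in Ioi (0 : ℝ),
        (1 - discKernel (N := N) 0 ((h ^ 2)⁻¹ * t)) / ((h ^ 2)⁻¹ * t) ^ (1 + σ / 2) := by
    rw [← integral_const_mul]
    refine setIntegral_congr_fun measurableSet_Ioi fun t ht => ?_
    have ht0 : (0 : ℝ) < t := ht
    have e1 : ((h ^ 2)⁻¹ * t) ^ (1 + σ / 2) = t ^ (1 + σ / 2) / h ^ (2 + σ) := by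
      have e0 : ((2 : ℕ) : ℝ) * (1 + σ / 2) = 2 + σ := by push_cast; ring
      rw [Real.mul_rpow h2.le ht0.le, Real.inv_rpow (by positivity), ← Real.rpow_natCast,
        ← Real.rpow_mul hh.le, e0, inv_mul_eq_div]
    rw [e1, div_eq_inv_mul t]
    have : (0 : ℝ) < h ^ (2 + σ) := by positivity
    field_simp
  rw [e, hc, cflConst_eq hσ, Real.rpow_add hh, Real.rpow_two]
  field_simp

/-- Comparison for the discrete fractional Laplacian: raising a function away from a point raises
the operator, and raising it at the point lowers the operator by at most the total weight. -/
lemma negDiscFracLap_sub_le (hσ : σ ∈ Ioo (0 : ℝ) 2) {h : ℝ} (hh : 0 < h) {φ ψ : Space N → ℝ}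
    (hφ : ∃ C, ∀ x, |φ x| ≤ C) (hψ : ∃ C, ∀ x, |ψ x| ≤ C) (hle : ∀ x, φ x ≤ ψ x) (x : Space N) :
    negDiscFracLap σ h φ x - negDiscFracLap σ h ψ x
      ≤ cflConst N σ / h ^ σ * (ψ x - φ x) := by
  have hδ := pointInd_bdd x
  rw [cflConst_div_rpow_eq hσ hh, negDiscFracLap, negDiscFracLap, ← mul_sub, ← heatConst,
    mul_assoc, ← integral_sub (integrableOn_discHeat hσ h hφ x) (integrableOn_discHeat hσ h hψ x),
    ← integral_mul_const]
  refine mul_le_mul_of_nonneg_left ?_ (heatConst_nonneg σ)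
  refine setIntegral_mono_on
    ((integrableOn_discHeat hσ h hφ x).sub (integrableOn_discHeat hσ h hψ x)) ?_
    measurableSet_Ioi fun t ht => ?_
  · refine IntegrableOn.congr_fun
      ((integrableOn_discHeat hσ h hδ x).neg.mul_const (ψ x - φ x)) (fun t ht => ?_)
      measurableSet_Ioi
    simp only [Pi.neg_apply, discHeat_pointInd_self hh.ne' x (le_of_lt ht), pointInd_self]
    ring
  · have ht0 : (0 : ℝ) < t := ht
    have hw : ∃ C, ∀ y, |(ψ x - φ x) * pointInd x y| ≤ C := by
      obtain ⟨C, hC⟩ := hδ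
      refine ⟨|ψ x - φ x| * C, fun y => ?_⟩
      rw [abs_mul]
      exact mul_le_mul_of_nonneg_left (hC y) (abs_nonneg _)
    -- `ψ` dominates `φ + (ψ x - φ x) 1_{x}`, and the semigroup sends the indicator of `x` to the
    -- return probability at `x`.
    have h1 : discHeat h t φ x + (ψ x - φ x) * discKernel (N := N) 0 (t / h ^ 2)
        ≤ discHeat h t ψ x := by
      have e : discHeat h t (fun y => (ψ x - φ x) * pointInd x y) x
          = (ψ x - φ x) * discKernel (N := N) 0 (t / h ^ 2) := by
        rw [← discHeat_pointInd_self hh.ne' x ht0.le, discHeat_eq_integral h ht0.le hw,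
          discHeat_eq_integral h ht0.le hδ, integral_const_mul]
      rw [← e, ← discHeat_add h ht0.le hφ hw]
      refine discHeat_mono h ht0.le ?_ hψ (fun y => ?_) x
      · obtain ⟨C, hC⟩ := hφ
        obtain ⟨D, hD⟩ := hw
        exact ⟨C + D, fun x => (abs_add_le _ _).trans (add_le_add (hC x) (hD x))⟩
      · by_cases hy : y = x
        · subst hy; simp
        · simpa [pointInd, hy] using hle y
    rw [div_sub_div_same, div_mul_eq_mul_div]
    gcongr
    linarith

end DiscreteFracLap

end

section

open scoped ENNReal NNReal
open ProbabilityTheory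

/-! ### A smooth bounded penalty function -/

section Penalty

variable {N : ℕ}

/-- The bounded smooth penalty `|x|² / (R² + |x|²)`. -/
def penalty (R : ℝ) (x : Space N) : ℝ := ‖x‖ ^ 2 / (R ^ 2 + ‖x‖ ^ 2)

lemma penalty_nonneg (R : ℝ) (x : Space N) : 0 ≤ penalty R x := by unfold penalty; positivity

lemma penalty_le_one (R : ℝ) (x : Space N) : penalty R x ≤ 1 :=
  div_le_one_of_le₀ (by nlinarith [sq_nonneg R]) (by positivity)

@[simp] lemma penalty_zero (R : ℝ) : penalty R (0 : Space N) = 0 := by simp [penalty]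

lemma penalty_bdd (R : ℝ) : ∃ C, ∀ x : Space N, |penalty R x| ≤ C :=
  ⟨1, fun x => by rw [abs_of_nonneg (penalty_nonneg R x)]; exact penalty_le_one R x⟩

lemma contDiff_penalty {R : ℝ} (hR : R ≠ 0) : ContDiff ℝ 2 (penalty R : Space N → ℝ) := by
  unfold penalty
  exact (contDiff_norm_sq ℝ).div (contDiff_const.add (contDiff_norm_sq ℝ)) fun x => by positivity

lemma penalty_mono {R : ℝ} (hR : R ≠ 0) {x : Space N} {r : ℝ} (hr : 0 ≤ r) (h : r ≤ ‖x‖) :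
    r ^ 2 / (R ^ 2 + r ^ 2) ≤ penalty R x := by
  unfold penalty
  rw [div_le_div_iff₀ (by positivity) (by positivity)]
  have : r ^ 2 ≤ ‖x‖ ^ 2 := by gcongr
  nlinarith [sq_nonneg R]

/-- If the penalty is small then the argument is small. -/
lemma norm_lt_of_penalty_lt {R : ℝ} (hR : R ≠ 0) {x : Space N} {r : ℝ} (hr : 0 ≤ r)
    (h : penalty R x < r ^ 2 / (R ^ 2 + r ^ 2)) : ‖x‖ < r := by
  by_contra hc
  exact absurd h (not_lt.2 (penalty_mono hR hr (not_lt.1 hc)))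

/-- Write the penalty as `1 - R² / (R² + s)` with `s = |x|²`. By the parallelogram law the values of
`s` at `x ± z` average to `|x|² + |z|²`, and `s ↦ 1 / (R² + s)` is convex. This gives an upper bound
uniform in `x` without computing derivatives. -/
lemma penalty_second_diff_le {R : ℝ} (hR : R ≠ 0) (x z : Space N) :
    penalty R (x + z) + penalty R (x - z) - 2 * penalty R x ≤ 2 * (‖z‖ ^ 2 / R ^ 2) := by
  have h1 := norm_add_sq_real x z
  have h2 := norm_sub_sq_real x z
  have hp : 0 < R ^ 2 := by positivity
  unfold penalty
  set a := ‖x‖ ^ 2 with ha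
  set c := ‖z‖ ^ 2 with hc
  set P := ‖x + z‖ ^ 2 with hP
  set Q := ‖x - z‖ ^ 2 with hQ
  set r := R ^ 2
  have ha0 : 0 ≤ a := by positivity
  have hc0 : 0 ≤ c := by positivity
  have hP0 : 0 ≤ P := by positivity
  have hQ0 : 0 ≤ Q := by positivity
  have hPQ : P + Q = 2 * a + 2 * c := by linarith
  have e : ∀ s : ℝ, 0 ≤ s → s / (r + s) = 1 - r / (r + s) := fun s hs => by
    field_simp; ring
  rw [e P hP0, e Q hQ0, e a ha0]
  have hconv : 2 / (r + a + c) ≤ 1 / (r + P) + 1 / (r + Q) := by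
    rw [div_add_div _ _ (by positivity) (by positivity), div_le_div_iff₀ (by positivity)
      (by positivity)]
    have : r + a + c = ((r + P) + (r + Q)) / 2 := by linarith
    rw [this]
    nlinarith [sq_nonneg (P - Q)]
  have h3 : 1 / (r + a) - 1 / (r + a + c) ≤ c / r ^ 2 := by
    rw [div_sub_div _ _ (by positivity) (by positivity), div_le_div_iff₀ (by positivity)
      (by positivity)]
    nlinarith [mul_nonneg hc0 ha0, mul_nonneg hc0 hc0, mul_nonneg (mul_nonneg hc0 ha0) hc0,
      mul_nonneg (mul_nonneg hc0 ha0) ha0, mul_nonneg (mul_nonneg hc0 ha0) hp.le,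
      mul_nonneg (mul_nonneg hc0 hc0) hp.le]
  have h4 := mul_le_mul_of_nonneg_left hconv hp.le
  have h5 := mul_le_mul_of_nonneg_left h3 hp.le
  have e1 : r * (c / r ^ 2) = c / r := by field_simp
  have e2 : ∀ s, r * (1 / s) = r / s := fun s => by ring
  have e3 : r * (2 / (r + a + c)) = 2 * (r / (r + a + c)) := by ring
  rw [e1, mul_sub, e2, e2] at h5
  rw [mul_add, e2, e2, e3] at h4
  linarith

lemma discLap_penalty_le {R : ℝ} (hR : R ≠ 0) {h : ℝ} (hh : h ≠ 0) (y x : Space N) :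
    discLap h (fun z => penalty R (z - y)) x ≤ 2 * N / R ^ 2 := by
  have : ∀ k ∈ (Finset.univ : Finset (Fin N)),
      (penalty R (x + h • EuclideanSpace.single k (1 : ℝ) - y) - 2 * penalty R (x - y)
      + penalty R (x - h • EuclideanSpace.single k (1 : ℝ) - y)) / h ^ 2 ≤ 2 / R ^ 2 := by
    intro k _
    have := penalty_second_diff_le hR (x - y) (h • EuclideanSpace.single k (1 : ℝ))
    rw [norm_smul, PiLp.norm_single, norm_one, mul_one, Real.norm_eq_abs, sq_abs,
      sub_add_eq_add_sub, sub_right_comm] at this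
    rw [div_le_iff₀ (by positivity)]
    have e : 2 / R ^ 2 * h ^ 2 = 2 * (h ^ 2 / R ^ 2) := by ring
    rw [e]
    linarith
  refine (Finset.sum_le_sum this).trans ?_
  simp only [Finset.sum_const, Finset.card_univ, Fintype.card_fin, nsmul_eq_mul]
  apply le_of_eq; ring

end Penalty

/-! ### The heat kernel and the local central limit theorem for the grid walk -/

section Heat

variable {N : ℕ}

/-- The heat kernel. -/
def heatKer (N : ℕ) (t : ℝ) (z : Space N) : ℝ :=
  (4 * Real.pi * t) ^ (-((N : ℝ) / 2)) * Real.exp (-(1 / (4 * t)) * ‖z‖ ^ 2)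

lemma heatKer_nonneg {t : ℝ} (ht : 0 < t) (z : Space N) : 0 ≤ heatKer N t z := by
  unfold heatKer; positivity

lemma measurable_heatKer : Measurable fun p : Space N × ℝ => heatKer N p.2 p.1 := by
  unfold heatKer; fun_prop

lemma measurable_heatKer_left (t : ℝ) : Measurable (heatKer N t) := by
  unfold heatKer; fun_prop

lemma integral_heatKer {t : ℝ} (ht : 0 < t) : ∫ z, heatKer N t z = 1 := by
  unfold heatKer
  rw [integral_const_mul, GaussianFourier.integral_rexp_neg_mul_sq_norm (by positivity),
    finrank_euclideanSpace, Fintype.card_fin]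
  have : Real.pi / (1 / (4 * t)) = 4 * Real.pi * t := by field_simp
  rw [this, ← Real.rpow_add (by positivity)]
  simp

lemma integrable_heatKer {t : ℝ} (ht : 0 < t) : Integrable (heatKer N t) :=
  Integrable.of_integral_ne_zero (by rw [integral_heatKer ht]; exact one_ne_zero)

/-- The Gaussian heat distribution at time `t`. -/
def heatLaw (N : ℕ) (t : ℝ) : Measure (Space N) :=
  volume.withDensity fun z => ENNReal.ofReal (heatKer N t z)

lemma isProbabilityMeasure_heatLaw {t : ℝ} (ht : 0 < t) : IsProbabilityMeasure (heatLaw N t) := by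
  constructor
  rw [heatLaw, withDensity_apply _ MeasurableSet.univ, Measure.restrict_univ,
    ← ofReal_integral_eq_lintegral_ofReal (integrable_heatKer ht)
      (ae_of_all _ (heatKer_nonneg ht)), integral_heatKer ht, ENNReal.ofReal_one]

lemma integral_heatLaw {E : Type*} [NormedAddCommGroup E] [NormedSpace ℝ E] {t : ℝ} (ht : 0 < t)
    (g : Space N → E) : ∫ z, g z ∂heatLaw N t = ∫ z, heatKer N t z • g z := by
  rw [heatLaw, integral_withDensity_eq_integral_toReal_smul
    (measurable_heatKer_left t).ennreal_ofReal (ae_of_all _ fun _ => ENNReal.ofReal_lt_top)]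
  congr 1; ext z
  rw [ENNReal.toReal_ofReal (heatKer_nonneg ht z)]

lemma charFun_heatLaw {t : ℝ} (ht : 0 < t) (ξ : Space N) :
    charFun (heatLaw N t) ξ = Complex.exp (-(t * ‖ξ‖ ^ 2 : ℝ)) := by
  have hb : 0 < ((1 / (4 * t) : ℝ) : ℂ).re := by
    rw [Complex.ofReal_re]; positivity
  -- The Gaussian integrals with and without the linear term share a prefactor, so their quotient is
  -- the characteristic function and the prefactor is never evaluated.
  have h := GaussianFourier.integral_cexp_neg_mul_sq_norm_add hb Complex.I ξ
  have h0 := GaussianFourier.integral_cexp_neg_mul_sq_norm_add hb 0 ξ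
  simp only [zero_mul, add_zero, ne_eq, OfNat.ofNat_ne_zero, not_false_eq_true, zero_pow,
    zero_div, Complex.exp_zero, mul_one] at h0
  rw [← h0] at h
  have h1 := integral_heatKer (N := N) ht
  have h2 : ((4 * Real.pi * t) ^ (-((N : ℝ) / 2)) : ℝ) *
      ∫ v : Space N, Complex.exp (-((1 / (4 * t) : ℝ) : ℂ) * ‖v‖ ^ 2) = 1 := by
    have : (∫ v : Space N, Complex.exp (-((1 / (4 * t) : ℝ) : ℂ) * ‖v‖ ^ 2))
        = ((∫ v : Space N, Real.exp (-(1 / (4 * t)) * ‖v‖ ^ 2) : ℝ) : ℂ) := by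
      rw [← integral_complex_ofReal]
      congr 1; ext v
      push_cast; rfl
    rw [this, ← Complex.ofReal_mul, ← integral_const_mul]
    unfold heatKer at h1
    rw [h1, Complex.ofReal_one]
  rw [charFun_apply, integral_heatLaw ht]
  have e : ∀ z : Space N, heatKer N t z • Complex.exp (inner ℝ z ξ * Complex.I)
      = ((4 * Real.pi * t) ^ (-((N : ℝ) / 2)) : ℝ) *
        Complex.exp (-((1 / (4 * t) : ℝ) : ℂ) * ‖z‖ ^ 2 + Complex.I * inner ℝ ξ z) := fun z => by
    rw [heatKer, Complex.real_smul, Complex.ofReal_mul, mul_assoc, Complex.ofReal_exp,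
      ← Complex.exp_add, real_inner_comm]
    congr 2
    push_cast; ring
  simp only [e]
  rw [integral_const_mul, h, ← mul_assoc, h2, one_mul]
  congr 1
  push_cast
  rw [Complex.I_sq]
  field_simp

/-- The law of the walk on the grid of size `h` at time `t`. -/
def gridLaw (N : ℕ) (h t : ℝ) : Measure (Space N) :=
  (walk N (t / h ^ 2).toNNReal).map (gridPt h)

instance (h t : ℝ) : IsProbabilityMeasure (gridLaw N h t) :=
  Measure.isProbabilityMeasure_map .of_discrete

lemma integral_gridLaw {E : Type*} [NormedAddCommGroup E] [NormedSpace ℝ E] (h t : ℝ)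
    {g : Space N → E} (hg : StronglyMeasurable g) :
    ∫ z, g z ∂gridLaw N h t = ∫ j, g (gridPt h j) ∂walk N (t / h ^ 2).toNNReal :=
  integral_map .of_discrete hg.aestronglyMeasurable

lemma discHeat_eq_integral_gridLaw (h : ℝ) {t : ℝ} (ht : 0 ≤ t) {φ : Space N → ℝ}
    (hφ : ∃ C, ∀ x, |φ x| ≤ C) (hc : Continuous φ) (x : Space N) :
    discHeat h t φ x = ∫ z, φ (x + z) ∂gridLaw N h t := by
  rw [discHeat_eq_integral h ht hφ, integral_gridLaw]
  exact (hc.comp (by fun_prop)).stronglyMeasurable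

/-- The symbol of the discrete Laplacian. -/
def discSymbol (h : ℝ) (ξ : Space N) : ℝ := ∑ k, (2 * Real.cos (h * ξ k) - 2) / h ^ 2

lemma inner_step (h : ℝ) (ξ : Space N) (k : Fin N) :
    inner ℝ (h • EuclideanSpace.single k (1 : ℝ)) ξ = h * ξ k := by
  rw [inner_smul_left, EuclideanSpace.inner_single_left]
  simp

lemma discLap_cos (h : ℝ) (ξ : Space N) :
    discLap h (fun x => Real.cos (inner ℝ x ξ))
      = fun x => discSymbol h ξ * Real.cos (inner ℝ x ξ) := by
  ext x
  rw [discLap, discSymbol, Finset.sum_mul]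
  refine Finset.sum_congr rfl fun k _ => ?_
  rw [inner_add_left, inner_sub_left, inner_step, Real.cos_add, Real.cos_sub]
  ring

lemma discLap_sin (h : ℝ) (ξ : Space N) :
    discLap h (fun x => Real.sin (inner ℝ x ξ))
      = fun x => discSymbol h ξ * Real.sin (inner ℝ x ξ) := by
  ext x
  rw [discLap, discSymbol, Finset.sum_mul]
  refine Finset.sum_congr rfl fun k _ => ?_
  rw [inner_add_left, inner_sub_left, inner_step, Real.sin_add, Real.sin_sub]
  ring

/-- The functions `cos ⟨x, ξ⟩` and `sin ⟨x, ξ⟩` are eigenfunctions of `Δ_h` with the same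
eigenvalue; evaluating the semigroup on them at the origin gives the characteristic function. -/
lemma charFun_gridLaw (h : ℝ) {t : ℝ} (ht : 0 ≤ t) (ξ : Space N) :
    charFun (gridLaw N h t) ξ = Complex.exp (t * discSymbol h ξ : ℝ) := by
  have hc := discHeat_eq_integral_gridLaw h ht (φ := fun x => Real.cos (inner ℝ x ξ))
    ⟨1, fun x => Real.abs_cos_le_one _⟩ (by fun_prop) 0
  have hs := discHeat_eq_integral_gridLaw h ht (φ := fun x => Real.sin (inner ℝ x ξ))
    ⟨1, fun x => Real.abs_sin_le_one _⟩ (by fun_prop) 0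
  rw [discHeat_eigen h t (discLap_cos h ξ)] at hc
  rw [discHeat_eigen h t (discLap_sin h ξ)] at hs
  simp only [inner_zero_left, Real.cos_zero, Real.sin_zero, mul_one, mul_zero, zero_add] at hc hs
  have e : ∀ z : Space N, Complex.exp (inner ℝ z ξ * Complex.I)
      = (Real.cos (inner ℝ z ξ) : ℂ) + (Real.sin (inner ℝ z ξ) : ℂ) * Complex.I := fun z => by
    rw [Complex.exp_mul_I, Complex.ofReal_cos, Complex.ofReal_sin]
  rw [charFun_apply]
  simp only [e]
  have i1 : Integrable (fun z : Space N => Real.cos (inner ℝ z ξ)) (gridLaw N h t) :=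
    Integrable.of_bound (by fun_prop) 1 (ae_of_all _ fun x => Real.abs_cos_le_one _)
  have i2 : Integrable (fun z : Space N => Real.sin (inner ℝ z ξ)) (gridLaw N h t) :=
    Integrable.of_bound (by fun_prop) 1 (ae_of_all _ fun x => Real.abs_sin_le_one _)
  rw [integral_add i1.ofReal (i2.ofReal.mul_const _), integral_mul_const,
    integral_complex_ofReal, integral_complex_ofReal, ← hc, ← hs]
  simp

lemma tendsto_discSymbol (ξ : Space N) :
    Tendsto (fun h => discSymbol h ξ) (𝓝[>] 0) (𝓝 (-‖ξ‖ ^ 2)) := by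
  have key : ∀ a : ℝ, Tendsto (fun h : ℝ => (2 * Real.cos (h * a) - 2) / h ^ 2) (𝓝[>] 0)
      (𝓝 (-a ^ 2)) := by
    intro a
    -- By the half-angle formula `2 cos(ha) - 2 = -4 sin²(ha/2)`, so only the derivative of the sine
    -- at `0` is needed.
    have hs : Tendsto (fun h : ℝ => Real.sin (h * (a / 2)) / h) (𝓝[>] 0) (𝓝 (a / 2)) := by
      have hd : HasDerivAt (fun h : ℝ => Real.sin (h * (a / 2))) (a / 2) 0 := by
        have := ((hasDerivAt_id (0 : ℝ)).mul_const (a / 2)).sin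
        simpa using this
      have := hd.tendsto_slope
      refine (this.mono_left (nhdsWithin_mono _ fun x hx => ne_of_gt hx)).congr fun h => ?_
      simp [slope_def_field]
    have h2 := (hs.pow 2).const_mul (-4)
    have e : -4 * (a / 2) ^ 2 = -a ^ 2 := by ring
    rw [e] at h2
    refine h2.congr fun h => ?_
    have : Real.cos (h * a) = 1 - 2 * Real.sin (h * (a / 2)) ^ 2 := by
      rw [show h * a = 2 * (h * (a / 2)) by ring, Real.cos_two_mul, Real.cos_sq']
      ring
    rw [this, div_pow]
    ring
  have : -‖ξ‖ ^ 2 = ∑ k, -(ξ k) ^ 2 := by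
    rw [EuclideanSpace.real_norm_sq_eq, Finset.sum_neg_distrib]
  rw [this]
  exact tendsto_finsetSum _ fun k _ => key _

/-- Convergence of the discrete heat semigroup in law. -/
lemma tendsto_integral_gridLaw {t : ℝ} (ht : 0 < t) {g : Space N → ℝ} (hg : Continuous g)
    (hb : ∃ C, ∀ x, |g x| ≤ C) {ι : Type*} {l : Filter ι} [l.IsCountablyGenerated] {h : ι → ℝ}
    (hh : Tendsto h l (𝓝[>] 0)) :
    Tendsto (fun i => ∫ z, g z ∂gridLaw N (h i) t) l (𝓝 (∫ z, g z ∂heatLaw N t)) := by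
  have := isProbabilityMeasure_heatLaw (N := N) ht
  refine Filter.tendsto_of_seq_tendsto fun u hu => ?_
  have hu' := hh.comp hu
  let μ : ℕ → ProbabilityMeasure (Space N) := fun n => ⟨gridLaw N (h (u n)) t, inferInstance⟩
  let μ₀ : ProbabilityMeasure (Space N) := ⟨heatLaw N t, inferInstance⟩
  have hlim : Tendsto μ atTop (𝓝 μ₀) := by
    -- Lévy's continuity theorem: `exp(t · symbol)` converges pointwise to `exp(-t|ξ|²)`.
    rw [ProbabilityMeasure.tendsto_iff_tendsto_charFun]
    intro ξ
    show Tendsto (fun n => charFun (gridLaw N (h (u n)) t) ξ) atTop (𝓝 (charFun (heatLaw N t) ξ))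
    simp only [charFun_gridLaw _ ht.le, charFun_heatLaw ht]
    have h1 := ((tendsto_discSymbol ξ).comp hu').const_mul t
    have h2 := (Complex.continuous_exp.comp Complex.continuous_ofReal).continuousAt.tendsto.comp h1
    simpa [Function.comp_def] using h2
  obtain ⟨C, hC⟩ := hb
  exact ProbabilityMeasure.tendsto_iff_forall_integral_tendsto.1 hlim
    (BoundedContinuousFunction.ofNormedAddCommGroup g hg C hC)

/-- A bounded substitute for the second moment: the penalty vanishes at the origin and its discrete
Laplacian is at most `2N/R²`. With `R = 1` it controls small times, and with `R` large it gives
tightness uniformly in `h`. -/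
lemma integral_penalty_gridLaw_le {R : ℝ} (hR : R ≠ 0) {h : ℝ} (hh : h ≠ 0) {t : ℝ} (ht : 0 ≤ t) :
    ∫ z, penalty R z ∂gridLaw N h t ≤ 2 * N / R ^ 2 * t := by
  have hc : Continuous (penalty R : Space N → ℝ) := (contDiff_penalty hR).continuous
  have h1 := discHeat_eq_integral_gridLaw h ht (penalty_bdd R) hc 0
  have h2 := discHeat_le_add_mul h (penalty_bdd (N := N) R)
    (fun x => by simpa using discLap_penalty_le hR hh 0 x) 0 ht
  simp only [zero_add, penalty_zero] at h1 h2
  rwa [h1] at h2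

lemma integral_penalty_heatLaw_le {R : ℝ} (hR : R ≠ 0) {t : ℝ} (ht : 0 < t) :
    ∫ z, penalty R z ∂heatLaw N t ≤ 2 * N / R ^ 2 * t := by
  have hc : Continuous (penalty R : Space N → ℝ) := (contDiff_penalty hR).continuous
  refine le_of_tendsto (tendsto_integral_gridLaw ht hc (penalty_bdd R)
    (tendsto_id : Tendsto id (𝓝[>] (0 : ℝ)) _)) ?_
  filter_upwards [self_mem_nhdsWithin] with h hh
  exact integral_penalty_gridLaw_le hR (ne_of_gt hh) ht.le

end Heat

end

section

open scoped ENNReal NNReal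
open ProbabilityTheory

/-! ### The fractional Laplacian through second differences and through the heat semigroup -/

section FracLap

variable {N : ℕ} {σ : ℝ}

/-- The singular kernel `c / |z|^(N+σ)`. -/
def fracKer (σ : ℝ) (z : Space N) : ℝ := fracConst N σ / ‖z‖ ^ (N + σ)

lemma fracKer_nonneg (hσ : σ ∈ Ioo (0 : ℝ) 2) (z : Space N) : 0 ≤ fracKer σ z := by
  unfold fracKer fracConst
  have : 0 < Real.Gamma ((N + σ) / 2) := Real.Gamma_pos_of_pos (by have := hσ.1; positivity)
  positivity

lemma measurable_fracKer (σ : ℝ) : Measurable (fracKer σ : Space N → ℝ) := by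
  unfold fracKer; fun_prop

/-- The subordination formula. Inverting time turns the integral into Euler's integral for
`Γ((N+σ)/2)`, which accounts for the constant `c`. -/
lemma integral_heatKer_div (hσ : σ ∈ Ioo (0 : ℝ) 2) {z : Space N} (hz : z ≠ 0) :
    heatConst σ * ∫ t in Ioi (0 : ℝ), heatKer N t z / t ^ (1 + σ / 2) = fracKer σ z := by
  have hn : 0 < ‖z‖ := norm_pos_iff.2 hz
  set a : ℝ := ((N : ℝ) + σ) / 2 with ha
  have ha0 : 0 < a := by have := hσ.1; positivity
  have h1 := Real.integral_rpow_mul_exp_neg_mul_Ioi ha0 (r := ‖z‖ ^ 2 / 4) (by positivity)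
  rw [← integral_comp_rpow_Ioi _ (show (-1 : ℝ) ≠ 0 by norm_num)] at h1
  have h2 : ∫ t in Ioi (0 : ℝ), heatKer N t z / t ^ (1 + σ / 2)
      = (4 * Real.pi) ^ (-((N : ℝ) / 2)) * ((1 / (‖z‖ ^ 2 / 4)) ^ a * Real.Gamma a) := by
    rw [← h1, ← integral_const_mul]
    refine setIntegral_congr_fun measurableSet_Ioi fun t ht => ?_
    have ht0 : (0 : ℝ) < t := ht
    simp only [heatKer, abs_neg, abs_one, one_mul, smul_eq_mul]
    rw [Real.mul_rpow (by positivity) ht0.le, ← Real.rpow_mul ht0.le, ← mul_assoc (t ^ _),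
      ← Real.rpow_add ht0, div_eq_mul_inv, ← Real.rpow_neg ht0.le, Real.rpow_neg_one]
    have e1 : t ^ (-1 - 1 + -1 * (a - 1)) = t ^ (-((N : ℝ) / 2)) * t ^ (-(1 + σ / 2)) := by
      rw [← Real.rpow_add ht0]
      congr 1
      rw [ha]; ring
    have e2 : -(‖z‖ ^ 2 / 4 * t⁻¹) = -(1 / (4 * t)) * ‖z‖ ^ 2 := by field_simp
    rw [e1, e2]
    ring
  rw [h2, fracKer, heatConst, fracConst, one_div_div, Real.div_rpow (by norm_num) (by positivity),
    Real.mul_rpow (by norm_num) Real.pi_pos.le, Real.rpow_neg Real.pi_pos.le]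
  have e1 : (‖z‖ ^ 2) ^ a = ‖z‖ ^ ((N : ℝ) + σ) := by
    rw [← Real.rpow_natCast, ← Real.rpow_mul hn.le]
    congr 1
    rw [ha]; push_cast; ring
  have e2 : (4 : ℝ) ^ (-((N : ℝ) / 2)) * 4 ^ a = 2 ^ σ := by
    rw [← Real.rpow_add (by norm_num), show (4 : ℝ) = 2 ^ (2 : ℝ) by norm_num,
      ← Real.rpow_mul (by norm_num)]
    congr 1
    rw [ha]; ring
  rw [e1, ← e2]
  ring

lemma integrable_penalty {R : ℝ} (hR : R ≠ 0) (μ : Measure (Space N)) [IsFiniteMeasure μ] :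
    Integrable (penalty R : Space N → ℝ) μ :=
  Integrable.of_bound (contDiff_penalty hR).continuous.aestronglyMeasurable 1
    (ae_of_all _ fun z => by
      rw [Real.norm_eq_abs, abs_of_nonneg (penalty_nonneg R z)]; exact penalty_le_one R z)

/-- A function dominated by the penalty has a small integral against a probability measure with a
small penalty integral. -/
lemma integral_abs_le_min {D : Space N → ℝ} {C : ℝ} (hC : 0 ≤ C)
    (hD : ∀ z, |D z| ≤ C * penalty 1 z) {μ : Measure (Space N)} [IsProbabilityMeasure μ] {t : ℝ}
    (hμ : ∫ z, penalty 1 z ∂μ ≤ 2 * N * t) :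
    ∫ z, |D z| ∂μ ≤ min C (C * (2 * N) * t) := by
  have hi : Integrable (fun z : Space N => C * penalty 1 z) μ :=
    (integrable_penalty one_ne_zero μ).const_mul C
  have h1 : ∫ z, |D z| ∂μ ≤ ∫ z, C * penalty 1 z ∂μ :=
    integral_mono_of_nonneg (ae_of_all _ fun _ => abs_nonneg _) hi (ae_of_all _ hD)
  rw [integral_const_mul] at h1
  refine le_min (h1.trans ?_) (h1.trans ?_)
  · have h2 : ∫ z, penalty 1 z ∂μ ≤ ∫ _z, (1 : ℝ) ∂μ :=
      integral_mono (integrable_penalty one_ne_zero μ) (integrable_const _)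
        fun z => penalty_le_one 1 z
    rw [integral_const, probReal_univ, smul_eq_mul, mul_one] at h2
    exact mul_le_of_le_one_right hC h2
  · rw [mul_assoc]
    exact mul_le_mul_of_nonneg_left hμ hC

/-- Integration against the singular kernel is the time integral of the heat semigroup. -/
lemma integral_mul_fracKer (hσ : σ ∈ Ioo (0 : ℝ) 2) {D : Space N → ℝ} (hm : Measurable D) {C : ℝ}
    (hC : 0 ≤ C) (hD : ∀ z, |D z| ≤ C * penalty 1 z) :
    Integrable (fun z => D z * fracKer σ z) ∧
      ∫ z, D z * fracKer σ z
        = heatConst σ * ∫ t in Ioi (0 : ℝ), (∫ z, D z ∂heatLaw N t) / t ^ (1 + σ / 2) := by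
  let H : Space N × ℝ → ℝ := fun p => D p.1 * (heatKer N p.2 p.1 / p.2 ^ (1 + σ / 2))
  have hH : Measurable H := by
    have := measurable_heatKer (N := N)
    fun_prop
  have hDC : ∀ z, |D z| ≤ C := fun z =>
    (hD z).trans (mul_le_of_le_one_right hC (penalty_le_one 1 z))
  have hHt : ∀ t : ℝ, ∫ z, H (z, t) = (∫ z, heatKer N t z • D z) / t ^ (1 + σ / 2) := by
    intro t
    rw [← integral_div]
    congr 1; ext z
    simp only [H, smul_eq_mul]
    ring
  have hHn : ∀ t ∈ Ioi (0 : ℝ), ∫ z, ‖H (z, t)‖ ≤ min C (C * (2 * N) * t) / t ^ (1 + σ / 2) := by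
    intro t ht
    have ht0 : (0 : ℝ) < t := ht
    have := isProbabilityMeasure_heatLaw (N := N) ht0
    have e : ∫ z, ‖H (z, t)‖ = (∫ z, |D z| ∂heatLaw N t) / t ^ (1 + σ / 2) := by
      rw [integral_heatLaw ht0, ← integral_div]
      congr 1; ext z
      simp only [H, smul_eq_mul, Real.norm_eq_abs, abs_mul, abs_div]
      rw [abs_of_nonneg (heatKer_nonneg ht0 z), abs_of_nonneg (by positivity : 0 ≤ t ^ (1 + σ / 2))]
      ring
    rw [e]
    gcongr
    refine integral_abs_le_min hC hD ?_
    simpa using integral_penalty_heatLaw_le (N := N) one_ne_zero ht0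
  -- For Fubini the spatial integral comes first: at time `t` it is at most `min C (2NCt) /
  -- t^(1+σ/2)`, by the mean of the penalty under the heat law.
  have hint : Integrable H (volume.prod (volume.restrict (Ioi 0))) := by
    rw [integrable_prod_iff' hH.aestronglyMeasurable]
    constructor
    · refine (ae_restrict_iff' measurableSet_Ioi).2 (ae_of_all _ fun t ht => ?_)
      exact ((integrable_heatKer ht).div_const (t ^ (1 + σ / 2))).bdd_mul hm.aestronglyMeasurable
        (ae_of_all _ hDC)
    · refine Integrable.mono' (integrableOn_min_div hσ hC (by positivity : 0 ≤ C * (2 * (N : ℝ))))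
        (hH.norm.stronglyMeasurable.integral_prod_left').aestronglyMeasurable ?_
      refine (ae_restrict_iff' measurableSet_Ioi).2 (ae_of_all _ fun t ht => ?_)
      rw [Real.norm_eq_abs, abs_of_nonneg (integral_nonneg fun _ => norm_nonneg _)]
      exact hHn t ht
  have hz : ∀ z : Space N, heatConst σ * ∫ t in Ioi (0 : ℝ), H (z, t) = D z * fracKer σ z := by
    intro z
    simp only [H]
    rw [integral_const_mul]
    -- Subordination fails at the origin, but the domination by the penalty forces `D 0 = 0`.
    by_cases h0 : z = 0
    · have : D z = 0 := by
        have := hD z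
        rw [h0, penalty_zero, mul_zero] at this
        rw [h0]
        exact abs_nonpos_iff.1 this
      rw [this]; ring
    · rw [← integral_heatKer_div hσ h0]; ring
  refine ⟨?_, ?_⟩
  · refine (hint.integral_prod_left.const_mul (heatConst σ)).congr (ae_of_all _ fun z => ?_)
    exact hz z
  · simp only [← hz]
    rw [integral_const_mul, integral_integral_swap (f := fun z t => H (z, t)) hint]
    congr 1
    refine setIntegral_congr_fun measurableSet_Ioi fun t ht => ?_
    simp only [hHt, integral_heatLaw (show (0 : ℝ) < t from ht)]

/-- The symmetrized second difference. -/
def secondDiff (φ : Space N → ℝ) (x z : Space N) : ℝ := (φ (x + z) + φ (x - z) - 2 * φ x) / 2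

/-- The fractional Laplacian as an absolutely convergent integral of second differences. -/
def fracOp (σ : ℝ) (φ : Space N → ℝ) (x : Space N) : ℝ :=
  ∫ z, secondDiff φ x z * fracKer σ z

lemma measurable_secondDiff {φ : Space N → ℝ} (hc : Continuous φ) (x : Space N) :
    Measurable (secondDiff φ x) := by
  unfold secondDiff
  exact Continuous.measurable (by fun_prop)

lemma integrable_fracKer_restrict (hσ : σ ∈ Ioo (0 : ℝ) 2) {r : ℝ} (hr : 0 < r) :
    IntegrableOn (fracKer σ : Space N → ℝ) {z | r < ‖z‖} := by
  have hm : MeasurableSet {z : Space N | r < ‖z‖} := measurableSet_lt measurable_const measurable_norm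
  have h1 := (integral_mul_fracKer hσ (D := penalty 1 (N := N)) (C := 1)
    (contDiff_penalty one_ne_zero).continuous.measurable zero_le_one
    (fun z => by rw [abs_of_nonneg (penalty_nonneg 1 z), one_mul])).1
  set c := r ^ 2 / (1 ^ 2 + r ^ 2) with hc
  have hc0 : 0 < c := by positivity
  refine Integrable.mono' ((h1.const_mul c⁻¹).integrableOn (s := {z : Space N | r < ‖z‖}))
    (measurable_fracKer σ).aestronglyMeasurable ?_
  refine (ae_restrict_iff' hm).2 (ae_of_all _ fun z hz => ?_)
  rw [Real.norm_eq_abs, abs_of_nonneg (fracKer_nonneg hσ z), ← mul_assoc]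
  refine le_mul_of_one_le_left (fracKer_nonneg hσ z) ?_
  rw [inv_mul_eq_div, one_le_div hc0]
  exact penalty_mono one_ne_zero hr.le (le_of_lt hz)

/-- The truncation region is invariant under `z ↦ -z`, so each truncated integral equals its
symmetrization. Second differences are absolutely integrable against the kernel, and dominated
convergence identifies the limit. From here on the limit in the definition of `negFracLap` can be
ignored. -/
lemma negFracLap_eq_fracOp (hσ : σ ∈ Ioo (0 : ℝ) 2) {φ : Space N → ℝ} (hφ : Continuous φ)
    (hb : ∃ M, ∀ y, |φ y| ≤ M) (x : Space N) {C : ℝ} (hC : 0 ≤ C)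
    (hD : ∀ z, |secondDiff φ x z| ≤ C * penalty 1 z) :
    negFracLap σ φ x = fracOp σ φ x := by
  obtain ⟨M, hM⟩ := hb
  have hms : ∀ r : ℝ, MeasurableSet {z : Space N | r < ‖z‖} := fun r =>
    measurableSet_lt measurable_const measurable_norm
  have hI := (integral_mul_fracKer hσ (measurable_secondDiff hφ x) hC hD).1
  have htr : ∀ r : ℝ, 0 < r → truncFracLap σ r φ x
      = ∫ z, ({z : Space N | r < ‖z‖}.indicator fun z => secondDiff φ x z * fracKer σ z) z := by
    intro r hr
    rw [integral_indicator (hms r)]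
    have hk := integrable_fracKer_restrict (N := N) hσ hr
    have hi : ∀ s : ℝ, IntegrableOn (fun z => (φ (x + s • z) - φ x) * fracKer σ z)
        {z : Space N | r < ‖z‖} := fun s => by
      refine hk.bdd_mul (c := 2 * M)
        (Continuous.aestronglyMeasurable (by fun_prop)) (ae_of_all _ fun z => ?_)
      refine (abs_sub _ _).trans ?_
      linarith [hM (x + s • z), hM x]
    have e1 : ∫ z in {z : Space N | r < ‖z‖}, (φ (x + (-1 : ℝ) • z) - φ x) * fracKer σ z
        = truncFracLap σ r φ x := by
      rw [truncFracLap, ← integral_indicator (hms r), ← integral_indicator (hms r),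
        ← integral_neg_eq_self]
      congr 1; ext z
      simp [indicator, fracKer]
    have e2 : ∫ z in {z : Space N | r < ‖z‖}, (φ (x + (1 : ℝ) • z) - φ x) * fracKer σ z
        = truncFracLap σ r φ x := by
      simp only [one_smul]; rfl
    have e3 := integral_add (hi 1) (hi (-1))
    rw [e1, e2] at e3
    have e4 : truncFracLap σ r φ x = (truncFracLap σ r φ x + truncFracLap σ r φ x) / 2 := by ring
    rw [e4, ← e3, ← integral_div]
    congr 1; ext z
    simp only [one_smul, neg_smul, ← sub_eq_add_neg, secondDiff]
    ring
  refine Tendsto.limUnder_eq ?_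
  have hlim : Tendsto (fun r : ℝ => ∫ z, ({z : Space N | r < ‖z‖}.indicator
      fun z => secondDiff φ x z * fracKer σ z) z) (𝓝[>] 0) (𝓝 (fracOp σ φ x)) := by
    refine tendsto_integral_filter_of_dominated_convergence
      (fun z => ‖secondDiff φ x z * fracKer σ z‖) (Eventually.of_forall fun r =>
        (hI.indicator (hms r)).aestronglyMeasurable) (Eventually.of_forall fun r =>
        ae_of_all _ fun z => norm_indicator_le_norm_self _ _) hI.norm (ae_of_all _ fun z => ?_)
    by_cases h0 : z = 0
    · have : secondDiff φ x z = 0 := by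
        rw [h0]; simp [secondDiff]; ring
      refine tendsto_const_nhds.congr fun r => ?_
      by_cases hz : z ∈ {z : Space N | r < ‖z‖}
      · rw [indicator_of_mem hz]
      · rw [indicator_of_notMem hz, this, zero_mul]
    · refine tendsto_const_nhds.congr' ?_
      have : ∀ᶠ r : ℝ in 𝓝[>] 0, r < ‖z‖ :=
        (eventually_lt_nhds (norm_pos_iff.2 h0)).filter_mono nhdsWithin_le_nhds
      filter_upwards [this] with r hr
      rw [indicator_of_mem (show z ∈ {z : Space N | r < ‖z‖} from hr)]
  refine hlim.congr' ?_
  filter_upwards [self_mem_nhdsWithin] with r hr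
  exact (htr r hr).symm

end FracLap

end

section

open scoped ENNReal NNReal
open ProbabilityTheory

/-! ### Consistency of the discrete fractional Laplacian -/

section Consistency

variable {N : ℕ} {σ : ℝ}

lemma discHeat_sub_eq_integral_secondDiff (h : ℝ) {t : ℝ} (ht : 0 ≤ t) {φ : Space N → ℝ}
    (hb : ∃ C, ∀ x, |φ x| ≤ C) (hc : Continuous φ) (x : Space N) :
    discHeat h t φ x - φ x = ∫ z, secondDiff φ x z ∂gridLaw N h t := by
  obtain ⟨C, hC⟩ := hb
  have h1 := discHeat_eq_integral_gridLaw h ht ⟨C, hC⟩ hc x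
  have h2 := discHeat_eq_integral_gridLaw h ht (φ := fun y => φ (x + x - y))
    ⟨C, fun y => hC _⟩ (by fun_prop) x
  rw [discHeat_reflect] at h2
  have e : ∀ z, φ (x + x - (x + z)) = φ (x - z) := fun z => by congr 1; abel
  simp only [e] at h2
  have i : ∀ s : ℝ, Integrable (fun z => φ (x + s • z)) (gridLaw N h t) := fun s =>
    Integrable.of_bound (Continuous.aestronglyMeasurable (by fun_prop)) C (ae_of_all _ fun z => hC _)
  have i1 : Integrable (fun z => φ (x + z)) (gridLaw N h t) := by simpa using i 1
  have i2 : Integrable (fun z => φ (x - z)) (gridLaw N h t) := by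
    simpa [← sub_eq_add_neg] using i (-1)
  simp only [secondDiff]
  have i12 : Integrable (fun z => φ (x + z) + φ (x - z)) (gridLaw N h t) := i1.add i2
  rw [integral_div, integral_sub i12 (integrable_const _), integral_add i1 i2, ← h1, ← h2]
  simp only [integral_const, probReal_univ, one_smul]
  ring

lemma abs_discHeat_sub_le_min {h : ℝ} (hh : h ≠ 0) {t : ℝ} (ht : 0 ≤ t) {φ : Space N → ℝ}
    (hb : ∃ C, ∀ x, |φ x| ≤ C) (hc : Continuous φ) (x : Space N) {C : ℝ} (hC : 0 ≤ C)
    (hD : ∀ z, |secondDiff φ x z| ≤ C * penalty 1 z) :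
    |discHeat h t φ x - φ x| ≤ min C (C * (2 * N) * t) := by
  rw [discHeat_sub_eq_integral_secondDiff h ht hb hc]
  refine (norm_integral_le_integral_norm (f := fun z => secondDiff φ x z)).trans ?_
  refine integral_abs_le_min hC hD ?_
  simpa using integral_penalty_gridLaw_le (N := N) one_ne_zero hh ht

variable {ι : Type*} {l : Filter ι} [l.IsCountablyGenerated] {h : ι → ℝ}

/-- Convergence in law also for test functions that converge locally uniformly. -/
lemma tendsto_integral_gridLaw_of_tendstoUniformlyOn {t : ℝ} (ht : 0 < t)
    (hh : Tendsto h l (𝓝[>] 0)) {g : ι → Space N → ℝ} {g₀ : Space N → ℝ} {M : ℝ}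
    (hg : ∀ᶠ i in l, Continuous (g i)) (hg₀ : Continuous g₀) (hM : ∀ᶠ i in l, ∀ z, |g i z| ≤ M)
    (hM₀ : ∀ z, |g₀ z| ≤ M)
    (hu : ∀ R : ℝ, TendstoUniformlyOn g g₀ l (Metric.closedBall 0 R)) :
    Tendsto (fun i => ∫ z, g i z ∂gridLaw N (h i) t) l (𝓝 (∫ z, g₀ z ∂heatLaw N t)) := by
  have h0 := tendsto_integral_gridLaw ht hg₀ ⟨M, hM₀⟩ hh
  suffices hs : Tendsto (fun i => ∫ z, g i z ∂gridLaw N (h i) t - ∫ z, g₀ z ∂gridLaw N (h i) t)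
      l (𝓝 0) by simpa using hs.add h0
  have hMn : 0 ≤ M := (abs_nonneg _).trans (hM₀ 0)
  rw [Metric.tendsto_nhds]
  intro ε hε
  -- Outside the ball of radius `R` the penalty is at least `1/2` and `|g i - g₀| ≤ 2M`, so `4M`
  -- times the penalty covers the tail; its mean is small for large `R`, uniformly in `h`.
  obtain ⟨R, hR0, hR⟩ : ∃ R : ℝ, 0 < R ∧ 4 * M * (2 * N / R ^ 2 * t) < ε / 2 := by
    have : Tendsto (fun R : ℝ => 4 * M * (2 * N * t) / R ^ 2) atTop (𝓝 0) :=
      tendsto_const_nhds.div_atTop (tendsto_pow_atTop two_ne_zero)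
    obtain ⟨R, hR, hR'⟩ := ((this.eventually (gt_mem_nhds (half_pos hε))).and
      (eventually_gt_atTop 0)).exists
    exact ⟨R, hR', by rwa [← mul_div_right_comm, ← mul_div_assoc]⟩
  have hev := (Metric.tendstoUniformlyOn_iff.1 (hu R)) (ε / 2) (half_pos hε)
  filter_upwards [hev, hg, hM, hh.eventually self_mem_nhdsWithin] with i hi hgi hMi hhi
  have i1 : Integrable (g i) (gridLaw N (h i) t) :=
    Integrable.of_bound hgi.aestronglyMeasurable M (ae_of_all _ hMi)
  have i2 : Integrable g₀ (gridLaw N (h i) t) :=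
    Integrable.of_bound hg₀.aestronglyMeasurable M (ae_of_all _ hM₀)
  rw [← integral_sub i1 i2, Real.dist_eq, sub_zero]
  have hpt : ∀ z, ‖g i z - g₀ z‖ ≤ ε / 2 + 4 * M * penalty R z := by
    intro z
    by_cases hz : z ∈ Metric.closedBall (0 : Space N) R
    · have := hi z hz
      rw [dist_comm, Real.dist_eq] at this
      rw [Real.norm_eq_abs]
      have := mul_nonneg (by positivity : 0 ≤ 4 * M) (penalty_nonneg R z)
      linarith
    · have hz' : R ≤ ‖z‖ := by
        rw [mem_closedBall_zero_iff, not_le] at hz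
        exact hz.le
      have h1 := penalty_mono hR0.ne' hR0.le hz'
      have h2 : R ^ 2 / (R ^ 2 + R ^ 2) = 1 / 2 := by field_simp; norm_num
      rw [h2] at h1
      have h3 : ‖g i z - g₀ z‖ ≤ |g i z| + |g₀ z| := abs_sub _ _
      have := mul_le_mul_of_nonneg_left h1 (by positivity : 0 ≤ 4 * M)
      linarith [hMi z, hM₀ z]
  have ip : Integrable (fun z : Space N => ε / 2 + 4 * M * penalty R z) (gridLaw N (h i) t) :=
    (integrable_const _).add ((integrable_penalty hR0.ne' _).const_mul _)
  refine lt_of_le_of_lt (norm_integral_le_of_norm_le ip (ae_of_all _ hpt)) ?_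
  rw [integral_add (integrable_const _) ((integrable_penalty hR0.ne' _).const_mul _),
    integral_const_mul]
  have := mul_le_mul_of_nonneg_left (integral_penalty_gridLaw_le (N := N) hR0.ne' (ne_of_gt hhi)
    ht.le) (by positivity : 0 ≤ 4 * M)
  simp only [integral_const, probReal_univ, smul_eq_mul, one_mul]
  linarith

/-- Abstract consistency statement. -/
lemma tendsto_negDiscFracLap (hσ : σ ∈ Ioo (0 : ℝ) 2) (hh : Tendsto h l (𝓝[>] 0))
    {g : ι → Space N → ℝ} {g₀ : Space N → ℝ} {X : ι → Space N} {x₀ : Space N} {M C : ℝ}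
    (hC : 0 ≤ C) (hg : ∀ᶠ i in l, Continuous (g i)) (hg₀ : Continuous g₀)
    (hM : ∀ᶠ i in l, ∀ z, |g i z| ≤ M)
    (hD : ∀ᶠ i in l, ∀ z, |secondDiff (g i) (X i) z| ≤ C * penalty 1 z)
    (hD₀ : ∀ z, |secondDiff g₀ x₀ z| ≤ C * penalty 1 z)
    (hu : ∀ R : ℝ, TendstoUniformlyOn (fun i => secondDiff (g i) (X i)) (secondDiff g₀ x₀) l
      (Metric.closedBall 0 R)) :
    Tendsto (fun i => negDiscFracLap σ (h i) (g i) (X i)) l (𝓝 (fracOp σ g₀ x₀)) := by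
  have hfr : fracOp σ g₀ x₀ = heatConst σ * ∫ t in Ioi (0 : ℝ),
      (∫ z, secondDiff g₀ x₀ z ∂heatLaw N t) / t ^ (1 + σ / 2) :=
    (integral_mul_fracKer hσ (measurable_secondDiff hg₀ x₀) hC hD₀).2
  rw [hfr]
  refine Tendsto.const_mul (heatConst σ) ?_
  -- Dominated convergence in `t`. At fixed `t` the integrand converges by the convergence in law,
  -- and the majorant is uniform because the second differences share the constant `C`.
  refine tendsto_integral_filter_of_dominated_convergence
    (fun t => min C (C * (2 * N) * t) / t ^ (1 + σ / 2)) ?_ ?_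
    (integrableOn_min_div hσ hC (by positivity)) ?_
  · filter_upwards [hM] with i hi
    exact (measurable_discHeat_div σ (h i) ⟨M, hi⟩ (X i)).aestronglyMeasurable
  · filter_upwards [hM, hg, hD, hh.eventually self_mem_nhdsWithin] with i hi hgi hDi hhi
    refine (ae_restrict_iff' measurableSet_Ioi).2 (ae_of_all _ fun t ht => ?_)
    have ht0 : (0 : ℝ) < t := ht
    rw [Real.norm_eq_abs, abs_div, abs_of_nonneg (by positivity : 0 ≤ t ^ (1 + σ / 2))]
    gcongr
    exact abs_discHeat_sub_le_min (ne_of_gt hhi) ht0.le ⟨M, hi⟩ hgi (X i) hC hDi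
  · refine (ae_restrict_iff' measurableSet_Ioi).2 (ae_of_all _ fun t ht => ?_)
    have ht0 : (0 : ℝ) < t := ht
    refine Tendsto.div_const ?_ _
    have key := tendsto_integral_gridLaw_of_tendstoUniformlyOn ht0 hh
      (g := fun i => secondDiff (g i) (X i)) (g₀ := secondDiff g₀ x₀) (M := C)
      (by
        filter_upwards [hg] with i hgi
        unfold secondDiff; fun_prop)
      (by unfold secondDiff; fun_prop)
      (by
        filter_upwards [hD] with i hDi z
        exact (hDi z).trans (mul_le_of_le_one_right hC (penalty_le_one 1 z)))
      (fun z => (hD₀ z).trans (mul_le_of_le_one_right hC (penalty_le_one 1 z))) hu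
    refine key.congr' ?_
    filter_upwards [hM, hg] with i hi hgi
    exact (discHeat_sub_eq_integral_secondDiff (h i) ht0.le ⟨M, hi⟩ hgi (X i)).symm

/-- Test functions have second differences dominated by the penalty, locally uniformly. -/
lemma exists_secondDiff_bound {T : ℝ} {φ : Space N → ℝ → ℝ} (hφ : IsTest T φ) (x₀ : Space N)
    (t₀ : ℝ) : ∃ C : ℝ, 0 ≤ C ∧ ∀ᶠ p : Space N × ℝ in 𝓝 (x₀, t₀), p.2 ∈ Icc 0 T →
      ∀ z, |secondDiff (fun y => φ y p.2) p.1 z| ≤ C * penalty 1 z := by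
  obtain ⟨hc, M, hM⟩ := hφ
  set Φ : Space N × ℝ → ℝ := fun p => φ p.1 p.2 with hΦ
  -- A `C²` function has a gradient that is Lipschitz near `(x₀, t₀)`, which controls small `z`. For
  -- `|z| ≥ r` the penalty is at least `c` and the bound `M` suffices.
  have hd : ContDiff ℝ 1 (fderiv ℝ Φ) := hc.fderiv_right (by norm_num)
  obtain ⟨K, s, hs, hK⟩ := hd.contDiffAt (x := (x₀, t₀)).exists_lipschitzOnWith
  obtain ⟨r', hr', hball⟩ := Metric.mem_nhds_iff.1 hs
  set r := min (r' / 2) 1 with hr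
  have hr0 : 0 < r := by positivity
  set c := r ^ 2 / (1 ^ 2 + r ^ 2) with hcdef
  have hc0 : 0 < c := by positivity
  refine ⟨2 * K + 2 * |M| / c, by positivity, ?_⟩
  filter_upwards [Metric.ball_mem_nhds (x₀, t₀) (by positivity : 0 < r' / 2)] with p hp hpT z
  have hpen := penalty_nonneg 1 z
  by_cases hz : ‖z‖ < r
  · have hmem : ∀ τ ∈ Icc (-1 : ℝ) 1, (p.1 + τ • z, p.2) ∈ s := by
      intro τ hτ
      apply hball
      have h1 : dist ((p.1 + τ • z, p.2) : Space N × ℝ) p ≤ ‖z‖ := by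
        rw [Prod.dist_eq]
        refine max_le ?_ (by simp)
        rw [dist_eq_norm, add_sub_cancel_left, norm_smul]
        exact mul_le_of_le_one_left (norm_nonneg _) (abs_le.2 ⟨hτ.1, hτ.2⟩)
      rw [Metric.mem_ball] at hp ⊢
      have := dist_triangle ((p.1 + τ • z, p.2) : Space N × ℝ) p (x₀, t₀)
      have : r ≤ r' / 2 := min_le_left _ _
      linarith
    have hder : ∀ (ε τ : ℝ), HasDerivAt (fun τ : ℝ => Φ (p.1 + (ε * τ) • z, p.2))
        (fderiv ℝ Φ (p.1 + (ε * τ) • z, p.2) (ε • z, 0)) τ := by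
      intro ε τ
      have hΦd : HasFDerivAt Φ (fderiv ℝ Φ (p.1 + (ε * τ) • z, p.2)) (p.1 + (ε * τ) • z, p.2) :=
        (hc.differentiable (by norm_num) _).hasFDerivAt
      have hl : HasDerivAt (fun τ : ℝ => ((p.1 + (ε * τ) • z, p.2) : Space N × ℝ))
          (ε • z, 0) τ := by
        refine HasDerivAt.prodMk ?_ (hasDerivAt_const _ _)
        have := ((((hasDerivAt_id τ).const_mul ε)).smul_const z).const_add p.1
        simpa using this
      exact hΦd.comp_hasDerivAt τ hl
    -- The mean value inequality is applied to `τ ↦ Φ(x + τz) + Φ(x - τz)`, whose derivative is a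
    -- difference of gradients at distance at most `2|z|`.
    have hmv := norm_image_sub_le_of_norm_deriv_le_segment_01'
      (f := fun τ : ℝ => Φ (p.1 + (1 * τ) • z, p.2) + Φ (p.1 + (-1 * τ) • z, p.2))
      (C := 2 * K * ‖z‖ ^ 2)
      (fun τ _ => ((hder 1 τ).add (hder (-1) τ)).hasDerivWithinAt) (by
        intro τ hτ
        have e : fderiv ℝ Φ (p.1 + (1 * τ) • z, p.2) ((1 : ℝ) • z, 0)
            + fderiv ℝ Φ (p.1 + (-1 * τ) • z, p.2) ((-1 : ℝ) • z, 0)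
            = (fderiv ℝ Φ (p.1 + (1 * τ) • z, p.2) - fderiv ℝ Φ (p.1 + (-1 * τ) • z, p.2))
              (z, 0) := by
          have : ((-1 : ℝ) • z, (0 : ℝ)) = -((z, 0) : Space N × ℝ) := by simp
          rw [this, map_neg, one_smul, sub_apply, sub_eq_add_neg]
        rw [e]
        refine (ContinuousLinearMap.le_opNorm _ _).trans ?_
        have hn : ‖((z, 0) : Space N × ℝ)‖ = ‖z‖ := by simp [Prod.norm_def]
        have hL := hK.dist_le_mul _ (hmem (1 * τ) ⟨by linarith [hτ.1], by linarith [hτ.2]⟩) _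
          (hmem (-1 * τ) ⟨by linarith [hτ.2], by linarith [hτ.1]⟩)
        rw [dist_eq_norm] at hL
        have hdist : dist ((p.1 + (1 * τ) • z, p.2) : Space N × ℝ) (p.1 + (-1 * τ) • z, p.2)
            ≤ 2 * ‖z‖ := by
          rw [Prod.dist_eq]
          refine max_le ?_ (by simp)
          rw [dist_eq_norm, add_sub_add_left_eq_sub, ← sub_smul, norm_smul]
          gcongr
          rw [Real.norm_eq_abs, abs_le]
          constructor <;> linarith [hτ.1, hτ.2]
        rw [hn]
        calc _ ≤ K * (2 * ‖z‖) * ‖z‖ := by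
              gcongr
              exact hL.trans (by gcongr)
          _ = _ := by ring)
    have e : secondDiff (fun y => φ y p.2) p.1 z
        = ((Φ (p.1 + ((1 : ℝ) * 1) • z, p.2) + Φ (p.1 + (-1 * (1 : ℝ)) • z, p.2))
          - (Φ (p.1 + ((1 : ℝ) * 0) • z, p.2) + Φ (p.1 + (-1 * (0 : ℝ)) • z, p.2))) / 2 := by
      simp only [secondDiff, hΦ, mul_one, one_smul, neg_smul, mul_zero, zero_smul, add_zero,
        ← sub_eq_add_neg]
      ring
    rw [e, abs_div, abs_two]
    rw [Real.norm_eq_abs] at hmv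
    have hz1 : ‖z‖ < 1 := hz.trans_le (min_le_right _ _)
    have hpen2 : ‖z‖ ^ 2 / 2 ≤ penalty 1 z := by
      unfold penalty
      gcongr
      nlinarith [norm_nonneg z]
    have h3 : (0 : ℝ) ≤ 2 * |M| / c * penalty 1 z := by positivity
    have h4 := mul_le_mul_of_nonneg_left hpen2 (by positivity : (0 : ℝ) ≤ 2 * K)
    rw [add_mul]
    have h5 : 2 * (K : ℝ) * ‖z‖ ^ 2 / 2 = 2 * K * (‖z‖ ^ 2 / 2) := by ring
    calc _ ≤ 2 * (K : ℝ) * ‖z‖ ^ 2 / 2 := by gcongr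
      _ ≤ _ := by rw [h5]; linarith
  · have h1 := penalty_mono one_ne_zero hr0.le (not_lt.1 hz)
    have hMx : ∀ y, |φ y p.2| ≤ |M| := fun y => (hM y p.2 hpT).trans (le_abs_self M)
    have h2 : |secondDiff (fun y => φ y p.2) p.1 z| ≤ 2 * |M| := by
      have a1 := abs_le.1 (hMx (p.1 + z))
      have a2 := abs_le.1 (hMx (p.1 - z))
      have a3 := abs_le.1 (hMx p.1)
      simp only [secondDiff]
      rw [abs_le]
      constructor <;> linarith [a1.1, a1.2, a2.1, a2.2, a3.1, a3.2]
    have h3 : 2 * |M| ≤ 2 * |M| / c * penalty 1 z := by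
      rw [div_mul_eq_mul_div, le_div_iff₀ hc0]
      gcongr
    have h4 : 0 ≤ 2 * (K : ℝ) * penalty 1 z := by positivity
    rw [add_mul]
    linarith

lemma IsTest.continuous {T : ℝ} {φ : Space N → ℝ → ℝ} (hφ : IsTest T φ) :
    Continuous fun p : Space N × ℝ => φ p.1 p.2 := hφ.1.continuous

lemma IsTest.continuous_slice {T : ℝ} {φ : Space N → ℝ → ℝ} (hφ : IsTest T φ) (t : ℝ) :
    Continuous fun y => φ y t :=
  hφ.continuous.comp (by fun_prop : Continuous fun y : Space N => (y, t))

lemma IsTest.negFracLap_eq (hσ : σ ∈ Ioo (0 : ℝ) 2) {T : ℝ} {φ : Space N → ℝ → ℝ}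
    (hφ : IsTest T φ) (x : Space N) {t : ℝ} (ht : t ∈ Icc 0 T) :
    negFracLap σ (fun y => φ y t) x = fracOp σ (fun y => φ y t) x := by
  obtain ⟨C, hC, hev⟩ := exists_secondDiff_bound hφ x t
  obtain ⟨M, hM⟩ := hφ.2
  exact negFracLap_eq_fracOp hσ (hφ.continuous_slice t) ⟨M, fun y => hM y t ht⟩ x hC
    (hev.self_of_nhds ht)

/-- Consistency of the scheme's diffusion operator for test functions. -/
lemma IsTest.tendsto_negDiscFracLap (hσ : σ ∈ Ioo (0 : ℝ) 2) {T : ℝ} {φ : Space N → ℝ → ℝ}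
    (hφ : IsTest T φ) {x₀ : Space N} {t₀ : ℝ} (ht₀ : t₀ ∈ Icc 0 T) {X : ι → Space N} {θ : ι → ℝ}
    (hh : Tendsto h l (𝓝[>] 0)) (hX : Tendsto X l (𝓝 x₀)) (hθ : Tendsto θ l (𝓝 t₀))
    (hθT : ∀ᶠ i in l, θ i ∈ Icc 0 T) :
    Tendsto (fun i => negDiscFracLap σ (h i) (fun y => φ y (θ i)) (X i)) l
      (𝓝 (negFracLap σ (fun y => φ y t₀) x₀)) := by
  rw [hφ.negFracLap_eq hσ x₀ ht₀]
  obtain ⟨C, hC, hev⟩ := exists_secondDiff_bound hφ x₀ t₀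
  obtain ⟨M, hM⟩ := hφ.2
  have hp : Tendsto (fun i => (X i, θ i)) l (𝓝 (x₀, t₀)) := hX.prodMk_nhds hθ
  refine FracHJB.tendsto_negDiscFracLap hσ hh hC (M := M)
    (Eventually.of_forall fun i => hφ.continuous_slice _) (hφ.continuous_slice _) ?_
    ?_ (hev.self_of_nhds ht₀) ?_
  · filter_upwards [hθT] with i hi z using hM z _ hi
  · filter_upwards [hθT, hp.eventually hev] with i hi hi2 using hi2 hi
  · intro R
    -- Currying a jointly continuous function gives a continuous map into the compact-open topology,
    -- and this is exactly local uniform convergence in `z`.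
    let G : C((Space N × ℝ) × Space N, ℝ) :=
      ⟨fun q => secondDiff (fun y => φ y q.1.2) q.1.1 q.2, by
        have hc := hφ.continuous
        have e : ∀ f : (Space N × ℝ) × Space N → Space N, Continuous f →
            Continuous fun q => φ (f q) q.1.2 := fun f hf =>
          hc.comp (hf.prodMk (by fun_prop))
        unfold secondDiff
        exact (((e _ (by fun_prop)).add (e _ (by fun_prop))).sub
          ((e _ (by fun_prop)).const_mul 2)).div_const 2⟩
    have hcur : Tendsto (fun i => G.curry (X i, θ i)) l (𝓝 (G.curry (x₀, t₀))) :=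
      (G.curry.continuous.tendsto _).comp hp
    exact ContinuousMap.tendsto_iff_forall_isCompact_tendstoUniformlyOn.1 hcur _
      (isCompact_closedBall 0 R)

end Consistency

end

section

open scoped ENNReal NNReal Manifold ContDiff
open ProbabilityTheory

/-! ### Tools for the comparison principle -/

section Insertion

/-- Smooth insertion between semicontinuous functions that are strictly ordered. -/
lemma exists_contDiff_between {E : Type*} [NormedAddCommGroup E] [NormedSpace ℝ E]
    [FiniteDimensional ℝ E] {S S' : Set E} (hS : IsClosed S) (hS' : IsClosed S') {a b : E → ℝ}
    (ha : UpperSemicontinuousOn a S) (hb : LowerSemicontinuousOn b S') {B : ℝ} (hB : 0 ≤ B)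
    (haB : ∀ x ∈ S, |a x| < B) (hbB : ∀ x ∈ S', |b x| < B)
    (hab : ∀ x ∈ S, x ∈ S' → a x < b x) :
    ∃ w : E → ℝ, ContDiff ℝ 2 w ∧ (∀ x ∈ S, a x < w x) ∧ (∀ x ∈ S', w x < b x) ∧
      ∀ x, |w x| ≤ B := by
  -- The constraints at each point are convex, so a partition of unity glues local solutions. By
  -- semicontinuity a constant solves them near each point: a midpoint where both constraints act,
  -- `±B` where only one does.
  obtain ⟨w, hw⟩ := exists_contMDiffMap_forall_mem_convex_of_local_const (n := 2) 𝓘(ℝ, E)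
    (t := fun x : E => {y : ℝ | x ∈ S → a x < y} ∩ {y : ℝ | x ∈ S' → y < b x} ∩ Icc (-B) B)
    (fun x => by
      refine Convex.inter (Convex.inter ?_ ?_) (convex_Icc _ _)
      · by_cases hx : x ∈ S
        · simp only [hx, forall_true_left]; exact convex_Ioi (a x)
        · simpa [hx] using convex_univ
      · by_cases hx : x ∈ S'
        · simp only [hx, forall_true_left]; exact convex_Iio (b x)
        · simpa [hx] using convex_univ)
    (fun x => by
      have hSn : x ∉ S → ∀ᶠ y in 𝓝 x, y ∉ S := fun h => hS.isOpen_compl.mem_nhds h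
      have hSn' : x ∉ S' → ∀ᶠ y in 𝓝 x, y ∉ S' := fun h => hS'.isOpen_compl.mem_nhds h
      have hSa : x ∈ S → ∀ c, a x < c → ∀ᶠ y in 𝓝 x, y ∈ S → a y < c := fun h c hc =>
        eventually_nhdsWithin_iff.1 (ha x h c hc)
      have hSb : x ∈ S' → ∀ c, c < b x → ∀ᶠ y in 𝓝 x, y ∈ S' → c < b y := fun h c hc =>
        eventually_nhdsWithin_iff.1 (hb x h c hc)
      by_cases h1 : x ∈ S <;> by_cases h2 : x ∈ S'
      · have h3 := hab x h1 h2
        have h4 := abs_lt.1 (haB x h1)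
        have h5 := abs_lt.1 (hbB x h2)
        refine ⟨(a x + b x) / 2, ?_⟩
        filter_upwards [hSa h1 ((a x + b x) / 2) (by linarith),
          hSb h2 ((a x + b x) / 2) (by linarith)] with y hy1 hy2
        exact ⟨⟨hy1, hy2⟩, by linarith [h4.1, h5.1], by linarith [h4.2, h5.2]⟩
      · refine ⟨B, ?_⟩
        filter_upwards [hSa h1 B (abs_lt.1 (haB x h1)).2, hSn' h2] with y hy1 hy2
        exact ⟨⟨hy1, fun h => absurd h hy2⟩, by linarith, le_rfl⟩
      · refine ⟨-B, ?_⟩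
        filter_upwards [hSb h2 (-B) (abs_lt.1 (hbB x h2)).1, hSn h1] with y hy1 hy2
        exact ⟨⟨fun h => absurd h hy2, hy1⟩, le_rfl, by linarith⟩
      · refine ⟨0, ?_⟩
        filter_upwards [hSn h1, hSn' h2] with y hy1 hy2
        exact ⟨⟨fun h => absurd h hy1, fun h => absurd h hy2⟩, by linarith, hB⟩)
  exact ⟨w, contMDiff_iff_contDiff.1 w.contMDiff, fun x hx => (hw x).1.1 hx,
    fun x hx => (hw x).1.2 hx, fun x => abs_le.2 (hw x).2⟩

end Insertion

section Comparison

variable {N : ℕ} {σ : ℝ}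

/-- An upper bound for the fractional Laplacian of the penalty of size `R`. -/
def penaltyOp (N : ℕ) (σ R : ℝ) : ℝ :=
  ∫ z : Space N, min 1 (‖z‖ ^ 2 / R ^ 2) * fracKer σ z

lemma min_one_sq_le_penalty (z : Space N) : min 1 (‖z‖ ^ 2) ≤ 2 * penalty 1 z := by
  unfold penalty
  rw [← mul_div_assoc, le_div_iff₀ (by positivity)]
  rcases le_total 1 (‖z‖ ^ 2) with h | h
  · rw [min_eq_left h]; linarith
  · rw [min_eq_right h]; nlinarith [sq_nonneg ‖z‖]

lemma integrable_mul_fracKer_of_le (hσ : σ ∈ Ioo (0 : ℝ) 2) {D : Space N → ℝ} (hm : Measurable D)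
    {C : ℝ} (hC : 0 ≤ C) (hD : ∀ z, |D z| ≤ C * min 1 (‖z‖ ^ 2)) :
    Integrable fun z => D z * fracKer σ z :=
  (integral_mul_fracKer hσ hm (C := C * 2) (by positivity) fun z => by
    refine (hD z).trans ?_
    rw [mul_assoc]
    exact mul_le_mul_of_nonneg_left (min_one_sq_le_penalty z) hC).1

lemma integrable_penaltyOp (hσ : σ ∈ Ioo (0 : ℝ) 2) {R : ℝ} (hR : R ≠ 0) :
    Integrable fun z : Space N => min 1 (‖z‖ ^ 2 / R ^ 2) * fracKer σ z := by
  refine integrable_mul_fracKer_of_le hσ (by fun_prop) (C := 1 + 1 / R ^ 2) (by positivity)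
    fun z => ?_
  have h1 : (0 : ℝ) ≤ 1 / R ^ 2 := by positivity
  rw [abs_of_nonneg (by positivity)]
  rcases le_total 1 (‖z‖ ^ 2) with h | h
  · rw [min_eq_left h]
    exact (min_le_left _ _).trans (by linarith)
  · rw [min_eq_right h]
    refine (min_le_right _ _).trans ?_
    rw [div_eq_mul_one_div]
    nlinarith [sq_nonneg ‖z‖]

lemma tendsto_integral_mul_fracKer_zero (hσ : σ ∈ Ioo (0 : ℝ) 2) {ι : Type*} {l : Filter ι}
    [l.IsCountablyGenerated] {D : ι → Space N → ℝ} {C : ℝ} (hC : 0 ≤ C)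
    (hm : ∀ i, Measurable (D i)) (hD : ∀ᶠ i in l, ∀ z, |D i z| ≤ C * min 1 (‖z‖ ^ 2))
    (hlim : ∀ z, z ≠ 0 → Tendsto (fun i => D i z) l (𝓝 0)) :
    Tendsto (fun i => ∫ z, D i z * fracKer σ z) l (𝓝 0) := by
  have h0 : ∫ _z : Space N, (0 : ℝ) = 0 := by simp
  rw [← h0]
  have hi : Integrable fun z : Space N => (C * min 1 (‖z‖ ^ 2)) * fracKer σ z :=
    integrable_mul_fracKer_of_le hσ (by fun_prop) hC fun z => by
      rw [abs_of_nonneg (by positivity)]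
  refine tendsto_integral_filter_of_dominated_convergence _
    (Eventually.of_forall fun i => ((hm i).mul (measurable_fracKer σ)).aestronglyMeasurable) ?_ hi
    (ae_of_all _ fun z => ?_)
  · filter_upwards [hD] with i hi
    refine ae_of_all _ fun z => ?_
    rw [norm_mul, Real.norm_eq_abs, Real.norm_eq_abs, abs_of_nonneg (fracKer_nonneg hσ z)]
    exact mul_le_mul_of_nonneg_right (hi z) (fracKer_nonneg hσ z)
  · by_cases hz : z = 0
    · refine tendsto_const_nhds.congr' ?_
      filter_upwards [hD] with i hi
      have := hi z
      rw [hz] at this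
      simp at this
      rw [hz, this, zero_mul]
    · simpa using (hlim z hz).mul_const (fracKer σ z)

lemma tendsto_penaltyOp (hσ : σ ∈ Ioo (0 : ℝ) 2) :
    Tendsto (penaltyOp N σ) atTop (𝓝 0) := by
  refine tendsto_integral_mul_fracKer_zero hσ zero_le_one (fun R => by fun_prop) ?_ ?_
  · filter_upwards [eventually_ge_atTop 1] with R hR z
    rw [abs_of_nonneg (by positivity), one_mul]
    refine min_le_min_left _ (div_le_self (by positivity) ?_)
    nlinarith
  · intro z _
    have h1 : Tendsto (fun R : ℝ => ‖z‖ ^ 2 / R ^ 2) atTop (𝓝 0) :=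
      tendsto_const_nhds.div_atTop (tendsto_pow_atTop two_ne_zero)
    have := (tendsto_const_nhds (x := (1 : ℝ))).min h1
    simpa using this

lemma penaltyOp_nonneg (hσ : σ ∈ Ioo (0 : ℝ) 2) (R : ℝ) : 0 ≤ penaltyOp N σ R :=
  integral_nonneg fun z => mul_nonneg (by positivity) (fracKer_nonneg hσ z)

lemma secondDiff_penalty_le {R : ℝ} (hR : R ≠ 0) (x z : Space N) :
    secondDiff (penalty R) x z ≤ min 1 (‖z‖ ^ 2 / R ^ 2) := by
  refine le_min ?_ ?_
  · have := penalty_le_one R (x + z)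
    have := penalty_le_one R (x - z)
    have := penalty_nonneg R x
    unfold secondDiff
    linarith
  · have := penalty_second_diff_le hR x z
    unfold secondDiff
    linarith

/-- The error made by gluing test functions in a ball of radius `r`. -/
def glueError (c r : ℝ) (z : Space N) : ℝ :=
  c * (if ‖z‖ < 2 * r then ‖z‖ ^ 2 else 0) + if r < ‖z‖ then r ^ 4 else 0

lemma measurable_glueError (c r : ℝ) : Measurable (glueError c r : Space N → ℝ) := by
  unfold glueError
  refine Measurable.add (Measurable.const_mul (Measurable.ite ?_ ?_ ?_) c) (Measurable.ite ?_ ?_ ?_)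
  · exact measurableSet_lt measurable_norm measurable_const
  · fun_prop
  · fun_prop
  · exact measurableSet_lt measurable_const measurable_norm
  · fun_prop
  · fun_prop

lemma glueError_nonneg {c : ℝ} (hc : 0 ≤ c) (r : ℝ) (z : Space N) : 0 ≤ glueError c r z := by
  unfold glueError
  have : 0 ≤ r ^ 4 := by positivity
  split_ifs <;> positivity

lemma abs_glueError_le {c : ℝ} (hc : 0 ≤ c) {r : ℝ} (hr : 0 < r) (hr2 : r ≤ 1 / 2)
    (z : Space N) : |glueError c r z| ≤ (c + 1) * min 1 (‖z‖ ^ 2) := by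
  rw [abs_of_nonneg (glueError_nonneg hc r z), glueError, add_mul, one_mul]
  have hm : 0 ≤ min 1 (‖z‖ ^ 2) := by positivity
  refine add_le_add (mul_le_mul_of_nonneg_left ?_ hc) ?_
  · split_ifs with h
    · refine le_min ?_ le_rfl
      nlinarith [norm_nonneg z]
    · exact hm
  · split_ifs with h
    · have h4 : r ^ 4 = r ^ 2 * r ^ 2 := by ring
      have h2 : r ^ 2 ≤ 1 := by nlinarith
      have h3 : r ^ 2 ≤ ‖z‖ ^ 2 := by gcongr
      refine le_min ?_ ?_
      · rw [h4]; nlinarith [sq_nonneg r]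
      · rw [h4]; nlinarith [sq_nonneg r]
    · exact hm

/-- For fixed `z ≠ 0` the quadratic term disappears once `2r ≤ |z|`, and the other term is at most
`r⁴`. For `r ≤ 1/2` both are dominated by `min 1 |z|²`, since `r⁴ ≤ min 1 |z|²` wherever `r < |z|`.
-/
lemma tendsto_integral_glueError (hσ : σ ∈ Ioo (0 : ℝ) 2) {c : ℝ} (hc : 0 ≤ c) :
    Tendsto (fun r => ∫ z : Space N, glueError c r z * fracKer σ z) (𝓝[>] 0) (𝓝 0) := by
  have hsm : ∀ b : ℝ, 0 < b → ∀ᶠ r : ℝ in 𝓝[>] 0, r < b := fun b hb =>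
    (eventually_lt_nhds hb).filter_mono nhdsWithin_le_nhds
  refine tendsto_integral_mul_fracKer_zero hσ (C := c + 1) (by positivity)
    (measurable_glueError c) ?_ ?_
  · filter_upwards [self_mem_nhdsWithin, hsm (1 / 2) (by norm_num)] with r hr hr2 z
    exact abs_glueError_le hc hr hr2.le z
  · intro z hz
    have hn : 0 < ‖z‖ := norm_pos_iff.2 hz
    have h4 : Tendsto (fun r : ℝ => r ^ 4) (𝓝[>] 0) (𝓝 0) := by
      have : Tendsto (fun r : ℝ => r ^ 4) (𝓝 0) (𝓝 (0 ^ 4)) := (continuous_pow 4).tendsto 0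
      simpa using this.mono_left nhdsWithin_le_nhds
    refine squeeze_zero' (Eventually.of_forall fun r => glueError_nonneg hc r z) ?_ h4
    filter_upwards [hsm (‖z‖ / 2) (by positivity)] with r hr
    have h1 : ¬ ‖z‖ < 2 * r := by linarith
    have : 0 ≤ r ^ 4 := by positivity
    unfold glueError
    rw [if_neg h1, mul_zero, zero_add]
    split_ifs <;> linarith

end Comparison

end

section

open scoped ENNReal NNReal Manifold ContDiff
open ProbabilityTheory

/-! ### The comparison principle -/

section Doubling

variable {N : ℕ} {σ : ℝ}

lemma contDiff_penalty_comp {R : ℝ} (hR : R ≠ 0) {E : Type*} [NormedAddCommGroup E]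
    [NormedSpace ℝ E] {g : E → Space N} (hg : ContDiff ℝ 2 g) :
    ContDiff ℝ 2 fun x => penalty R (g x) := (contDiff_penalty hR).comp hg

lemma abs_convexComb_le {θ a b A B : ℝ} (h0 : 0 ≤ θ) (h1 : θ ≤ 1) (ha : |a| ≤ A) (hb : |b| ≤ B) :
    |θ * a + (1 - θ) * b| ≤ A + B := by
  refine (abs_add_le _ _).trans (add_le_add ?_ ?_)
  · rw [abs_mul, abs_of_nonneg h0]
    exact (mul_le_of_le_one_left (abs_nonneg _) h1).trans ha
  · rw [abs_mul, abs_of_nonneg (by linarith)]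
    exact (mul_le_of_le_one_left (abs_nonneg _) (by linarith)).trans hb

lemma integrable_secondDiff_of_isTest (hσ : σ ∈ Ioo (0 : ℝ) 2) {T : ℝ} {φ : Space N → ℝ → ℝ}
    (hφ : IsTest T φ) (x : Space N) {t : ℝ} (ht : t ∈ Icc 0 T) :
    Integrable fun z => secondDiff (fun y => φ y t) x z * fracKer σ z := by
  obtain ⟨C, hC, hev⟩ := exists_secondDiff_bound hφ x t
  exact (integral_mul_fracKer hσ (measurable_secondDiff (hφ.continuous_slice t) x) hC
    (hev.self_of_nhds ht)).1

lemma abs_penalty_le_one (R : ℝ) (x : Space N) : |penalty R x| ≤ 1 := by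
  rw [abs_of_nonneg (penalty_nonneg R x)]; exact penalty_le_one R x

/-- The pair of viscosity inequalities at a maximum of the doubled function, with an error from
gluing the quadratic touching functions in a ball of radius `r`. -/
lemma doubling_inequality_aux (hσ : σ ∈ Ioo (0 : ℝ) 2) {T : ℝ} {F : ℝ → ℝ} {L : ℝ}
    (hF : ∀ l₁ l₂ : ℝ, F l₁ - F l₂ ≤ L * max (l₁ - l₂) 0) (hL : 0 ≤ L)
    {f u v : Space N → ℝ → ℝ}
    (hu_usc : UpperSemicontinuousOn (fun p : Space N × ℝ => u p.1 p.2) (univ ×ˢ Icc 0 T))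
    (hv_lsc : LowerSemicontinuousOn (fun p : Space N × ℝ => v p.1 p.2) (univ ×ˢ Icc 0 T))
    {B : ℝ} (huB : ∀ x, ∀ t ∈ Icc 0 T, |u x t| ≤ B) (hvB : ∀ x, ∀ t ∈ Icc 0 T, |v x t| ≤ B)
    (hu : ViscSub σ T F f u) (hv : ViscSuper σ T F f v) {K R ε η : ℝ} (hK : 0 ≤ K) (hR : R ≠ 0)
    (hε : 0 < ε) {x' y' : Space N} {t' s' : ℝ} (ht' : t' ∈ Ioc 0 T) (hs' : s' ∈ Ioc 0 T)
    (hmax : ∀ x y : Space N, ∀ t ∈ Icc 0 T, ∀ s ∈ Icc 0 T,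
      u x t - v y s - K * penalty ε (x - y) - (t - s) ^ 2 / ε - K * penalty R x - η * t
      ≤ u x' t' - v y' s' - K * penalty ε (x' - y') - (t' - s') ^ 2 / ε - K * penalty R x' - η * t')
    {r : ℝ} (hr : 0 < r) (hr2 : r ≤ 1 / 2) :
    η ≤ L * max (K * penaltyOp N σ R + ∫ z : Space N, glueError (2 * K / ε ^ 2) r z * fracKer σ z) 0
      + (f x' t' - f y' s') := by
  have hT : 0 ≤ T := ht'.1.le.trans ht'.2
  have htI : t' ∈ Icc 0 T := ⟨ht'.1.le, ht'.2⟩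
  have hsI : s' ∈ Icc 0 T := ⟨hs'.1.le, hs'.2⟩
  have hB0 : 0 ≤ B := (abs_nonneg _).trans (huB x' t' htI)
  set p := x' - y' with hp
  set q := t' - s' with hq
  set a : Space N × ℝ → ℝ := fun P => u P.1 P.2 - K * penalty R P.1 - η * P.2 with ha
  set a₀ := a (x', t') with ha₀
  set c := a₀ - v y' s' with hc
  -- Maximality of the doubled function in the form used below: it gives the upper touching function
  -- `Pp` with `(y, s) = (y', s')`, the lower one `Pm` with `(x, t) = (x', t')`, and the strict
  -- ordering for insertion with the displacement `(p, q)` frozen.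
  have hI : ∀ x y : Space N, ∀ t ∈ Icc 0 T, ∀ s ∈ Icc 0 T,
      a (x, t) ≤ v y s + c + K * penalty ε (x - y) + (t - s) ^ 2 / ε - K * penalty ε p
        - q ^ 2 / ε := by
    intro x y t ht s hs
    have := hmax x y t ht s hs
    simp only [hc, ha₀, ha]
    linarith
  set Pp : Space N × ℝ → ℝ := fun P => a₀ + K * penalty ε (P.1 - y') + (P.2 - s') ^ 2 / ε
    - K * penalty ε p - q ^ 2 / ε with hPp
  set Pm : Space N × ℝ → ℝ := fun P => a₀ - K * penalty ε (x' - P.1 + p) - (t' - P.2 + q) ^ 2 / ε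
    + K * penalty ε p + q ^ 2 / ε with hPm
  set S : Set (Space N × ℝ) := univ ×ˢ Icc 0 T with hS
  set S' : Set (Space N × ℝ) := {P | P.2 - q ∈ Icc 0 T} with hS'
  set δ := r ^ 4 with hδ
  have hδ0 : 0 < δ := by positivity
  have hSc : IsClosed S := isClosed_univ.prod isClosed_Icc
  have hSc' : IsClosed S' := isClosed_Icc.preimage (by fun_prop)
  set b : Space N × ℝ → ℝ := fun P => v (P.1 - p) (P.2 - q) + (c + δ) with hb
  have haP : ∀ P ∈ S, a P ≤ Pp P := by
    rintro ⟨x, t⟩ hP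
    have := hI x y' t hP.2 s' hsI
    simp only [hPp]
    linarith
  have hbP : ∀ P ∈ S', Pm P ≤ v (P.1 - p) (P.2 - q) + c := by
    rintro ⟨x, t⟩ hP
    have h1 := hI x' (x - p) t' htI (t - q) hP
    simp only [hPm]
    have e1 : x' - (x - p) = x' - x + p := by abel
    have e2 : t' - (t - q) = t' - t + q := by ring
    rw [e1, e2] at h1
    linarith
  -- Smooth insertion.
  obtain ⟨w, hwC, haw, hwb, hwB⟩ : ∃ w : Space N × ℝ → ℝ, ContDiff ℝ 2 w ∧ (∀ x ∈ S, a x < w x) ∧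
      (∀ x ∈ S', w x < b x) ∧ ∀ x, |w x| ≤ B + K + |η| * T + |c| + δ + 1 := by
    refine exists_contDiff_between hSc hSc' ?_ ?_ (by positivity) ?_ ?_ ?_
    · have hcont : Continuous fun P : Space N × ℝ => -(K * penalty R P.1) - η * P.2 := by
        have := (contDiff_penalty_comp hR (contDiff_fst (𝕜 := ℝ) (E := Space N) (F := ℝ)
          (n := 2))).continuous
        fun_prop
      have := hu_usc.add hcont.continuousOn.upperSemicontinuousOn
      have e : a = fun P => u P.1 P.2 + (-(K * penalty R P.1) - η * P.2) := by
        ext P; simp only [ha]; ring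
      rw [e]
      exact this
    · have h1 : LowerSemicontinuousOn (fun P : Space N × ℝ => v (P.1 - p) (P.2 - q)) S' :=
        hv_lsc.comp (g := fun P : Space N × ℝ => (P.1 - p, P.2 - q))
          (Continuous.continuousOn (by fun_prop)) fun P hP => ⟨mem_univ _, hP⟩
      exact h1.add (continuous_const.continuousOn.lowerSemicontinuousOn)
    · rintro ⟨x, t⟩ hP
      have h1 := abs_le.1 (huB x t hP.2)
      have h2 := penalty_nonneg R x
      have h3 := penalty_le_one R x
      have h4 : |η * t| ≤ |η| * T := by
        rw [abs_mul, abs_of_nonneg hP.2.1]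
        exact mul_le_mul_of_nonneg_left hP.2.2 (abs_nonneg _)
      have h5 := abs_le.1 h4
      have h6 : K * penalty R x ≤ K := mul_le_of_le_one_right hK h3
      have h7 : 0 ≤ K * penalty R x := by positivity
      have := abs_nonneg c
      rw [abs_lt]
      simp only [ha]
      constructor <;> linarith [h1.1, h1.2, h5.1, h5.2]
    · rintro ⟨x, t⟩ hP
      have h1 := abs_le.1 (hvB (x - p) (t - q) hP)
      have h2 := neg_abs_le c
      have h3 := le_abs_self c
      have h4 : 0 ≤ |η| * T := by positivity
      rw [abs_lt]
      simp only [hb]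
      constructor <;> linarith [h1.1, h1.2]
    -- At the frozen displacement `(p, q)` the doubling penalties keep their value at the maximum
    -- and cancel, so `a ≤ v(· - p, · - q) + c` and the shift `δ` makes the inequality strict.
    · rintro ⟨x, t⟩ hP hP'
      have := hI x (x - p) t hP.2 (t - q) hP'
      rw [sub_sub_cancel, sub_sub_cancel] at this
      simp only [hb]
      linarith
  let θ : ContDiffBump ((x', t') : Space N × ℝ) := ⟨r, 2 * r, hr, by linarith⟩
  have hθ0 : ∀ P, 0 ≤ θ P := fun P => θ.nonneg
  have hθ1 : ∀ P, θ P ≤ 1 := fun P => θ.le_one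
  have hθC : ContDiff ℝ 2 θ := θ.contDiff (n := 2)
  have hPpC : ContDiff ℝ 2 Pp := by
    have := contDiff_penalty_comp hε.ne' (g := fun P : Space N × ℝ => P.1 - y') (by fun_prop)
    simp only [hPp]
    fun_prop
  have hPmC : ContDiff ℝ 2 Pm := by
    have := contDiff_penalty_comp hε.ne' (g := fun P : Space N × ℝ => x' - P.1 + p) (by fun_prop)
    simp only [hPm]
    fun_prop
  -- Near the contact point these are the touching functions; elsewhere they are the same `w`,
  -- lowered by `δ` for the supersolution.
  set Φ : Space N × ℝ → ℝ := fun P => θ P * Pp P + (1 - θ P) * w P with hΦ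
  set X : Space N × ℝ → ℝ := fun P => θ P * Pm P + (1 - θ P) * (w P - δ) with hX
  have hΦC : ContDiff ℝ 2 Φ := by simp only [hΦ]; fun_prop
  have hXC : ContDiff ℝ 2 X := by simp only [hX]; fun_prop
  let φ : Space N → ℝ → ℝ := fun x t => Φ (x, t) + K * penalty R x + η * t
  let χ : Space N → ℝ → ℝ := fun y s => X (y + p, s + q) - c
  set W := B + K + |η| * T + |c| + δ + 1 with hW
  have hKp : ∀ (ρ : ℝ) (z : Space N), |K * penalty ρ z| ≤ K := fun ρ z => by
    rw [abs_mul, abs_of_nonneg hK]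
    exact mul_le_of_le_one_right hK (abs_penalty_le_one ρ z)
  have hsq : ∀ t ∈ Icc 0 T, ∀ s ∈ Icc 0 T, |(t - s) ^ 2 / ε| ≤ T ^ 2 / ε := by
    intro t ht s hs
    rw [abs_of_nonneg (by positivity)]
    gcongr ?_ / ε
    exact sq_le_sq' (by linarith [ht.1, hs.2]) (by linarith [ht.2, hs.1])
  have hφT : IsTest T φ := by
    refine ⟨?_, (|a₀| + K + T ^ 2 / ε + K + T ^ 2 / ε) + W + K + |η| * T, fun x t ht => ?_⟩
    · have := contDiff_penalty_comp hR (contDiff_fst (𝕜 := ℝ) (E := Space N) (F := ℝ) (n := 2))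
      simp only [φ]
      fun_prop
    · refine (abs_add_le _ _).trans (add_le_add ((abs_add_le _ _).trans (add_le_add
        (abs_convexComb_le (hθ0 _) (hθ1 _) ?_ (hwB _)) (hKp _ _))) ?_)
      · simp only [hPp]
        refine (abs_sub _ _).trans (add_le_add ((abs_sub _ _).trans (add_le_add
          ((abs_add_le _ _).trans (add_le_add ((abs_add_le _ _).trans (add_le_add le_rfl ?_)) ?_))
            ?_)) ?_)
        · exact hKp _ _
        · exact hsq t ht s' hsI
        · exact hKp _ _
        · exact hsq t' htI s' hsI
      · rw [abs_mul, abs_of_nonneg ht.1]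
        exact mul_le_mul_of_nonneg_left ht.2 (abs_nonneg _)
  have hχT : IsTest T χ := by
    refine ⟨?_, (|a₀| + K + T ^ 2 / ε + K + T ^ 2 / ε) + (W + δ) + |c|, fun y s hs => ?_⟩
    · simp only [χ]
      have : ContDiff ℝ 2 fun P : Space N × ℝ => X (P.1 + p, P.2 + q) := hXC.comp (by fun_prop)
      fun_prop
    · refine (abs_sub _ _).trans (add_le_add
        (abs_convexComb_le (hθ0 _) (hθ1 _) ?_ ?_) le_rfl)
      · simp only [hPm]
        have e : t' - (s + q) + q = t' - s := by ring
        rw [e]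
        refine (abs_add_le _ _).trans (add_le_add ((abs_add_le _ _).trans (add_le_add
          ((abs_sub _ _).trans (add_le_add ((abs_sub _ _).trans (add_le_add le_rfl ?_)) ?_))
            ?_)) ?_)
        · exact hKp _ _
        · exact hsq t' htI s hs
        · exact hKp _ _
        · exact hsq t' htI s' hsI
      · refine (abs_sub _ _).trans (add_le_add (hwB _) ?_)
        rw [abs_of_pos hδ0]
  have hθc : θ (x', t') = 1 := θ.one_of_mem_closedBall (Metric.mem_closedBall_self hr.le)
  have hPp0 : Pp (x', t') = a₀ := by
    simp only [hPp, ← hp, ← hq]; ring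
  have hPm0 : Pm (x', t') = a₀ := by
    simp only [hPm, sub_self, zero_add]; ring
  have hΦ0 : Φ (x', t') = a₀ := by simp only [hΦ, hθc, hPp0]; ring
  have hX0 : X (x', t') = a₀ := by simp only [hX, hθc, hPm0]; ring
  have hyp : y' + p = x' := by rw [hp]; abel
  have hsq' : s' + q = t' := by rw [hq]; ring
  -- The subsolution inequality.
  have hsub := hu φ hφT x' t' ht' (by
    intro x t ht
    have htc : t ∈ Icc 0 T := ⟨ht.1.le, ht.2⟩
    have hmem : ((x, t) : Space N × ℝ) ∈ S := ⟨mem_univ _, htc⟩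
    have h1 := haP _ hmem
    have h2 := (haw _ hmem).le
    have h3 : a (x, t) ≤ Φ (x, t) := by
      have := mul_le_mul_of_nonneg_left h1 (hθ0 (x, t))
      have := mul_le_mul_of_nonneg_left h2 (sub_nonneg.2 (hθ1 (x, t)))
      simp only [hΦ]
      linarith
    have h4 : a (x', t') = Φ (x', t') := hΦ0.symm
    simp only [ha] at h3 h4
    simp only [φ]
    linarith)
  have hsup := hv χ hχT y' s' hs' (by
    intro y s hs
    have hsc : s ∈ Icc 0 T := ⟨hs.1.le, hs.2⟩
    have hmem : ((y + p, s + q) : Space N × ℝ) ∈ S' := by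
      simp only [hS', mem_ofPred_eq, add_sub_cancel_right]
      exact hsc
    have h1 := hbP _ hmem
    have h2 := (hwb _ hmem).le
    simp only [hb, add_sub_cancel_right] at h1 h2
    have h3 : X (y + p, s + q) ≤ v y s + c := by
      have h5 : w (y + p, s + q) - δ ≤ v y s + c := by linarith
      have := mul_le_mul_of_nonneg_left h1 (hθ0 (y + p, s + q))
      have := mul_le_mul_of_nonneg_left h5 (sub_nonneg.2 (hθ1 (y + p, s + q)))
      simp only [hX]
      linarith
    have h4 : X (y' + p, s' + q) = a₀ := by rw [hyp, hsq', hX0]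
    simp only [χ]
    rw [h4]
    linarith)
  have hθnear : ∀ᶠ t in 𝓝 t', θ (x', t) = 1 := by
    filter_upwards [Metric.ball_mem_nhds t' hr] with t ht
    refine θ.one_of_mem_closedBall ?_
    rw [Metric.mem_closedBall, Prod.dist_eq, dist_self, max_eq_right dist_nonneg]
    exact (le_of_lt ht)
  -- The bump equals `1` near the contact time, so only the touching functions enter. Both time
  -- penalties contribute `2q/ε`, which cancels in the final subtraction and leaves `η`.
  have hdφ : deriv (fun s => φ x' s) t' = 2 * q / ε + η := by
    have e : (fun s => φ x' s) =ᶠ[𝓝 t'] fun s => (a₀ + K * penalty ε (x' - y') + (s - s') ^ 2 / ε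
        - K * penalty ε p - q ^ 2 / ε) + K * penalty R x' + η * s := by
      filter_upwards [hθnear] with s hs
      simp only [φ, hΦ, hs, hPp]; ring
    rw [e.deriv_eq]
    have h1 := ((((((hasDerivAt_id t').sub_const s').pow 2).div_const ε).const_add
      (a₀ + K * penalty ε (x' - y'))).sub_const (K * penalty ε p)).sub_const (q ^ 2 / ε)
    have h2 := (h1.add_const (K * penalty R x')).add ((hasDerivAt_id t').const_mul η)
    refine HasDerivAt.deriv (h2.congr_deriv ?_)
    simp [hq]
  have hdχ : deriv (fun s => χ y' s) s' = 2 * q / ε := by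
    have hθs : ∀ᶠ s in 𝓝 s', θ (x', s + q) = 1 := by
      have : Tendsto (fun s => s + q) (𝓝 s') (𝓝 t') := by
        rw [← hsq']; exact (continuous_add_const q).tendsto s'
      exact this.eventually hθnear
    have e : (fun s => χ y' s) =ᶠ[𝓝 s'] fun s => a₀ - K * penalty ε (x' - x' + p)
        - (t' - s) ^ 2 / ε + K * penalty ε p + q ^ 2 / ε - c := by
      filter_upwards [hθs] with s hs
      simp only [χ, hX, hyp, hs, hPm]
      have e : t' - (s + q) + q = t' - s := by ring
      rw [e]; ring
    rw [e.deriv_eq]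
    have h1 := (((((((hasDerivAt_id s').const_sub t').pow 2).div_const ε).const_sub
      (a₀ - K * penalty ε (x' - x' + p))).add_const (K * penalty ε p)).add_const
        (q ^ 2 / ε)).sub_const c
    refine HasDerivAt.deriv (h1.congr_deriv ?_)
    simp [hq]; ring
  -- The nonlocal terms.
  have hglue : ∀ z : Space N, φ (x' + z) t' - χ (y' + z) s' - (K * penalty R (x' + z) + η * t' + c)
      ≤ glueError (2 * K / ε ^ 2) r z := by
    intro z
    have e1 : y' + z + p = x' + z := by rw [← hyp]; abel
    have e2 : φ (x' + z) t' - χ (y' + z) s' - (K * penalty R (x' + z) + η * t' + c)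
        = θ (x' + z, t') * (Pp (x' + z, t') - Pm (x' + z, t')) + (1 - θ (x' + z, t')) * δ := by
      simp only [φ, χ, e1, hsq', hΦ, hX]; ring
    -- This difference is `K` times the symmetric second difference of the doubling penalty at `p`;
    -- at the contact time the time penalties cancel.
    have e3 : Pp (x' + z, t') - Pm (x' + z, t') ≤ 2 * K / ε ^ 2 * ‖z‖ ^ 2 := by
      have h1 := mul_le_mul_of_nonneg_left (penalty_second_diff_le hε.ne' p z) hK
      simp only [hPp, hPm]
      have e4 : x' + z - y' = p + z := by rw [hp]; abel
      have e5 : x' - (x' + z) + p = p - z := by abel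
      rw [e4, e5, sub_self, zero_add, ← hq]
      have e6 : 2 * K / ε ^ 2 * ‖z‖ ^ 2 = K * (2 * (‖z‖ ^ 2 / ε ^ 2)) := by ring
      rw [e6]
      linarith
    have hdist : dist ((x' + z, t') : Space N × ℝ) (x', t') = ‖z‖ := by
      rw [Prod.dist_eq, dist_self, max_eq_left dist_nonneg, dist_eq_norm, add_sub_cancel_left]
    rw [e2, glueError]
    refine add_le_add ?_ ?_
    · split_ifs with h
      · have h2 : 0 ≤ 2 * K / ε ^ 2 * ‖z‖ ^ 2 := by positivity
        calc _ ≤ θ (x' + z, t') * (2 * K / ε ^ 2 * ‖z‖ ^ 2) :=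
              mul_le_mul_of_nonneg_left e3 (hθ0 _)
          _ ≤ _ := mul_le_of_le_one_left h2 (hθ1 _)
      · have : θ (x' + z, t') = 0 := θ.zero_of_le_dist (by rw [hdist]; exact not_lt.1 h)
        rw [this]; simp
    · split_ifs with h
      · exact mul_le_of_le_one_left hδ0.le (by linarith [hθ0 (x' + z, t')])
      · have : θ (x' + z, t') = 1 := θ.one_of_mem_closedBall (by
          rw [Metric.mem_closedBall, hdist]; exact not_lt.1 h)
        rw [this]; simp
  have hglue0 : φ x' t' - χ y' s' - (K * penalty R x' + η * t' + c) = 0 := by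
    simp only [φ, χ, hyp, hsq', hΦ0, hX0]; ring
  -- The gluing estimates at `z` and `-z` are added; at the contact point they are equalities, so no
  -- centre term is lost.
  have hsd : ∀ z : Space N, secondDiff (fun y => φ y t') x' z - secondDiff (fun y => χ y s') y' z
      ≤ K * min 1 (‖z‖ ^ 2 / R ^ 2) + glueError (2 * K / ε ^ 2) r z := by
    intro z
    have h1 := hglue z
    have h2 := hglue (-z)
    have e : glueError (2 * K / ε ^ 2) r (-z) = glueError (2 * K / ε ^ 2) r z := by
      simp [glueError]
    rw [e, ← sub_eq_add_neg, ← sub_eq_add_neg] at h2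
    have h3 := mul_le_mul_of_nonneg_left (secondDiff_penalty_le hR x' z) hK
    simp only [secondDiff] at h3 ⊢
    linarith
  have hdiff : negFracLap σ (fun y => φ y t') x' - negFracLap σ (fun y => χ y s') y'
      ≤ K * penaltyOp N σ R + ∫ z : Space N, glueError (2 * K / ε ^ 2) r z * fracKer σ z := by
    have i1 := integrable_secondDiff_of_isTest hσ hφT x' htI
    have i2 := integrable_secondDiff_of_isTest hσ hχT y' hsI
    have i3 := (integrable_penaltyOp (N := N) hσ hR).const_mul K
    have i4 := integrable_mul_fracKer_of_le (N := N) hσ (measurable_glueError (2 * K / ε ^ 2) r)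
      (by positivity) (abs_glueError_le (by positivity) hr hr2)
    rw [hφT.negFracLap_eq hσ x' htI, hχT.negFracLap_eq hσ y' hsI, fracOp, fracOp,
      ← integral_sub i1 i2, penaltyOp, ← integral_const_mul, ← integral_add i3 i4]
    refine integral_mono (i1.sub i2) (i3.add i4) fun z => ?_
    have := mul_le_mul_of_nonneg_right (hsd z) (fracKer_nonneg hσ z)
    rw [sub_mul, add_mul, mul_assoc] at this
    exact this
  rw [residual, hdφ] at hsub
  rw [residual, hdχ] at hsup
  have hFF := hF (negFracLap σ (fun y => φ y t') x') (negFracLap σ (fun y => χ y s') y')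
  have hmono := mul_le_mul_of_nonneg_left (max_le_max hdiff (le_refl (0 : ℝ))) hL
  linarith

/-- The pair of viscosity inequalities at a maximum of the doubled function. -/
lemma doubling_inequality (hσ : σ ∈ Ioo (0 : ℝ) 2) {T : ℝ} {F : ℝ → ℝ} {L : ℝ}
    (hF : ∀ l₁ l₂ : ℝ, F l₁ - F l₂ ≤ L * max (l₁ - l₂) 0) (hL : 0 ≤ L)
    {f u v : Space N → ℝ → ℝ}
    (hu_usc : UpperSemicontinuousOn (fun p : Space N × ℝ => u p.1 p.2) (univ ×ˢ Icc 0 T))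
    (hv_lsc : LowerSemicontinuousOn (fun p : Space N × ℝ => v p.1 p.2) (univ ×ˢ Icc 0 T))
    {B : ℝ} (huB : ∀ x, ∀ t ∈ Icc 0 T, |u x t| ≤ B) (hvB : ∀ x, ∀ t ∈ Icc 0 T, |v x t| ≤ B)
    (hu : ViscSub σ T F f u) (hv : ViscSuper σ T F f v) {K R ε η : ℝ} (hK : 0 ≤ K) (hR : R ≠ 0)
    (hε : 0 < ε) {x' y' : Space N} {t' s' : ℝ} (ht' : t' ∈ Ioc 0 T) (hs' : s' ∈ Ioc 0 T)
    (hmax : ∀ x y : Space N, ∀ t ∈ Icc 0 T, ∀ s ∈ Icc 0 T,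
      u x t - v y s - K * penalty ε (x - y) - (t - s) ^ 2 / ε - K * penalty R x - η * t
      ≤ u x' t' - v y' s' - K * penalty ε (x' - y') - (t' - s') ^ 2 / ε - K * penalty R x'
        - η * t') :
    η ≤ L * (K * penaltyOp N σ R) + (f x' t' - f y' s') := by
  have hlim := tendsto_integral_glueError (N := N) hσ (c := 2 * K / ε ^ 2) (by positivity)
  have h1 := (((hlim.const_add (K * penaltyOp N σ R)).max (tendsto_const_nhds (x := (0 : ℝ)))).const_mul
    L).add_const (f x' t' - f y' s')
  rw [add_zero, max_eq_left (mul_nonneg hK (penaltyOp_nonneg hσ R))] at h1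
  refine ge_of_tendsto h1 ?_
  have hsm : ∀ᶠ r : ℝ in 𝓝[>] 0, r < 1 / 2 :=
    (eventually_lt_nhds (by norm_num)).filter_mono nhdsWithin_le_nhds
  filter_upwards [self_mem_nhdsWithin, hsm] with r hr hr2
  exact doubling_inequality_aux hσ hF hL hu_usc hv_lsc huB hvB hu hv hK hR hε ht' hs' hmax hr hr2.le

end Doubling

end

section

/-! ### Maximum points of the doubled function and the limit of the doubling parameter -/

section ComparisonPrinciple

variable {N : ℕ} {σ : ℝ}

lemma tendsto_penalty_atTop (x : Space N) : Tendsto (fun R => penalty R x) atTop (𝓝 0) := by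
  unfold penalty
  exact tendsto_const_nhds.div_atTop
    (tendsto_atTop_add_const_right _ _ (tendsto_pow_atTop two_ne_zero))

lemma norm_lt_two_mul_of_penalty_le {R : ℝ} (hR : 0 < R) {x : Space N}
    (h : penalty R x ≤ 1 / 2) : ‖x‖ < 2 * R := by
  refine norm_lt_of_penalty_lt hR.ne' (by positivity) (lt_of_le_of_lt h ?_)
  rw [div_lt_div_iff₀ (by norm_num) (by positivity)]
  nlinarith [sq_nonneg R, pow_pos hR 2]

/-- The comparison principle for semicontinuous viscosity sub- and supersolutions. -/
theorem comparison (hσ : σ ∈ Ioo (0 : ℝ) 2) {T : ℝ} {F : ℝ → ℝ} {L : ℝ}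
    (hF : ∀ l₁ l₂ : ℝ, F l₁ - F l₂ ≤ L * max (l₁ - l₂) 0) (hL : 0 ≤ L)
    {f u v : Space N → ℝ → ℝ}
    (hf : ContinuousOn (fun p : Space N × ℝ => f p.1 p.2) (univ ×ˢ Ioc 0 T))
    (hu_usc : UpperSemicontinuousOn (fun p : Space N × ℝ => u p.1 p.2) (univ ×ˢ Icc 0 T))
    (hv_lsc : LowerSemicontinuousOn (fun p : Space N × ℝ => v p.1 p.2) (univ ×ˢ Icc 0 T))
    (huB : ∃ B, ∀ x, ∀ t ∈ Icc 0 T, |u x t| ≤ B) (hvB : ∃ B, ∀ x, ∀ t ∈ Icc 0 T, |v x t| ≤ B)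
    (hu : ViscSub σ T F f u) (hv : ViscSuper σ T F f v) (h0 : ∀ x, u x 0 ≤ v x 0)
    (x : Space N) {t : ℝ} (ht : t ∈ Icc 0 T) : u x t ≤ v x t := by
  by_contra hcon
  rw [not_le, ← sub_pos] at hcon
  set m := u x t - v x t with hm
  have ht0 : 0 < t := by
    refine lt_of_le_of_ne ht.1 fun h => ?_
    rw [hm, ← h] at hcon
    linarith [h0 x]
  have hT : 0 < T := ht0.trans_le ht.2
  obtain ⟨B, hB, huB, hvB⟩ : ∃ B : ℝ, 0 < B ∧ (∀ x, ∀ t ∈ Icc 0 T, |u x t| ≤ B) ∧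
      ∀ x, ∀ t ∈ Icc 0 T, |v x t| ≤ B := by
    obtain ⟨B₁, h₁⟩ := huB
    obtain ⟨B₂, h₂⟩ := hvB
    exact ⟨|B₁| + |B₂| + 1, by positivity,
      fun x t ht => (h₁ x t ht).trans (by linarith [le_abs_self B₁, abs_nonneg B₂]),
      fun x t ht => (h₂ x t ht).trans (by linarith [le_abs_self B₂, abs_nonneg B₁])⟩
  -- Where the doubled function is nonnegative the penalties are at most `2B`. With `K = 4B` each
  -- spatial penalty is then at most `1/2`, which localizes `x` and `x - y` although the penalties
  -- are bounded.
  set K := 4 * B with hK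
  have hK0 : 0 < K := by positivity
  set η := m / (4 * T) with hη
  have hη0 : 0 < η := by positivity
  -- `R` is fixed before `ε → 0`. Localization costs at most `m/4` at `x`, as does `ηt`, so the
  -- maximum stays above `m/2`; the nonlocal cost `L K penaltyOp` is below `η`.
  obtain ⟨R, hR0, hR1, hR2⟩ : ∃ R : ℝ, 0 < R ∧ K * penalty R x < m / 4 ∧
      L * (K * penaltyOp N σ R) < η := by
    have h1 := (tendsto_penalty_atTop x).const_mul K
    have h2 := ((tendsto_penaltyOp (N := N) hσ).const_mul K).const_mul L
    rw [mul_zero] at h1 h2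
    rw [mul_zero] at h2
    obtain ⟨R, h3, h4, h5⟩ := ((eventually_gt_atTop 0).and ((h1.eventually
      (gt_mem_nhds (by positivity : 0 < m / 4))).and (h2.eventually (gt_mem_nhds hη0)))).exists
    exact ⟨R, h3, h4, h5⟩
  let Ψ : ℝ → Space N → Space N → ℝ → ℝ → ℝ := fun ε x y t s =>
    u x t - v y s - K * penalty ε (x - y) - (t - s) ^ 2 / ε - K * penalty R x - η * t
  have hηt : η * t ≤ m / 4 := by
    calc η * t ≤ η * T := by gcongr; exact ht.2
      _ = m / 4 := by rw [hη]; field_simp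
  have hΨ0 : ∀ ε, m / 2 ≤ Ψ ε x x t t := by
    intro ε
    simp only [Ψ, sub_self, penalty_zero, mul_zero, ne_eq, OfNat.ofNat_ne_zero, not_false_eq_true,
      zero_pow, zero_div, sub_zero]
    linarith
  have hloc : ∀ ε : ℝ, 0 < ε → ∀ x y : Space N, ∀ t ∈ Icc 0 T, ∀ s ∈ Icc 0 T,
      0 ≤ Ψ ε x y t s → ‖x‖ < 2 * R ∧ ‖x - y‖ < 2 * ε ∧ (t - s) ^ 2 ≤ 2 * B * ε ∧
        Ψ ε x y t s ≤ u x t - v y s := by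
    intro ε hε x y t ht s hs hpos
    have h1 := abs_le.1 (huB x t ht)
    have h2 := abs_le.1 (hvB y s hs)
    have h3 : 0 ≤ K * penalty ε (x - y) := mul_nonneg hK0.le (penalty_nonneg _ _)
    have h4 : 0 ≤ K * penalty R x := mul_nonneg hK0.le (penalty_nonneg _ _)
    have h5 : 0 ≤ (t - s) ^ 2 / ε := by positivity
    have h6 : 0 ≤ η * t := mul_nonneg hη0.le ht.1
    simp only [Ψ] at hpos ⊢
    refine ⟨norm_lt_two_mul_of_penalty_le hR0 ?_, norm_lt_two_mul_of_penalty_le hε ?_, ?_, ?_⟩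
    · have : K * penalty R x ≤ 2 * B := by linarith [h1.2, h2.1]
      rw [hK] at this
      nlinarith
    · have : K * penalty ε (x - y) ≤ 2 * B := by linarith [h1.2, h2.1]
      rw [hK] at this
      nlinarith
    · rw [← div_le_iff₀ hε]
      linarith [h1.2, h2.1]
    · linarith
  -- Existence of maximum points.
  have hmaxpt : ∀ ε : ℝ, 0 < ε → ε ≤ 1 → ∃ P : (Space N × ℝ) × (Space N × ℝ),
      P.1.2 ∈ Icc 0 T ∧ P.2.2 ∈ Icc 0 T ∧ m / 2 ≤ Ψ ε P.1.1 P.2.1 P.1.2 P.2.2 ∧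
      ∀ x y : Space N, ∀ t ∈ Icc 0 T, ∀ s ∈ Icc 0 T,
        Ψ ε x y t s ≤ Ψ ε P.1.1 P.2.1 P.1.2 P.2.2 := by
    intro ε hε hε1
    set C : Set ((Space N × ℝ) × (Space N × ℝ)) :=
      (Metric.closedBall 0 (2 * R) ×ˢ Icc 0 T) ×ˢ (Metric.closedBall 0 (2 * R + 2) ×ˢ Icc 0 T)
      with hC
    have hCc : IsCompact C := ((isCompact_closedBall _ _).prod isCompact_Icc).prod
      ((isCompact_closedBall _ _).prod isCompact_Icc)
    have hmemC : ∀ x y : Space N, ∀ t ∈ Icc 0 T, ∀ s ∈ Icc 0 T, 0 ≤ Ψ ε x y t s →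
        ((x, t), (y, s)) ∈ C := by
      intro x y t ht s hs hpos
      obtain ⟨h1, h2, -, -⟩ := hloc ε hε x y t ht s hs hpos
      refine ⟨⟨mem_closedBall_zero_iff.2 h1.le, ht⟩, ⟨mem_closedBall_zero_iff.2 ?_, hs⟩⟩
      have h3 : ‖y‖ ≤ ‖x‖ + ‖x - y‖ := by
        have := norm_sub_le x (x - y)
        rwa [sub_sub_cancel] at this
      show ‖y‖ ≤ _
      linarith
    have hx0 : ((x, t), (x, t)) ∈ C := hmemC x x t ht t ht (by linarith [hΨ0 ε])
    have husc : UpperSemicontinuousOn (fun P : (Space N × ℝ) × (Space N × ℝ) =>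
        Ψ ε P.1.1 P.2.1 P.1.2 P.2.2) C := by
      have h1 : UpperSemicontinuousOn (fun P : (Space N × ℝ) × (Space N × ℝ) => u P.1.1 P.1.2) C :=
        hu_usc.comp (g := fun P : (Space N × ℝ) × (Space N × ℝ) => P.1)
          continuous_fst.continuousOn fun P hP => ⟨mem_univ _, hP.1.2⟩
      have h2 : UpperSemicontinuousOn
          (fun P : (Space N × ℝ) × (Space N × ℝ) => -v P.2.1 P.2.2) C :=
        (hv_lsc.comp (g := fun P : (Space N × ℝ) × (Space N × ℝ) => P.2)
          continuous_snd.continuousOn fun P hP => ⟨mem_univ _, hP.2.2⟩).neg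
      have h3 : Continuous fun P : (Space N × ℝ) × (Space N × ℝ) =>
          -(K * penalty ε (P.1.1 - P.2.1)) - (P.1.2 - P.2.2) ^ 2 / ε - K * penalty R P.1.1
            - η * P.1.2 := by
        have c1 : Continuous fun P : (Space N × ℝ) × (Space N × ℝ) => penalty ε (P.1.1 - P.2.1) :=
          (contDiff_penalty hε.ne').continuous.comp (by fun_prop)
        have c2 : Continuous fun P : (Space N × ℝ) × (Space N × ℝ) => penalty R P.1.1 :=
          (contDiff_penalty hR0.ne').continuous.comp (by fun_prop)
        fun_prop
      have h4 := (h1.add h2).add h3.continuousOn.upperSemicontinuousOn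
      refine (congrArg (fun g => UpperSemicontinuousOn g C) (funext fun P => ?_)).mp h4
      simp only [Ψ]
      ring
    obtain ⟨P, hP, hPmax⟩ := husc.exists_isMaxOn ⟨_, hx0⟩ hCc
    have hge : m / 2 ≤ Ψ ε P.1.1 P.2.1 P.1.2 P.2.2 := (hΨ0 ε).trans (hPmax hx0)
    refine ⟨P, hP.1.2, hP.2.2, hge, fun x y t ht s hs => ?_⟩
    by_cases hneg : 0 ≤ Ψ ε x y t s
    · exact hPmax (hmemC x y t ht s hs hneg)
    · linarith
  have hε : ∀ n : ℕ, (0 : ℝ) < 1 / ((n : ℝ) + 1) := fun n => by positivity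
  have hε1 : ∀ n : ℕ, 1 / ((n : ℝ) + 1) ≤ 1 := fun n => by
    rw [div_le_one (by positivity)]; linarith [(Nat.cast_nonneg n : (0 : ℝ) ≤ n)]
  choose P hP1 hP2 hPm hPmax using fun n : ℕ => hmaxpt (1 / ((n : ℝ) + 1)) (hε n) (hε1 n)
  have hPl := fun n => hloc _ (hε n) (P n).1.1 (P n).2.1 (P n).1.2 (hP1 n) (P n).2.2 (hP2 n)
    (by linarith [hPm n])
  obtain ⟨⟨x₁, t₁⟩, hmem, g, hg, hlim⟩ :=
    ((isCompact_closedBall (0 : Space N) (2 * R)).prod (isCompact_Icc (a := (0 : ℝ)) (b := T))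
      ).tendsto_subseq (x := fun n => (P n).1)
      fun n => ⟨mem_closedBall_zero_iff.2 (hPl n).1.le, hP1 n⟩
  have hεlim : Tendsto (fun n => 1 / ((g n : ℝ) + 1)) atTop (𝓝 0) :=
    tendsto_one_div_add_atTop_nhds_zero_nat.comp hg.tendsto_atTop
  have hlim2 : Tendsto (fun n => (P (g n)).2) atTop (𝓝 (x₁, t₁)) := by
    have hx : Tendsto (fun n => (P (g n)).1.1 - (P (g n)).2.1) atTop (𝓝 0) := by
      refine squeeze_zero_norm (fun n => (hPl (g n)).2.1.le) ?_
      simpa using hεlim.const_mul 2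
    have ht : Tendsto (fun n => (P (g n)).1.2 - (P (g n)).2.2) atTop (𝓝 0) := by
      refine squeeze_zero_norm (a := fun n => √(2 * B * (1 / ((g n : ℝ) + 1)))) (fun n => ?_) ?_
      · rw [Real.norm_eq_abs]
        exact Real.abs_le_sqrt (hPl (g n)).2.2.1
      · have := (hεlim.const_mul (2 * B)).sqrt
        simpa using this
    have h1 := hlim.sub (hx.prodMk_nhds ht)
    rw [Prod.mk_sub_mk, sub_zero, sub_zero] at h1
    refine h1.congr fun n => ?_
    simp only [Function.comp]
    ext1
    · simp
    · simp
  have hmS : ((x₁, t₁) : Space N × ℝ) ∈ (univ : Set (Space N)) ×ˢ Icc 0 T := ⟨mem_univ _, hmem.2⟩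
  have hw1 : Tendsto (fun n => (P (g n)).1) atTop (𝓝[univ ×ˢ Icc 0 T] (x₁, t₁)) :=
    tendsto_nhdsWithin_iff.2 ⟨hlim, Eventually.of_forall fun n => ⟨mem_univ _, hP1 _⟩⟩
  have hw2 : Tendsto (fun n => (P (g n)).2) atTop (𝓝[univ ×ˢ Icc 0 T] (x₁, t₁)) :=
    tendsto_nhdsWithin_iff.2 ⟨hlim2, Eventually.of_forall fun n => ⟨mem_univ _, hP2 _⟩⟩
  -- At time zero the ordering of the initial values contradicts a maximum of at least `m/2`.
  -- Positivity is needed both for the viscosity inequalities and for the continuity of `f`.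
  have ht₁ : 0 < t₁ := by
    refine lt_of_le_of_ne hmem.2.1 fun h => ?_
    have e1 := hw1.eventually (hu_usc _ hmS (u x₁ t₁ + m / 8) (by simp only; linarith))
    have e2 := hw2.eventually (hv_lsc _ hmS (v x₁ t₁ - m / 8) (by simp only; linarith))
    obtain ⟨n, hn1, hn2⟩ := (e1.and e2).exists
    have h3 := (hPl (g n)).2.2.2
    have h4 := hPm (g n)
    have h5 := h0 x₁
    rw [h] at h5
    simp only at hn1 hn2
    linarith
  have hmQ : ((x₁, t₁) : Space N × ℝ) ∈ (univ : Set (Space N)) ×ˢ Ioc 0 T :=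
    ⟨mem_univ _, ht₁, hmem.2.2⟩
  have hpos1 : ∀ᶠ n in atTop, 0 < (P (g n)).1.2 :=
    ((continuous_snd.tendsto _).comp hlim).eventually (lt_mem_nhds ht₁)
  have hpos2 : ∀ᶠ n in atTop, 0 < (P (g n)).2.2 :=
    ((continuous_snd.tendsto _).comp hlim2).eventually (lt_mem_nhds ht₁)
  have hf1 : Tendsto (fun n => f (P (g n)).1.1 (P (g n)).1.2) atTop (𝓝 (f x₁ t₁)) :=
    (hf _ hmQ).tendsto.comp (tendsto_nhdsWithin_iff.2 ⟨hlim, by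
      filter_upwards [hpos1] with n hn using ⟨mem_univ _, hn, (hP1 _).2⟩⟩)
  have hf2 : Tendsto (fun n => f (P (g n)).2.1 (P (g n)).2.2) atTop (𝓝 (f x₁ t₁)) :=
    (hf _ hmQ).tendsto.comp (tendsto_nhdsWithin_iff.2 ⟨hlim2, by
      filter_upwards [hpos2] with n hn using ⟨mem_univ _, hn, (hP2 _).2⟩⟩)
  have hfin := (hf1.sub hf2).const_add (L * (K * penaltyOp N σ R))
  rw [sub_self, add_zero] at hfin
  have : η ≤ L * (K * penaltyOp N σ R) := by
    refine ge_of_tendsto hfin ?_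
    filter_upwards [hpos1, hpos2] with n hn1 hn2
    exact doubling_inequality hσ hF hL hu_usc hv_lsc huB hvB hu hv hK0.le hR0.ne' (hε (g n))
      ⟨hn1, (hP1 _).2⟩ ⟨hn2, (hP2 _).2⟩ (hPmax (g n))
  linarith

end ComparisonPrinciple

end

section

/-! ### The explicit scheme -/

section Scheme

variable {N : ℕ} {σ T : ℝ} {F : ℝ → ℝ} {L : ℝ} {f : Space N → ℝ → ℝ} {u₀ : Space N → ℝ}
  {h τ : ℝ} {U : Space N → ℝ → ℝ}

lemma monotone_of_one_sided (hF : ∀ l₁ l₂ : ℝ, F l₁ - F l₂ ≤ L * max (l₁ - l₂) 0) :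
    Monotone F := fun a b hab => by
  have := hF a b
  rw [max_eq_right (sub_nonpos.2 hab), mul_zero] at this
  linarith

lemma continuous_of_one_sided (hF : ∀ l₁ l₂ : ℝ, F l₁ - F l₂ ≤ L * max (l₁ - l₂) 0)
    (hL : 0 ≤ L) : Continuous F := by
  refine (LipschitzWith.of_dist_le_mul (K := L.toNNReal) fun a b => ?_).continuous
  rw [Real.dist_eq, Real.dist_eq, Real.coe_toNNReal _ hL]
  have h1 := hF a b
  have h2 := hF b a
  have h3 : L * max (a - b) 0 ≤ L * |a - b| :=
    mul_le_mul_of_nonneg_left (max_le (le_abs_self _) (abs_nonneg _)) hL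
  have h4 : L * max (b - a) 0 ≤ L * |a - b| := by
    rw [abs_sub_comm]
    exact mul_le_mul_of_nonneg_left (max_le (le_abs_self _) (abs_nonneg _)) hL
  rw [abs_le]
  constructor <;> linarith

/-- The explicit Euler step is monotone under the CFL condition. -/
lemma euler_step_mono (hσ : σ ∈ Ioo (0 : ℝ) 2)
    (hF : ∀ l₁ l₂ : ℝ, F l₁ - F l₂ ≤ L * max (l₁ - l₂) 0) (hL : 0 ≤ L) (hh : 0 < h) (hτ : 0 ≤ τ)
    (hcfl : τ * (L * (cflConst N σ / h ^ σ)) ≤ 1) {φ ψ : Space N → ℝ}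
    (hφ : ∃ C, ∀ x, |φ x| ≤ C) (hψ : ∃ C, ∀ x, |ψ x| ≤ C) (hle : ∀ x, φ x ≤ ψ x) (x : Space N) :
    φ x + τ * F (negDiscFracLap σ h φ x) ≤ ψ x + τ * F (negDiscFracLap σ h ψ x) := by
  have h1 := hF (negDiscFracLap σ h φ x) (negDiscFracLap σ h ψ x)
  have h2 := negDiscFracLap_sub_le hσ hh hφ hψ hle x
  have hw : 0 ≤ ψ x - φ x := sub_nonneg.2 (hle x)
  -- If the operator does not decrease from `φ` to `ψ`, monotonicity of `F` is enough. Otherwise the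
  -- decrease is at most the diagonal weight times `ψ x - φ x`, and the CFL condition absorbs it.
  rcases le_total (negDiscFracLap σ h φ x - negDiscFracLap σ h ψ x) 0 with h3 | h3
  · rw [max_eq_right h3, mul_zero] at h1
    have := mul_le_mul_of_nonneg_left h1 hτ
    linarith
  · rw [max_eq_left h3] at h1
    have h4 := mul_le_mul_of_nonneg_left h1 hτ
    have h5 := mul_le_mul_of_nonneg_left (mul_le_mul_of_nonneg_left h2 hL) hτ
    have h6 := mul_le_mul_of_nonneg_right hcfl hw
    have h7 : τ * (L * (cflConst N σ / h ^ σ * (ψ x - φ x)))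
        = τ * (L * (cflConst N σ / h ^ σ)) * (ψ x - φ x) := by ring
    linarith

lemma negDiscFracLap_const (σ h c : ℝ) (x : Space N) :
    negDiscFracLap σ h (fun _ => c) x = 0 := by
  have h0 := negDiscFracLap_neg σ h (fun _ => (0 : ℝ)) x
  rw [neg_zero] at h0
  have := negDiscFracLap_add_const σ h c (bdd_const N 0) x
  rw [zero_add] at this
  rw [this]
  linarith

lemma SolvesScheme.init (hU : SolvesScheme σ T F f u₀ h τ U) (x : Space N) {t : ℝ}
    (ht : t ∈ Icc 0 T) (htτ : t < τ) : U x t = u₀ x := by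
  have := hU x t ht
  rw [schemeOp, if_neg (not_le.2 htτ)] at this
  linarith

lemma SolvesScheme.step (hU : SolvesScheme σ T F f u₀ h τ U) (hτ : 0 < τ) (x : Space N) {t : ℝ}
    (ht : t ∈ Icc 0 T) (htτ : τ ≤ t) :
    U x t = U x (t - τ) + τ * F (negDiscFracLap σ h (fun y => U y (t - τ)) x)
      + τ * f x (t - τ) := by
  have := hU x t ht
  rw [schemeOp, if_pos htτ, sub_sub, sub_eq_zero, div_eq_iff hτ.ne'] at this
  linarith

/-- The sign change preserves the hypotheses (`one_sided_neg`), so statements on lower limits and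
supersolutions follow from the upper ones. -/
lemma SolvesScheme.neg (hU : SolvesScheme σ T F f u₀ h τ U) :
    SolvesScheme σ T (fun l => -F (-l)) (fun x t => -f x t) (fun x => -u₀ x) h τ
      (fun x t => -U x t) := by
  intro x t ht
  have := hU x t ht
  rw [schemeOp] at this ⊢
  split_ifs at this ⊢ with h1
  · rw [negDiscFracLap_neg, neg_neg]
    have e : (-U x t - -U x (t - τ)) / τ = -((U x t - U x (t - τ)) / τ) := by ring
    rw [e]
    linarith
  · linarith

lemma one_sided_neg (hF : ∀ l₁ l₂ : ℝ, F l₁ - F l₂ ≤ L * max (l₁ - l₂) 0) (l₁ l₂ : ℝ) :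
    (-F (-l₁)) - (-F (-l₂)) ≤ L * max (l₁ - l₂) 0 := by
  have := hF (-l₂) (-l₁)
  rw [show -l₂ - -l₁ = l₁ - l₂ by ring] at this
  linarith

/-- Induction over time steps. -/
lemma time_step_induction (hτ : 0 < τ) {P : ℝ → Prop} (h0 : ∀ t ∈ Icc 0 T, t < τ → P t)
    (hs : ∀ t ∈ Icc 0 T, τ ≤ t → P (t - τ) → P t) {t : ℝ} (ht : t ∈ Icc 0 T) : P t := by
  -- Time is continuous and `U` is prescribed on all of `[0, τ)`; the induction therefore runs over
  -- layers of length `τ`, not over grid times.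
  have key : ∀ n : ℕ, ∀ t ∈ Icc 0 T, t < (n + 1) * τ → P t := by
    intro n
    induction n with
    | zero => intro t ht htn; exact h0 t ht (by simpa using htn)
    | succ n ih =>
      intro t ht htn
      by_cases hc : t < τ
      · exact h0 t ht hc
      · push Not at hc
        refine hs t ht hc (ih _ ⟨by linarith, by linarith [ht.2]⟩ ?_)
        push_cast at htn
        linarith
  obtain ⟨n, hn⟩ := exists_nat_gt (t / τ)
  refine key n t ht ?_
  rw [div_lt_iff₀ hτ] at hn
  linarith

/-- An upper barrier for the scheme, for solutions with bounded time slices. -/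
lemma SolvesScheme.le_barrier_of_bdd (hσ : σ ∈ Ioo (0 : ℝ) 2)
    (hF : ∀ l₁ l₂ : ℝ, F l₁ - F l₂ ≤ L * max (l₁ - l₂) 0) (hL : 0 ≤ L) (hh : 0 < h) (hτ : 0 < τ)
    (hcfl : τ * (L * (cflConst N σ / h ^ σ)) ≤ 1) (hU : SolvesScheme σ T F f u₀ h τ U)
    (hUb : ∀ t ∈ Icc 0 T, ∃ C, ∀ x, |U x t| ≤ C)
    {C b A : ℝ} (hf : ∀ x, ∀ t ∈ Icc 0 T, f x t ≤ C) {ψ : Space N → ℝ} (hψ : ∃ C, ∀ x, |ψ x| ≤ C)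
    (hA : ∀ x, negDiscFracLap σ h ψ x ≤ A) (hb : F A + C ≤ b) (hb0 : 0 ≤ b) (h0 : ∀ x, u₀ x ≤ ψ x)
    (x : Space N) {t : ℝ} (ht : t ∈ Icc 0 T) : U x t ≤ ψ x + b * t := by
  refine time_step_induction (P := fun t => ∀ x, U x t ≤ ψ x + b * t) hτ ?_ ?_ ht x
  · intro t ht htτ x
    rw [hU.init x ht htτ]
    have := mul_nonneg hb0 ht.1
    linarith [h0 x]
  · intro t ht htτ ih x
    have ht' : t - τ ∈ Icc 0 T := ⟨by linarith, by linarith [ht.2]⟩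
    rw [hU.step hτ x ht htτ]
    have hψ' : ∃ C, ∀ x, |ψ x + b * (t - τ)| ≤ C := by
      obtain ⟨D, hD⟩ := hψ
      exact ⟨D + |b * (t - τ)|, fun x => (abs_add_le _ _).trans (add_le_add (hD x) le_rfl)⟩
    have h1 := euler_step_mono hσ hF hL hh hτ.le hcfl (hUb _ ht') hψ' ih x
    rw [negDiscFracLap_add_const σ h _ hψ] at h1
    have h2 := mul_le_mul_of_nonneg_left (monotone_of_one_sided hF (hA x)) hτ.le
    have h3 := mul_le_mul_of_nonneg_left (hf x _ ht') hτ.le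
    have h4 := mul_le_mul_of_nonneg_left hb hτ.le
    linarith

/-- Stability of the scheme in the supremum norm. -/
lemma SolvesScheme.abs_apply_le (hσ : σ ∈ Ioo (0 : ℝ) 2)
    (hF : ∀ l₁ l₂ : ℝ, F l₁ - F l₂ ≤ L * max (l₁ - l₂) 0) (hL : 0 ≤ L) (hh : 0 < h) (hτ : 0 < τ)
    (hcfl : τ * (L * (cflConst N σ / h ^ σ)) ≤ 1) (hU : SolvesScheme σ T F f u₀ h τ U)
    {C C₀ : ℝ} (hf : ∀ x, ∀ t ∈ Icc 0 T, |f x t| ≤ C) (h0 : ∀ x, |u₀ x| ≤ C₀)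
    (x : Space N) {t : ℝ} (ht : t ∈ Icc 0 T) : |U x t| ≤ C₀ + (|F 0| + C) * t := by
  refine time_step_induction (P := fun t => ∀ x, |U x t| ≤ C₀ + (|F 0| + C) * t) hτ ?_ ?_ ht x
  · intro t ht htτ x
    rw [hU.init x ht htτ]
    have hC : 0 ≤ C := (abs_nonneg _).trans (hf x t ht)
    have := mul_nonneg (add_nonneg (abs_nonneg (F 0)) hC) ht.1
    linarith [h0 x]
  · intro t ht htτ ih x
    have ht' : t - τ ∈ Icc 0 T := ⟨by linarith, by linarith [ht.2]⟩
    rw [hU.step hτ x ht htτ]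
    set c := C₀ + (|F 0| + C) * (t - τ) with hc
    have h1 := euler_step_mono hσ hF hL hh hτ.le hcfl ⟨c, ih⟩ (bdd_const N c)
      (fun x => (abs_le.1 (ih x)).2) x
    have h2 := euler_step_mono hσ hF hL hh hτ.le hcfl (bdd_const N (-c)) ⟨c, ih⟩
      (fun x => (abs_le.1 (ih x)).1) x
    rw [negDiscFracLap_const] at h1 h2
    have h3 := abs_le.1 (hf x _ ht')
    have h4 := mul_le_mul_of_nonneg_left h3.1 hτ.le
    have h5 := mul_le_mul_of_nonneg_left h3.2 hτ.le
    have h6 := mul_le_mul_of_nonneg_left (le_abs_self (F 0)) hτ.le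
    have h7 := mul_le_mul_of_nonneg_left (neg_abs_le (F 0)) hτ.le
    rw [abs_le]
    constructor <;> linarith

/-- The scheme takes its initial values uniformly in the discretization parameter. -/
lemma exists_barrier (hσ : σ ∈ Ioo (0 : ℝ) 2)
    (hF : ∀ l₁ l₂ : ℝ, F l₁ - F l₂ ≤ L * max (l₁ - l₂) 0) (hL : 0 ≤ L)
    (hf : ∃ C, ∀ x, ∀ t ∈ Icc 0 T, |f x t| ≤ C) (hu₀ : Continuous u₀)
    (hu₀b : ∃ C, ∀ x, |u₀ x| ≤ C) (x₀ : Space N) {ε : ℝ} (hε : 0 < ε) :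
    ∃ g : Space N × ℝ → ℝ, Continuous g ∧ g (x₀, 0) = u₀ x₀ + ε ∧
      ∀ (h τ : ℝ) (U : Space N → ℝ → ℝ), 0 < h → 0 < τ →
        τ * (L * (cflConst N σ / h ^ σ)) ≤ 1 → SolvesScheme σ T F f u₀ h τ U →
        ∀ x, ∀ t ∈ Icc 0 T, U x t ≤ g (x, t) := by
  obtain ⟨C, hC⟩ := hf
  obtain ⟨C₀, hC₀⟩ := hu₀b
  have hC₀n : 0 ≤ C₀ := (abs_nonneg _).trans (hC₀ x₀)
  obtain ⟨δ, hδ, hδu⟩ := Metric.continuousAt_iff.1 (hu₀.continuousAt (x := x₀)) ε hε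
  -- At distance at least `δ` from `x₀` the penalty is at least `1/2`, so `K` times it exceeds `2C₀`
  -- and the barrier lies above `u₀` there. The constant `A` below bounds the discrete operator on
  -- the barrier uniformly in `h`.
  set K := 4 * C₀ with hK
  have hK0 : 0 ≤ K := by positivity
  set A := heatConst σ * ∫ t in Ioi (0 : ℝ), min K (K * (2 * N / δ ^ 2) * t) / t ^ (1 + σ / 2)
  set b := |F A| + |C| with hb
  have hpc : Continuous fun x : Space N => penalty δ (x - x₀) :=
    (contDiff_penalty hδ.ne').continuous.comp (by fun_prop)
  have hpb : ∃ C, ∀ x : Space N, |K * penalty δ (x - x₀)| ≤ C := ⟨K, fun x => by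
    rw [abs_mul, abs_of_nonneg hK0]
    exact mul_le_of_le_one_right hK0 (abs_penalty_le_one _ _)⟩
  refine ⟨fun p => K * penalty δ (p.1 - x₀) + (u₀ x₀ + ε) + b * p.2, ?_, by simp, ?_⟩
  · have := hpc.comp (continuous_fst : Continuous fun p : Space N × ℝ => p.1)
    simp only [Function.comp_def] at this
    fun_prop
  · intro h τ U hh hτ hcfl hU x t ht
    refine hU.le_barrier_of_bdd hσ hF hL hh hτ hcfl (A := A) (C := |C|)
      (ψ := fun x => K * penalty δ (x - x₀) + (u₀ x₀ + ε))
      (fun t ht => ⟨_, fun x => hU.abs_apply_le hσ hF hL hh hτ hcfl hC hC₀ x ht⟩)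
      (fun x t ht => (le_abs_self _).trans ((hC x t ht).trans (le_abs_self _))) ?_ ?_
      (by rw [hb]; linarith [le_abs_self (F A)]) (by positivity) ?_ x ht
    · obtain ⟨D, hD⟩ := hpb
      exact ⟨D + |u₀ x₀ + ε|, fun x => (abs_add_le _ _).trans (add_le_add (hD x) le_rfl)⟩
    · intro x
      rw [negDiscFracLap_add_const σ h _ hpb]
      refine negDiscFracLap_le hσ h hpb x hK0 (by positivity) (fun y => ?_) fun y => ?_
      · have h1 : K * penalty δ (y - x₀) ≤ K := mul_le_of_le_one_right hK0 (penalty_le_one _ _)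
        have h2 : 0 ≤ K * penalty δ (x - x₀) := mul_nonneg hK0 (penalty_nonneg _ _)
        linarith
      · rw [congrFun (discLap_const_mul h K fun z : Space N => penalty δ (z - x₀)) y]
        exact mul_le_mul_of_nonneg_left (discLap_penalty_le hδ.ne' hh.ne' x₀ y) hK0
    · intro y
      have hpn : 0 ≤ K * penalty δ (y - x₀) := mul_nonneg hK0 (penalty_nonneg _ _)
      by_cases hy : dist y x₀ < δ
      · have := hδu hy
        rw [Real.dist_eq] at this
        have := (abs_lt.1 this).2
        linarith
      · rw [not_lt, dist_eq_norm] at hy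
        have h1 := penalty_mono hδ.ne' hδ.le hy
        have h2 : δ ^ 2 / (δ ^ 2 + δ ^ 2) = 1 / 2 := by field_simp; norm_num
        rw [h2] at h1
        have h3 := mul_le_mul_of_nonneg_left h1 hK0
        have h4 := abs_le.1 (hC₀ y)
        have h5 := abs_le.1 (hC₀ x₀)
        linarith

end Scheme

end

section

/-! ### The upper half-relaxed limit of the scheme -/

section RelaxedLimit

variable {N : ℕ} {σ T : ℝ} {F : ℝ → ℝ} {L : ℝ} {f : Space N → ℝ → ℝ} {u₀ : Space N → ℝ}
  {τ : ℝ → ℝ} {U : ℝ → Space N → ℝ → ℝ}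

/-- The filter `h → 0+`, `(y, s) → (x, t)` with `s ∈ [0, T]`. -/
def relaxFilter (N : ℕ) (T : ℝ) (p : Space N × ℝ) : Filter (ℝ × (Space N × ℝ)) :=
  𝓝[>] 0 ×ˢ 𝓝[univ ×ˢ Icc 0 T] p

/-- The upper half-relaxed limit. -/
def upperLimit (T : ℝ) (U : ℝ → Space N → ℝ → ℝ) (x : Space N) (t : ℝ) : ℝ :=
  limsup (fun q : ℝ × (Space N × ℝ) => U q.1 q.2.1 q.2.2) (relaxFilter N T (x, t))

lemma relaxFilter_neBot {p : Space N × ℝ} (hp : p.2 ∈ Icc 0 T) : (relaxFilter N T p).NeBot := by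
  have : (𝓝[univ ×ˢ Icc 0 T] p).NeBot :=
    mem_closure_iff_nhdsWithin_neBot.1 (subset_closure ⟨mem_univ _, hp⟩)
  unfold relaxFilter
  infer_instance

lemma eventually_relaxFilter_pos (p : Space N × ℝ) :
    ∀ᶠ q in relaxFilter N T p, 0 < q.1 ∧ q.2.2 ∈ Icc 0 T := by
  have : Ioi (0 : ℝ) ×ˢ ((univ : Set (Space N)) ×ˢ Icc 0 T) ∈ relaxFilter N T p :=
    Filter.prod_mem_prod self_mem_nhdsWithin self_mem_nhdsWithin
  filter_upwards [this] with q hq using ⟨hq.1, hq.2.2⟩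

/-- Uniform boundedness of a family on the strip. -/
def UnifBdd (T : ℝ) (U : ℝ → Space N → ℝ → ℝ) (C : ℝ) : Prop :=
  ∀ h, 0 < h → ∀ x, ∀ t ∈ Icc 0 T, |U h x t| ≤ C

lemma UnifBdd.isBoundedUnder_le {C : ℝ} (hU : UnifBdd T U C) (p : Space N × ℝ) :
    (relaxFilter N T p).IsBoundedUnder (· ≤ ·)
      (fun q : ℝ × (Space N × ℝ) => U q.1 q.2.1 q.2.2) := by
  refine ⟨C, ?_⟩
  rw [eventually_map]
  filter_upwards [eventually_relaxFilter_pos p] with q hq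
  exact (abs_le.1 (hU _ hq.1 _ _ hq.2)).2

lemma UnifBdd.isCoboundedUnder_le {C : ℝ} (hU : UnifBdd T U C) {p : Space N × ℝ}
    (hp : p.2 ∈ Icc 0 T) : (relaxFilter N T p).IsCoboundedUnder (· ≤ ·)
      (fun q : ℝ × (Space N × ℝ) => U q.1 q.2.1 q.2.2) := by
  have := relaxFilter_neBot hp
  refine IsBoundedUnder.isCoboundedUnder_flip ⟨-C, ?_⟩
  rw [eventually_map]
  filter_upwards [eventually_relaxFilter_pos p] with q hq
  exact (abs_le.1 (hU _ hq.1 _ _ hq.2)).1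

lemma UnifBdd.eventually_lt {C : ℝ} (hU : UnifBdd T U C) {x : Space N} {t a : ℝ}
    (ha : upperLimit T U x t < a) : ∀ᶠ q in relaxFilter N T (x, t), U q.1 q.2.1 q.2.2 < a :=
  eventually_lt_of_limsup_lt ha (hU.isBoundedUnder_le _)

lemma UnifBdd.frequently_lt {C : ℝ} (hU : UnifBdd T U C) {x : Space N} {t a : ℝ}
    (ht : t ∈ Icc 0 T) (ha : a < upperLimit T U x t) :
    ∃ᶠ q in relaxFilter N T (x, t), a < U q.1 q.2.1 q.2.2 :=
  frequently_lt_of_lt_limsup (hU.isCoboundedUnder_le ht) ha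

lemma UnifBdd.upperLimit_le {C : ℝ} (hU : UnifBdd T U C) {x : Space N} {t a : ℝ}
    (ht : t ∈ Icc 0 T) (ha : ∀ᶠ q in relaxFilter N T (x, t), U q.1 q.2.1 q.2.2 ≤ a) :
    upperLimit T U x t ≤ a :=
  limsup_le_of_le (hU.isCoboundedUnder_le ht) ha

lemma UnifBdd.abs_upperLimit_le {C : ℝ} (hU : UnifBdd T U C) (x : Space N) {t : ℝ}
    (ht : t ∈ Icc 0 T) : |upperLimit T U x t| ≤ C := by
  have := relaxFilter_neBot (N := N) (p := (x, t)) ht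
  refine abs_le.2 ⟨?_, hU.upperLimit_le ht ?_⟩
  · refine le_limsup_of_frequently_le (Eventually.frequently ?_) (hU.isBoundedUnder_le _)
    filter_upwards [eventually_relaxFilter_pos (x, t)] with q hq
    exact (abs_le.1 (hU _ hq.1 _ _ hq.2)).1
  · filter_upwards [eventually_relaxFilter_pos (x, t)] with q hq
    exact (abs_le.1 (hU _ hq.1 _ _ hq.2)).2

/-- A bound holding eventually in the product filter at a point also holds eventually in the filters
at nearby points of the strip. -/
lemma UnifBdd.upperSemicontinuousOn {C : ℝ} (hU : UnifBdd T U C) :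
    UpperSemicontinuousOn (fun p : Space N × ℝ => upperLimit T U p.1 p.2) (univ ×ˢ Icc 0 T) := by
  rintro ⟨x, t⟩ hp a ha
  obtain ⟨a', ha1, ha2⟩ := exists_between ha
  have h1 := hU.eventually_lt ha1
  obtain ⟨P, hP, Q, hQ, hPQ⟩ := eventually_prod_iff.1 h1
  have h2 := eventually_eventually_nhdsWithin.2 hQ
  filter_upwards [h2, self_mem_nhdsWithin] with y hy hyS
  refine lt_of_le_of_lt (hU.upperLimit_le hyS.2 ?_) ha2
  refine (hP.prod_mk hy).mono fun q hq => (hPQ hq.1 hq.2).le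

/-- Half-relaxed limits that are bounded by the initial datum at time zero. -/
lemma UnifBdd.upperLimit_zero_le (hσ : σ ∈ Ioo (0 : ℝ) 2) (hT : 0 < T)
    (hF : ∀ l₁ l₂ : ℝ, F l₁ - F l₂ ≤ L * max (l₁ - l₂) 0) (hL : 0 ≤ L)
    (hf : ∃ C, ∀ x, ∀ t ∈ Icc 0 T, |f x t| ≤ C) (hu₀ : Continuous u₀)
    (hu₀b : ∃ C, ∀ x, |u₀ x| ≤ C) {C : ℝ} (hUb : UnifBdd T U C) (hτ : ∀ h, 0 < h → 0 < τ h)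
    (hcfl : ∀ h, 0 < h → τ h * (L * (cflConst N σ / h ^ σ)) ≤ 1)
    (hU : ∀ h, 0 < h → SolvesScheme σ T F f u₀ h (τ h) (U h)) (x : Space N) :
    upperLimit T U x 0 ≤ u₀ x := by
  refine le_of_forall_pos_le_add fun ε hε => ?_
  obtain ⟨g, hgc, hg0, hg⟩ := exists_barrier (T := T) (N := N) hσ hF hL hf hu₀ hu₀b x (half_pos hε)
  have h0 : (0 : ℝ) ∈ Icc 0 T := ⟨le_rfl, hT.le⟩
  refine hUb.upperLimit_le h0 ?_
  have h1 : ∀ᶠ p in 𝓝[univ ×ˢ Icc 0 T] ((x, 0) : Space N × ℝ), g p < u₀ x + ε := by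
    refine (hgc.continuousAt.eventually (gt_mem_nhds ?_)).filter_mono nhdsWithin_le_nhds
    rw [hg0]; linarith
  filter_upwards [eventually_relaxFilter_pos (x, (0 : ℝ)), h1.prod_inr (𝓝[>] (0 : ℝ))] with q hq hq2
  exact (hg q.1 (τ q.1) (U q.1) hq.1 (hτ _ hq.1) (hcfl _ hq.1) (hU _ hq.1) _ _ hq.2).trans hq2.le

/-- Locally uniform upper bound on compact sets. -/
lemma eventually_forall_mem_of_isCompact {P : ℝ → Space N × ℝ → Prop} {K : Set (Space N × ℝ)}
    (hK : IsCompact K) (hKT : K ⊆ univ ×ˢ Icc 0 T)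
    (h : ∀ p ∈ K, ∀ᶠ q in relaxFilter N T p, P q.1 q.2) : ∀ᶠ h in 𝓝[>] (0 : ℝ), ∀ p ∈ K, P h p := by
  refine hK.induction_on (p := fun S => ∀ᶠ h in 𝓝[>] (0 : ℝ), ∀ p ∈ S, P h p) (by simp)
    (fun s t hst ht => ht.mono fun h hh p hp => hh p (hst hp))
    (fun s t hs ht => ?_) fun p hp => ?_
  · filter_upwards [hs, ht] with h h1 h2 p hp
    exact hp.elim (h1 p) (h2 p)
  · obtain ⟨A, hA, B, hB, hAB⟩ := eventually_prod_iff.1 (h p hp)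
    refine ⟨{q | B q}, nhdsWithin_mono _ hKT hB, ?_⟩
    filter_upwards [hA] with h hh q hq using hAB hh hq

/-- Consistency of the whole scheme along the relaxed filter. -/
lemma tendsto_scheme_residual (hσ : σ ∈ Ioo (0 : ℝ) 2)
    (hF : ∀ l₁ l₂ : ℝ, F l₁ - F l₂ ≤ L * max (l₁ - l₂) 0) (hL : 0 ≤ L)
    (hf : ContinuousOn (fun p : Space N × ℝ => f p.1 p.2) (univ ×ˢ Ioc 0 T))
    (hτ : ∀ h, 0 < h → 0 < τ h) (hτ0 : Tendsto τ (𝓝[>] 0) (𝓝 0)) {φ : Space N → ℝ → ℝ}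
    (hφ : IsTest T φ) {x₀ : Space N} {t₀ : ℝ} (ht₀ : t₀ ∈ Ioc 0 T) :
    Tendsto (fun q : ℝ × (Space N × ℝ) =>
      (φ q.2.1 q.2.2 - φ q.2.1 (q.2.2 - τ q.1)) / τ q.1
        - F (negDiscFracLap σ q.1 (fun y => φ y (q.2.2 - τ q.1)) q.2.1)
        - f q.2.1 (q.2.2 - τ q.1))
      (relaxFilter N T (x₀, t₀)) (𝓝 (residual σ F f φ x₀ t₀)) := by
  have hq1 : Tendsto (fun q : ℝ × (Space N × ℝ) => q.1) (relaxFilter N T (x₀, t₀)) (𝓝[>] 0) :=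
    tendsto_fst
  have hq2 : Tendsto (fun q : ℝ × (Space N × ℝ) => q.2) (relaxFilter N T (x₀, t₀))
      (𝓝 (x₀, t₀)) := tendsto_snd.mono_right nhdsWithin_le_nhds
  have hqx : Tendsto (fun q : ℝ × (Space N × ℝ) => q.2.1) (relaxFilter N T (x₀, t₀)) (𝓝 x₀) :=
    (continuous_fst.tendsto _).comp hq2
  have hqt : Tendsto (fun q : ℝ × (Space N × ℝ) => q.2.2) (relaxFilter N T (x₀, t₀)) (𝓝 t₀) :=
    (continuous_snd.tendsto _).comp hq2
  have hqτ : Tendsto (fun q : ℝ × (Space N × ℝ) => τ q.1) (relaxFilter N T (x₀, t₀)) (𝓝 0) :=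
    hτ0.comp hq1
  have hqs : Tendsto (fun q : ℝ × (Space N × ℝ) => q.2.2 - τ q.1) (relaxFilter N T (x₀, t₀))
      (𝓝 t₀) := by simpa using hqt.sub hqτ
  have hpos := eventually_relaxFilter_pos (T := T) (x₀, t₀)
  -- The scheme evaluates `f` at the earlier time, which must stay positive because continuity at
  -- `0` is not assumed.
  have hsQ : ∀ᶠ q in relaxFilter N T (x₀, t₀), q.2.2 - τ q.1 ∈ Ioc 0 T := by
    filter_upwards [hpos, hqs.eventually (lt_mem_nhds ht₀.1)] with q hq hq'
    exact ⟨hq', by linarith [hq.2.2, hτ _ hq.1]⟩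
  have : (relaxFilter N T (x₀, t₀)).IsCountablyGenerated := by
    unfold relaxFilter; infer_instance
  refine Tendsto.sub (Tendsto.sub ?_ ?_) ?_
  · set Φ : Space N × ℝ → ℝ := fun p => φ p.1 p.2 with hΦ
    -- Strict differentiability is what the time quotient needs, since its base point moves together
    -- with the step.
    have hs : HasStrictFDerivAt Φ (fderiv ℝ Φ (x₀, t₀)) (x₀, t₀) :=
      hφ.1.contDiffAt.hasStrictFDerivAt (by norm_num)
    have hd : HasDerivAt (fun s => φ x₀ s) (fderiv ℝ Φ (x₀, t₀) (0, 1)) t₀ := by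
      have hl : HasDerivAt (fun s : ℝ => ((x₀, s) : Space N × ℝ)) (0, 1) t₀ :=
        (hasDerivAt_const _ _).prodMk (hasDerivAt_id _)
      exact hs.hasFDerivAt.comp_hasDerivAt t₀ hl
    rw [hd.deriv]
    have ht2 : Tendsto (fun q : ℝ × (Space N × ℝ) => (q.2, (q.2.1, q.2.2 - τ q.1)))
        (relaxFilter N T (x₀, t₀)) (𝓝 ((x₀, t₀), (x₀, t₀))) :=
      hq2.prodMk_nhds (hqx.prodMk_nhds hqs)
    have ho := hs.isLittleO.comp_tendsto ht2
    have ho2 : (fun q : ℝ × (Space N × ℝ) => φ q.2.1 q.2.2 - φ q.2.1 (q.2.2 - τ q.1)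
        - τ q.1 * fderiv ℝ Φ (x₀, t₀) (0, 1)) =o[relaxFilter N T (x₀, t₀)] fun q => τ q.1 := by
      refine (ho.congr_left fun q => ?_).trans_isBigO
        (Asymptotics.IsBigO.of_bound 1 (Eventually.of_forall fun q => ?_))
      · have e : q.2 - (q.2.1, q.2.2 - τ q.1) = τ q.1 • ((0, 1) : Space N × ℝ) := by
          ext1 <;> simp
        simp only [Function.comp, e, map_smul, smul_eq_mul, hΦ]
      · simp [Prod.norm_def]
    have h1 := ho2.tendsto_div_nhds_zero.add_const (fderiv ℝ Φ (x₀, t₀) (0, 1))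
    rw [zero_add] at h1
    refine h1.congr' ?_
    filter_upwards [hpos] with q hq
    have := hτ _ hq.1
    field_simp
    ring
  · exact ((continuous_of_one_sided hF hL).tendsto _).comp
      (hφ.tendsto_negDiscFracLap hσ ⟨ht₀.1.le, ht₀.2⟩ hq1 hqx hqs
        (hsQ.mono fun q hq => ⟨hq.1.le, hq.2⟩))
  · exact (hf (x₀, t₀) ⟨mem_univ _, ht₀⟩).tendsto.comp (tendsto_nhdsWithin_iff.2
      ⟨hqx.prodMk_nhds hqs, hsQ.mono fun q hq => ⟨mem_univ _, hq⟩⟩)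

end RelaxedLimit

end

section

/-! ### The upper half-relaxed limit is a subsolution -/

section Subsolution

variable {N : ℕ} {σ T : ℝ} {F : ℝ → ℝ} {L : ℝ} {f : Space N → ℝ → ℝ} {u₀ : Space N → ℝ}
  {τ : ℝ → ℝ} {U : ℝ → Space N → ℝ → ℝ}

/-- Adding a slowly varying penalty keeps a strictly positive residual positive. -/
lemma exists_residual_add_penalty_pos (hσ : σ ∈ Ioo (0 : ℝ) 2)
    (hF : ∀ l₁ l₂ : ℝ, F l₁ - F l₂ ≤ L * max (l₁ - l₂) 0) (hL : 0 ≤ L) {φ : Space N → ℝ → ℝ}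
    (hφ : IsTest T φ) {x₀ : Space N} {t₀ : ℝ} (ht₀ : t₀ ∈ Ioc 0 T)
    (hres : 0 < residual σ F f φ x₀ t₀) {K : ℝ} (hK : 0 ≤ K) (K' : ℝ) :
    ∃ R : ℝ, 0 < R ∧
      IsTest T (fun x t => φ x t + (K * penalty R (x - x₀) + K' * (t - t₀) ^ 2)) ∧
      0 < residual σ F f (fun x t => φ x t + (K * penalty R (x - x₀) + K' * (t - t₀) ^ 2))
        x₀ t₀ := by
  -- The penalty raises the fractional Laplacian at `x₀` by at most `K penaltyOp`, which tends to
  -- `0` as `R` grows with `K` fixed; the quadratic in time has zero derivative at `t₀`.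
  obtain ⟨R, hR, hRres⟩ : ∃ R : ℝ, 0 < R ∧ L * (K * penaltyOp N σ R) < residual σ F f φ x₀ t₀ := by
    have h1 := ((tendsto_penaltyOp (N := N) hσ).const_mul K).const_mul L
    rw [mul_zero, mul_zero] at h1
    obtain ⟨R, hR1, hR2⟩ := ((h1.eventually (gt_mem_nhds hres)).and (eventually_gt_atTop 0)).exists
    exact ⟨R, hR2, hR1⟩
  obtain ⟨C, hC⟩ := hφ.2
  have ht₀' : t₀ ∈ Icc 0 T := Ioc_subset_Icc_self ht₀
  set φ' : Space N → ℝ → ℝ := fun x t => φ x t + (K * penalty R (x - x₀) + K' * (t - t₀) ^ 2)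
    with hφ'
  have htest : IsTest T φ' := by
    refine ⟨?_, C + (K + |K'| * T ^ 2), fun x t ht => ?_⟩
    · have h1 := contDiff_penalty_comp hR.ne' (g := fun p : Space N × ℝ => p.1 - x₀) (by fun_prop)
      have h2 := hφ.1
      exact h2.add ((contDiff_const.mul h1).add (by fun_prop))
    · refine (abs_add_le _ _).trans (add_le_add (hC x t ht) ((abs_add_le _ _).trans
        (add_le_add ?_ ?_)))
      · rw [abs_mul, abs_of_nonneg hK]
        exact mul_le_of_le_one_right hK (abs_penalty_le_one _ _)
      · rw [abs_mul, abs_pow]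
        refine mul_le_mul_of_nonneg_left (pow_le_pow_left₀ (abs_nonneg _) ?_ 2) (abs_nonneg _)
        rw [abs_le]
        constructor <;> linarith [ht.1, ht.2, ht₀.1, ht₀.2]
  refine ⟨R, hR, htest, ?_⟩
  have hderiv : deriv (fun s => φ' x₀ s) t₀ = deriv (fun s => φ x₀ s) t₀ := by
    have hd : DifferentiableAt ℝ (fun s => φ x₀ s) t₀ := by
      have h1 : ContDiff ℝ 2 fun s : ℝ => φ x₀ s :=
        hφ.1.comp (contDiff_const.prodMk contDiff_id : ContDiff ℝ 2 fun s : ℝ => (x₀, s))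
      exact (h1.differentiable (by norm_num)).differentiableAt
    have h2 : HasDerivAt (fun s : ℝ => K * penalty R (x₀ - x₀) + K' * (s - t₀) ^ 2) 0 t₀ := by
      have := ((((hasDerivAt_id t₀).sub_const t₀).pow 2).const_mul K').const_add
        (K * penalty R (x₀ - x₀))
      simpa using this
    have h3 := (hd.hasDerivAt.add h2).deriv
    rw [add_zero] at h3
    exact h3
  have hop : negFracLap σ (fun y => φ' y t₀) x₀
      ≤ negFracLap σ (fun y => φ y t₀) x₀ + K * penaltyOp N σ R := by
    rw [htest.negFracLap_eq hσ x₀ ht₀', hφ.negFracLap_eq hσ x₀ ht₀', fracOp, fracOp, penaltyOp,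
      ← integral_const_mul]
    have i1 := integrable_secondDiff_of_isTest hσ hφ x₀ ht₀'
    have i2 := (integrable_penaltyOp (N := N) hσ hR.ne').const_mul K
    rw [← integral_add i1 i2]
    refine integral_mono (integrable_secondDiff_of_isTest hσ htest x₀ ht₀') (i1.add i2) fun z => ?_
    have h1 := mul_le_mul_of_nonneg_left (secondDiff_penalty_le hR.ne' 0 z) hK
    have h2 : secondDiff (fun y => φ' y t₀) x₀ z
        = secondDiff (fun y => φ y t₀) x₀ z + K * secondDiff (penalty R) 0 z := by
      simp only [secondDiff, hφ', add_sub_cancel_left, sub_self, zero_add, zero_sub,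
        show x₀ - z - x₀ = -z by abel]
      ring
    have h3 := mul_le_mul_of_nonneg_right (h2.le.trans (add_le_add_right h1 _))
      (fracKer_nonneg hσ z)
    simp only [add_mul, mul_assoc] at h3
    exact h3
  have hFop := hF (negFracLap σ (fun y => φ' y t₀) x₀) (negFracLap σ (fun y => φ y t₀) x₀)
  have hmax : max (negFracLap σ (fun y => φ' y t₀) x₀ - negFracLap σ (fun y => φ y t₀) x₀) 0
      ≤ K * penaltyOp N σ R :=
    max_le (by linarith) (mul_nonneg hK (penaltyOp_nonneg hσ R))
  have h4 := mul_le_mul_of_nonneg_left hmax hL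
  unfold residual at hRres ⊢
  rw [hderiv]
  linarith

/-- A monotone consistent scheme touched strictly from above by a test function. -/
lemma residual_nonpos_of_strict_max (hσ : σ ∈ Ioo (0 : ℝ) 2)
    (hF : ∀ l₁ l₂ : ℝ, F l₁ - F l₂ ≤ L * max (l₁ - l₂) 0) (hL : 0 ≤ L)
    (hf : ContinuousOn (fun p : Space N × ℝ => f p.1 p.2) (univ ×ˢ Ioc 0 T))
    {C : ℝ} (hUb : UnifBdd T U C) (hτ : ∀ h, 0 < h → 0 < τ h) (hτ0 : Tendsto τ (𝓝[>] 0) (𝓝 0))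
    (hcfl : ∀ h, 0 < h → τ h * (L * (cflConst N σ / h ^ σ)) ≤ 1)
    (hU : ∀ h, 0 < h → SolvesScheme σ T F f u₀ h (τ h) (U h)) {φ : Space N → ℝ → ℝ}
    (hφ : IsTest T φ) {x₀ : Space N} {t₀ : ℝ} (ht₀ : t₀ ∈ Ioc 0 T)
    (hmax : ∀ V ∈ 𝓝 (x₀, t₀), ∃ δ : ℝ, 0 < δ ∧ ∀ᶠ h in 𝓝[>] (0 : ℝ), ∀ x, ∀ t ∈ Icc 0 T,
      (x, t) ∉ V → U h x t - φ x t ≤ upperLimit T U x₀ t₀ - φ x₀ t₀ - δ) :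
    residual σ F f φ x₀ t₀ ≤ 0 := by
  by_contra! hρ
  set ρ := residual σ F f φ x₀ t₀ with hρdef
  set M := upperLimit T U x₀ t₀ - φ x₀ t₀ with hM
  have ht₀' : t₀ ∈ Icc 0 T := Ioc_subset_Icc_self ht₀
  have hq1 : Tendsto (fun q : ℝ × (Space N × ℝ) => q.1) (relaxFilter N T (x₀, t₀)) (𝓝[>] 0) :=
    tendsto_fst
  have hq2 : Tendsto (fun q : ℝ × (Space N × ℝ) => q.2) (relaxFilter N T (x₀, t₀))
      (𝓝 (x₀, t₀)) := tendsto_snd.mono_right nhdsWithin_le_nhds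
  have hlate : ∀ᶠ q in relaxFilter N T (x₀, t₀), τ q.1 < q.2.2 :=
    (hτ0.comp hq1).eventually_lt ((continuous_snd.tendsto _).comp hq2) ht₀.1
  have hres := (tendsto_scheme_residual hσ hF hL hf hτ hτ0 hφ ht₀).eventually
    (lt_mem_nhds (half_lt_self hρ))
  obtain ⟨A, hA, B, hB, hAB⟩ := eventually_prod_iff.1 (hlate.and hres)
  obtain ⟨V, hV, hVB⟩ := mem_nhdsWithin_iff_exists_mem_nhds_inter.1 hB
  obtain ⟨δ, hδ, hoff⟩ := hmax V hV
  have hgood : ∀ᶠ q in relaxFilter N T (x₀, t₀), A q.1 ∧ (∀ x, ∀ t ∈ Icc 0 T, (x, t) ∉ V →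
      U q.1 x t - φ x t ≤ M - δ) ∧ φ q.2.1 q.2.2 < φ x₀ t₀ + δ / 4 :=
    (hq1.eventually hA).and ((hq1.eventually hoff).and
      (((hφ.continuous.tendsto (x₀, t₀)).comp hq2).eventually (gt_mem_nhds (by simpa using hδ))))
  obtain ⟨⟨h, y, s⟩, hqU, ⟨hqA, hqoff, hqφ⟩, hh, hs⟩ :=
    ((hUb.frequently_lt ht₀' (sub_lt_self _ (by positivity : (0 : ℝ) < δ / 4))).and_eventually
      (hgood.and (eventually_relaxFilter_pos (x₀, t₀)))).exists
  simp only at hqU hqA hqoff hqφ hh hs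
  have hτh := hτ h hh
  obtain ⟨Cφ, hCφ⟩ := hφ.2
  set E : Set ℝ := (fun p : Space N × ℝ => U h p.1 p.2 - φ p.1 p.2) '' (univ ×ˢ Icc 0 T) with hE
  have hEb : BddAbove E := by
    refine ⟨C + Cφ, ?_⟩
    rintro _ ⟨⟨x, t⟩, hp, rfl⟩
    have h1 := (abs_le.1 (hUb h hh x t hp.2)).2
    have h2 := (abs_le.1 (hCφ x t hp.2)).1
    simp only
    linarith
  have hle : ∀ x, ∀ t ∈ Icc 0 T, U h x t - φ x t ≤ sSup E := fun x t ht =>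
    le_csSup hEb ⟨(x, t), ⟨mem_univ _, ht⟩, rfl⟩
  -- The supremum of `U - φ` need not be attained, so an approximate maximum is used. Accuracy `δ/2`
  -- forces it into `V`, since the supremum exceeds `M - δ/2`; accuracy `τρ/2` is beaten by the gain
  -- that the positive residual yields in one step.
  have hε : 0 < min (δ / 2) (τ h * (ρ / 2)) := by positivity
  obtain ⟨_, ⟨⟨x, t⟩, ⟨-, ht⟩, rfl⟩, hlt⟩ :=
    exists_lt_of_lt_csSup (⟨_, (y, s), ⟨mem_univ _, hs⟩, rfl⟩ : E.Nonempty) (sub_lt_self _ hε)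
  simp only at hlt ht
  have hε1 := min_le_left (δ / 2) (τ h * (ρ / 2))
  have hε2 := min_le_right (δ / 2) (τ h * (ρ / 2))
  have hmem : (x, t) ∈ V := by
    by_contra hn
    have := hqoff x t ht hn
    have := hle y s hs
    linarith
  obtain ⟨hlate', hres'⟩ := hAB hqA (hVB ⟨hmem, mem_univ _, ht⟩)
  simp only at hlate' hres'
  have ht' : t - τ h ∈ Icc 0 T := ⟨by linarith, by linarith [ht.2]⟩
  have hφb : ∃ D, ∀ x, |φ x (t - τ h)| ≤ D := ⟨Cφ, fun x => hCφ x _ ht'⟩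
  have hstep := euler_step_mono hσ hF hL hh hτh.le (hcfl h hh)
    (φ := fun x => U h x (t - τ h)) (ψ := fun x => φ x (t - τ h) + sSup E)
    ⟨C, fun x => hUb h hh x _ ht'⟩
    ⟨Cφ + |sSup E|, fun x => (abs_add_le _ _).trans (add_le_add (hCφ x _ ht') le_rfl)⟩
    (fun x => by linarith [hle x _ ht']) x
  rw [negDiscFracLap_add_const σ h _ hφb] at hstep
  have hsch := (hU h hh).step hτh x ht hlate'.le
  have hres2 := mul_lt_mul_of_pos_left hres' hτh
  have e : τ h * ((φ x t - φ x (t - τ h)) / τ h - F (negDiscFracLap σ h (fun y => φ y (t - τ h)) x)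
      - f x (t - τ h)) = φ x t - φ x (t - τ h)
        - τ h * F (negDiscFracLap σ h (fun y => φ y (t - τ h)) x) - τ h * f x (t - τ h) := by
    field_simp
  rw [e] at hres2
  linarith

/-- The upper half-relaxed limit of the scheme is a viscosity subsolution. -/
theorem viscSub_upperLimit (hσ : σ ∈ Ioo (0 : ℝ) 2)
    (hF : ∀ l₁ l₂ : ℝ, F l₁ - F l₂ ≤ L * max (l₁ - l₂) 0) (hL : 0 ≤ L)
    (hf : ContinuousOn (fun p : Space N × ℝ => f p.1 p.2) (univ ×ˢ Ioc 0 T))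
    {C : ℝ} (hUb : UnifBdd T U C) (hτ : ∀ h, 0 < h → 0 < τ h) (hτ0 : Tendsto τ (𝓝[>] 0) (𝓝 0))
    (hcfl : ∀ h, 0 < h → τ h * (L * (cflConst N σ / h ^ σ)) ≤ 1)
    (hU : ∀ h, 0 < h → SolvesScheme σ T F f u₀ h (τ h) (U h)) :
    ViscSub σ T F f (upperLimit T U) := by
  intro φ hφ x₀ t₀ ht₀ hmax
  by_contra! hres
  obtain ⟨Cφ, hCφ⟩ := hφ.2
  have ht₀' : t₀ ∈ Icc 0 T := Ioc_subset_Icc_self ht₀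
  have hC0 : 0 ≤ C := (abs_nonneg _).trans (hUb.abs_upperLimit_le x₀ ht₀')
  have hCφ0 : 0 ≤ Cφ := (abs_nonneg _).trans (hCφ x₀ t₀ ht₀')
  have ht0 := ht₀.1
  -- Half of `K` exceeds the oscillation of `U - φ` by at least `2`, so far from `x₀` the penalty
  -- alone gives the strict gap. `K'` makes the time term at least `K/2` for `t ≤ t₀/2`, keeping
  -- away from time zero, where the maximum is not assumed.
  set K := 4 * (C + Cφ) + 4 with hK
  have hK0 : 0 < K := by positivity
  set K' := K / 2 / (t₀ / 2) ^ 2 with hK'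
  have hK'0 : 0 < K' := by positivity
  obtain ⟨R, hR, htest, hpos⟩ :=
    exists_residual_add_penalty_pos hσ hF hL hφ ht₀ hres hK0.le K'
  refine absurd ?_ (not_le.2 hpos)
  refine residual_nonpos_of_strict_max hσ hF hL hf hUb hτ hτ0 hcfl hU htest ht₀ fun V hV => ?_
  simp only [sub_self, penalty_zero, mul_zero, ne_eq, OfNat.ofNat_ne_zero, not_false_eq_true,
    zero_pow, add_zero]
  obtain ⟨r, hr, hrV⟩ := Metric.mem_nhds_iff.1 hV
  set M := upperLimit T U x₀ t₀ - φ x₀ t₀ with hM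
  set δ := min 1 (min (K * (r ^ 2 / (R ^ 2 + r ^ 2))) (K' * r ^ 2) / 2) with hδ
  have hδ0 : 0 < δ := by positivity
  have hδ1 : δ ≤ 1 := min_le_left _ _
  have hδ2 : δ ≤ min (K * (r ^ 2 / (R ^ 2 + r ^ 2))) (K' * r ^ 2) / 2 := min_le_right _ _
  refine ⟨δ, hδ0, ?_⟩
  set S : Set (Space N × ℝ) := (Metric.closedBall x₀ (2 * R) ×ˢ Icc (t₀ / 2) T) \
    Metric.ball (x₀, t₀) r with hS
  have hScomp : IsCompact S :=
    ((isCompact_closedBall _ _).prod isCompact_Icc).diff Metric.isOpen_ball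
  have hSsub : S ⊆ univ ×ˢ Icc 0 T := fun p hp =>
    ⟨mem_univ _, (by positivity : (0 : ℝ) ≤ t₀ / 2).trans hp.1.2.1, hp.1.2.2⟩
  -- On the remaining compact set the maximality of the upper limit leaves a gap `2δ`; half of it is
  -- spent in passing from the limit to `U` with `h` small.
  have hSev := eventually_forall_mem_of_isCompact (T := T) (P := fun h p => U h p.1 p.2
    - (φ p.1 p.2 + (K * penalty R (p.1 - x₀) + K' * (p.2 - t₀) ^ 2)) ≤ M - δ) hScomp hSsub ?_
  · filter_upwards [hSev, self_mem_nhdsWithin] with h hh hh0 x t ht hxt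
    by_cases hxS : (x, t) ∈ S
    · exact hh _ hxS
    have hKp : 0 ≤ K * penalty R (x - x₀) := mul_nonneg hK0.le (penalty_nonneg _ _)
    have hKt : 0 ≤ K' * (t - t₀) ^ 2 := by positivity
    have hbig : K / 2 ≤ K * penalty R (x - x₀) + K' * (t - t₀) ^ 2 := by
      by_cases h1 : penalty R (x - x₀) ≤ 1 / 2
      · have h2 : t < t₀ / 2 := by
          by_contra! h3
          refine hxS ⟨⟨?_, h3, ht.2⟩, fun hb => hxt (hrV hb)⟩
          rw [mem_closedBall_iff_norm]
          exact (norm_lt_two_mul_of_penalty_le hR h1).le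
        have h3 : (t₀ / 2) ^ 2 ≤ (t - t₀) ^ 2 := by nlinarith
        have h4 := mul_le_mul_of_nonneg_left h3 hK'0.le
        have h5 : K' * (t₀ / 2) ^ 2 = K / 2 := by rw [hK']; field_simp
        linarith
      · push Not at h1
        have := mul_le_mul_of_nonneg_left h1.le hK0.le
        linarith
    have h1 := (abs_le.1 (hUb h hh0 x t ht)).2
    have h2 := (abs_le.1 (hCφ x t ht)).1
    have h3 := (abs_le.1 (hUb.abs_upperLimit_le x₀ ht₀')).1
    have h4 := (abs_le.1 (hCφ x₀ t₀ ht₀')).2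
    linarith
  · rintro ⟨x, t⟩ hp
    have htpos : 0 < t := lt_of_lt_of_le (by positivity : (0 : ℝ) < t₀ / 2) hp.1.2.1
    have hmx := hmax x t ⟨htpos, hp.1.2.2⟩
    have hpen : 2 * δ ≤ K * penalty R (x - x₀) + K' * (t - t₀) ^ 2 := by
      have hKp : 0 ≤ K * penalty R (x - x₀) := mul_nonneg hK0.le (penalty_nonneg _ _)
      have hKt : 0 ≤ K' * (t - t₀) ^ 2 := by positivity
      have hd := hp.2
      rw [Metric.mem_ball, not_lt, Prod.dist_eq, le_max_iff, dist_eq_norm, Real.dist_eq] at hd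
      rcases hd with hd | hd
      · have h1 := mul_le_mul_of_nonneg_left (penalty_mono hR.ne' hr.le hd) hK0.le
        have h2 := min_le_left (K * (r ^ 2 / (R ^ 2 + r ^ 2))) (K' * r ^ 2)
        linarith
      · have h1 : r ^ 2 ≤ (t - t₀) ^ 2 := by
          rw [← sq_abs (t - t₀)]
          exact pow_le_pow_left₀ hr.le hd 2
        have h1 := mul_le_mul_of_nonneg_left h1 hK'0.le
        have h2 := min_le_right (K * (r ^ 2 / (R ^ 2 + r ^ 2))) (K' * r ^ 2)
        linarith
    have h1 := hUb.eventually_lt (lt_add_of_pos_right (upperLimit T U x t) (half_pos hδ0))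
    have hq2 : Tendsto (fun q : ℝ × (Space N × ℝ) => q.2) (relaxFilter N T (x, t))
        (𝓝 (x, t)) := tendsto_snd.mono_right nhdsWithin_le_nhds
    have h2 := ((htest.continuous.tendsto (x, t)).comp hq2).eventually
      (lt_mem_nhds (sub_lt_self _ (half_pos hδ0)))
    filter_upwards [h1, h2] with q hq1 hq2
    simp only [Function.comp] at hq2
    linarith

end Subsolution

end

section

/-! ### Existence, uniqueness and convergence -/

section Convergence

variable {N : ℕ} {σ T : ℝ} {F : ℝ → ℝ} {L : ℝ} {f : Space N → ℝ → ℝ} {u₀ : Space N → ℝ}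
  {τ : ℝ → ℝ} {U : ℝ → Space N → ℝ → ℝ}

lemma IsTest.neg {φ : Space N → ℝ → ℝ} (hφ : IsTest T φ) : IsTest T fun x t => -φ x t :=
  ⟨hφ.1.neg, by simpa only [abs_neg] using hφ.2⟩

lemma fracOp_neg (σ : ℝ) (φ : Space N → ℝ) (x : Space N) :
    fracOp σ (fun y => -φ y) x = -fracOp σ φ x := by
  simp only [fracOp, ← integral_neg]
  congr 1
  ext z
  unfold secondDiff
  ring

lemma residual_neg (hσ : σ ∈ Ioo (0 : ℝ) 2) {φ : Space N → ℝ → ℝ} (hφ : IsTest T φ) (x : Space N)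
    {t : ℝ} (ht : t ∈ Icc 0 T) :
    residual σ (fun l => -F (-l)) (fun x t => -f x t) (fun x t => -φ x t) x t
      = -residual σ F f φ x t := by
  unfold residual
  rw [hφ.neg.negFracLap_eq hσ x ht, hφ.negFracLap_eq hσ x ht, fracOp_neg]
  simp only [neg_neg, deriv.fun_neg]
  ring

lemma ViscSub.viscSuper_neg (hσ : σ ∈ Ioo (0 : ℝ) 2) {w : Space N → ℝ → ℝ}
    (hw : ViscSub σ T (fun l => -F (-l)) (fun x t => -f x t) w) :
    ViscSuper σ T F f fun x t => -w x t := by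
  intro φ hφ x₀ t₀ ht₀ hmin
  have := hw _ hφ.neg x₀ t₀ ht₀ fun x t ht => by linarith [hmin x t ht]
  rw [residual_neg hσ hφ x₀ (Ioc_subset_Icc_self ht₀)] at this
  linarith

lemma ViscSuper.congr {v w : Space N → ℝ → ℝ} (hv : ViscSuper σ T F f v)
    (h : ∀ x, ∀ t ∈ Ioc 0 T, v x t = w x t) : ViscSuper σ T F f w := by
  intro φ hφ x₀ t₀ ht₀ hmin
  refine hv φ hφ x₀ t₀ ht₀ fun x t ht => ?_
  rw [h x t ht, h x₀ t₀ ht₀]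
  exact hmin x t ht

/-- The lower half-relaxed limit. -/
def lowerLimit (T : ℝ) (U : ℝ → Space N → ℝ → ℝ) (x : Space N) (t : ℝ) : ℝ :=
  -upperLimit T (fun h x t => -U h x t) x t

lemma UnifBdd.neg {C : ℝ} (hU : UnifBdd T U C) : UnifBdd T (fun h x t => -U h x t) C :=
  fun h hh x t ht => by rw [abs_neg]; exact hU h hh x t ht

lemma UnifBdd.lowerLimit_le_upperLimit {C : ℝ} (hU : UnifBdd T U C) (x : Space N) {t : ℝ}
    (ht : t ∈ Icc 0 T) : lowerLimit T U x t ≤ upperLimit T U x t := by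
  have := relaxFilter_neBot (N := N) (p := (x, t)) ht
  by_contra! h
  obtain ⟨a, ha1, ha2⟩ := exists_between h
  obtain ⟨q, hq1, hq2⟩ := ((hU.eventually_lt ha1).and
    (hU.neg.eventually_lt (a := -a) (lt_neg.2 ha2))).exists
  linarith

/-- The half-relaxed limits of an admissible family of scheme solutions are a bounded
semicontinuous sub- and supersolution pair with ordered initial values. -/
structure IsRelaxedPair (σ T : ℝ) (F : ℝ → ℝ) (f : Space N → ℝ → ℝ) (u₀ : Space N → ℝ)
    (v w : Space N → ℝ → ℝ) : Prop where
  usc : UpperSemicontinuousOn (fun p : Space N × ℝ => v p.1 p.2) (univ ×ˢ Icc 0 T)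
  lsc : LowerSemicontinuousOn (fun p : Space N × ℝ => w p.1 p.2) (univ ×ˢ Icc 0 T)
  bdd_upper : ∃ B, ∀ x, ∀ t ∈ Icc 0 T, |v x t| ≤ B
  bdd_lower : ∃ B, ∀ x, ∀ t ∈ Icc 0 T, |w x t| ≤ B
  sub : ViscSub σ T F f v
  super : ViscSuper σ T F f w
  upper_zero_le : ∀ x, v x 0 ≤ u₀ x
  le_lower_zero : ∀ x, u₀ x ≤ w x 0

lemma exists_unifBdd (hσ : σ ∈ Ioo (0 : ℝ) 2)
    (hF : ∀ l₁ l₂ : ℝ, F l₁ - F l₂ ≤ L * max (l₁ - l₂) 0) (hL : 0 ≤ L)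
    (hfb : ∃ C, ∀ x, ∀ t ∈ Icc 0 T, |f x t| ≤ C)
    (hu₀b : ∃ C, ∀ x, |u₀ x| ≤ C) (hτ : ∀ h, 0 < h → 0 < τ h)
    (hcfl : ∀ h, 0 < h → τ h * (L * (cflConst N σ / h ^ σ)) ≤ 1)
    (hU : ∀ h, 0 < h → SolvesScheme σ T F f u₀ h (τ h) (U h)) : ∃ C, UnifBdd T U C := by
  obtain ⟨C, hC⟩ := hfb
  obtain ⟨C₀, hC₀⟩ := hu₀b
  refine ⟨C₀ + (|F 0| + C) * T, fun h hh x t ht => ?_⟩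
  have hCn : 0 ≤ C := (abs_nonneg _).trans (hC x t ht)
  have h1 := (hU h hh).abs_apply_le hσ hF hL hh (hτ h hh) (hcfl h hh) hC hC₀ x ht
  have h2 := mul_le_mul_of_nonneg_left ht.2 (add_nonneg (abs_nonneg (F 0)) hCn)
  linarith

lemma isRelaxedPair (hσ : σ ∈ Ioo (0 : ℝ) 2) (hT : 0 < T)
    (hF : ∀ l₁ l₂ : ℝ, F l₁ - F l₂ ≤ L * max (l₁ - l₂) 0) (hL : 0 ≤ L)
    (hf : ContinuousOn (fun p : Space N × ℝ => f p.1 p.2) (univ ×ˢ Ioc 0 T))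
    (hfb : ∃ C, ∀ x, ∀ t ∈ Icc 0 T, |f x t| ≤ C) (hu₀ : Continuous u₀)
    (hu₀b : ∃ C, ∀ x, |u₀ x| ≤ C) (hτ : ∀ h, 0 < h → 0 < τ h)
    (hτ0 : Tendsto τ (𝓝[>] 0) (𝓝 0))
    (hcfl : ∀ h, 0 < h → τ h * (L * (cflConst N σ / h ^ σ)) ≤ 1)
    (hU : ∀ h, 0 < h → SolvesScheme σ T F f u₀ h (τ h) (U h)) :
    IsRelaxedPair σ T F f u₀ (upperLimit T U) (lowerLimit T U) := by
  obtain ⟨C, hC⟩ := exists_unifBdd hσ hF hL hfb hu₀b hτ hcfl hU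
  have hfb' : ∃ C, ∀ x, ∀ t ∈ Icc 0 T, |-f x t| ≤ C := by simpa only [abs_neg] using hfb
  have hu₀b' : ∃ C, ∀ x, |-u₀ x| ≤ C := by simpa only [abs_neg] using hu₀b
  have hU' : ∀ h, 0 < h → SolvesScheme σ T (fun l => -F (-l)) (fun x t => -f x t)
      (fun x => -u₀ x) h (τ h) (fun x t => -U h x t) := fun h hh => (hU h hh).neg
  refine ⟨hC.upperSemicontinuousOn, ?_, ⟨C, fun x t ht => hC.abs_upperLimit_le x ht⟩,
    ⟨C, fun x t ht => ?_⟩, viscSub_upperLimit hσ hF hL hf hC hτ hτ0 hcfl hU, ?_,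
    hC.upperLimit_zero_le hσ hT hF hL hfb hu₀ hu₀b hτ hcfl hU, fun x => ?_⟩
  · intro p hp a ha
    have := hC.neg.upperSemicontinuousOn p hp (-a) (lt_neg.2 ha)
    filter_upwards [this] with q hq
    exact lt_neg.2 hq
  · rw [lowerLimit, abs_neg]
    exact hC.neg.abs_upperLimit_le x ht
  · exact (viscSub_upperLimit hσ (one_sided_neg hF) hL hf.neg hC.neg hτ hτ0 hcfl
      hU').viscSuper_neg hσ
  · exact le_neg.2 (hC.neg.upperLimit_zero_le hσ hT (one_sided_neg hF) hL hfb' hu₀.neg hu₀b' hτ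
      hcfl hU' x)

/-- The scheme solution on the `n`-th time layer. -/
def eulerLayer (σ : ℝ) (F : ℝ → ℝ) (f : Space N → ℝ → ℝ) (u₀ : Space N → ℝ) (h τ : ℝ) :
    ℕ → Space N → ℝ → ℝ
  | 0, x, _ => u₀ x
  | n + 1, x, t => eulerLayer σ F f u₀ h τ n x (t - τ)
      + τ * (F (negDiscFracLap σ h (fun y => eulerLayer σ F f u₀ h τ n y (t - τ)) x)
      + f x (t - τ))

lemma solvesScheme_eulerLayer (σ T : ℝ) (F : ℝ → ℝ) (f : Space N → ℝ → ℝ) (u₀ : Space N → ℝ)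
    (h : ℝ) {τ : ℝ} (hτ : 0 < τ) :
    SolvesScheme σ T F f u₀ h τ fun x t => eulerLayer σ F f u₀ h τ ⌊t / τ⌋₊ x t := by
  intro x t ht
  rw [schemeOp]
  split_ifs with hc
  · have h1 : ⌊t / τ⌋₊ = ⌊(t - τ) / τ⌋₊ + 1 := by
      rw [← Nat.floor_add_one (div_nonneg (sub_nonneg.2 hc) hτ.le)]
      congr 1
      field_simp
      ring
    simp only [h1, eulerLayer]
    field_simp
    ring
  · simp only [Nat.floor_eq_zero.2 ((div_lt_one hτ).2 (not_le.1 hc)), eulerLayer, sub_self]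

/-- Existence of an admissible discretization. -/
lemma exists_admissible (L : ℝ) (N : ℕ) (σ : ℝ) {h : ℝ} (hh : 0 < h) :
    ∃ τ : ℝ, 0 < τ ∧ τ ≤ h ∧ τ * (L * (cflConst N σ / h ^ σ)) ≤ 1 := by
  set c := L * (cflConst N σ / h ^ σ)
  refine ⟨min h (1 / (|c| + 1)), by positivity, min_le_left _ _, ?_⟩
  have h1 : min h (1 / (|c| + 1)) * c ≤ min h (1 / (|c| + 1)) * (|c| + 1) :=
    mul_le_mul_of_nonneg_left (by linarith [le_abs_self c]) (by positivity)
  have h2 := mul_le_mul_of_nonneg_right (min_le_right h (1 / (|c| + 1)))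
    (by positivity : 0 ≤ |c| + 1)
  rw [one_div_mul_cancel (by positivity : |c| + 1 ≠ 0)] at h2
  exact h1.trans h2

/-- The CFL condition in product form. -/
lemma cfl_mul_le_one (hL : 0 < L) {h τ : ℝ} (hh : 0 < h) (hτ : 0 < τ)
    (hcfl : τ ≤ h ^ σ / (L * cflConst N σ)) :
    τ * (L * (cflConst N σ / h ^ σ)) ≤ 1 := by
  have hp : 0 < h ^ σ := Real.rpow_pos_of_pos hh _
  -- The CFL condition itself forces positivity: for `C_σ ≤ 0` its right-hand side would be
  -- nonpositive, with value `0` when `C_σ = 0`, while `τ > 0`.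
  have hc : 0 < cflConst N σ := by
    by_contra! hc
    exact absurd (hτ.trans_le hcfl) (not_lt.2 (div_nonpos_of_nonneg_of_nonpos hp.le
      (mul_nonpos_of_nonneg_of_nonpos hL.le hc)))
  rw [le_div_iff₀ (by positivity)] at hcfl
  rw [← mul_div_assoc, ← mul_div_assoc, div_le_one hp]
  exact hcfl

lemma tendsto_timeStep (hσ : 0 < σ) {c : ℝ} (hτ : ∀ h, 0 < h → 0 < τ h)
    (hcfl : ∀ h, 0 < h → τ h ≤ h ^ σ / c) : Tendsto τ (𝓝[>] 0) (𝓝 0) := by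
  have h1 : Tendsto (fun h : ℝ => h ^ σ / c) (𝓝[>] 0) (𝓝 0) := by
    have := ((Real.continuousAt_rpow_const 0 σ (Or.inr hσ.le)).tendsto.div_const c).mono_left
      (nhdsWithin_le_nhds (s := Ioi 0))
    simpa [Real.zero_rpow hσ.ne'] using this
  refine tendsto_of_tendsto_of_tendsto_of_le_of_le' tendsto_const_nhds h1 ?_ ?_
  · filter_upwards [self_mem_nhdsWithin] with h hh using (hτ h hh).le
  · filter_upwards [self_mem_nhdsWithin] with h hh using hcfl h hh

/-- Locally uniform convergence from squeezing by the half-relaxed limits. -/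
lemma UnifBdd.tendstoLocallyUniformlyOn {C : ℝ} (hU : UnifBdd T U C) {u : Space N → ℝ → ℝ}
    (hu : ContinuousOn (fun p : Space N × ℝ => u p.1 p.2) (univ ×ˢ Icc 0 T))
    (h1 : ∀ x, ∀ t ∈ Icc 0 T, upperLimit T U x t ≤ u x t)
    (h2 : ∀ x, ∀ t ∈ Icc 0 T, u x t ≤ lowerLimit T U x t) :
    TendstoLocallyUniformlyOn (fun h (p : Space N × ℝ) => U h p.1 p.2) (fun p => u p.1 p.2)
      (𝓝[>] (0 : ℝ)) (univ ×ˢ Icc 0 T) := by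
  -- Local uniform convergence is convergence of the distance along `h → 0+` and `(y, s) → (x, t)`
  -- jointly, the filter that defines the relaxed limits.
  rw [tendstoLocallyUniformlyOn_iff_forall_tendsto]
  rintro ⟨x, t⟩ hp
  refine Metric.uniformity_basis_dist.tendsto_right_iff.2 fun ε hε => ?_
  have e1 := hU.eventually_lt (a := u x t + ε / 2) (x := x) (t := t) (by linarith [h1 x t hp.2])
  have e2 := hU.neg.eventually_lt (a := -(u x t - ε / 2)) (x := x) (t := t) (by
    have := h2 x t hp.2
    unfold lowerLimit at this
    linarith)
  have e3 : ∀ᶠ q in relaxFilter N T (x, t), dist (u q.2.1 q.2.2) (u x t) < ε / 2 :=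
    ((hu (x, t) hp).tendsto.comp tendsto_snd).eventually (Metric.ball_mem_nhds _ (half_pos hε))
  filter_upwards [e1, e2, e3] with q hq1 hq2 hq3
  rw [Real.dist_eq, abs_lt] at hq3
  rw [Real.dist_eq, abs_lt]
  constructor <;> linarith

end Convergence

end

end FracHJB

end

/-! ### The main theorem -/

theorem mainTheorem1 (N : ℕ) (hN : 1 ≤ N) (σ : ℝ) (hσ : σ ∈ Ioo (0 : ℝ) 2) (T : ℝ) (hT : 0 < T)
    (F : ℝ → ℝ) (L : ℝ) (hL : 0 < L)
    (hF : ∀ l₁ l₂ : ℝ, F l₁ - F l₂ ≤ L * max (l₁ - l₂) 0)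
    (f : FracHJB.Space N → ℝ → ℝ)
    (hf_cont : ContinuousOn (fun p : FracHJB.Space N × ℝ => f p.1 p.2) (univ ×ˢ Ioc 0 T))
    (hf_bdd : ∃ C : ℝ, ∀ x : FracHJB.Space N, ∀ t ∈ Icc 0 T, |f x t| ≤ C)
    (u₀ : FracHJB.Space N → ℝ) (hu₀_cont : Continuous u₀)
    (hu₀_bdd : ∃ C : ℝ, ∀ x : FracHJB.Space N, |u₀ x| ≤ C) :
    ∃ u : FracHJB.Space N → ℝ → ℝ,
      FracHJB.IsBddViscositySolution σ T F f u₀ u ∧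
      (∀ v : FracHJB.Space N → ℝ → ℝ, FracHJB.IsBddViscositySolution σ T F f u₀ v →
        ∀ x : FracHJB.Space N, ∀ t ∈ Icc 0 T, v x t = u x t) ∧
      ∀ (τ : ℝ → ℝ) (U : ℝ → FracHJB.Space N → ℝ → ℝ),
        (∀ h : ℝ, 0 < h → ∃ M : ℕ, 0 < M ∧ τ h = T / M) →
        (∀ h : ℝ, 0 < h → τ h ≤ h ^ σ / (L * FracHJB.cflConst N σ)) →
        (∀ h : ℝ, 0 < h → FracHJB.SolvesScheme σ T F f u₀ h (τ h) (U h)) →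
        TendstoLocallyUniformlyOn (fun h (p : FracHJB.Space N × ℝ) => U h p.1 p.2)
          (fun p => u p.1 p.2) (𝓝[>] (0 : ℝ)) (univ ×ˢ Icc 0 T) := by
  have hL' := hL.le
  -- Any two such pairs are ordered crosswise, because at time zero `u₀` separates them. Applied to
  -- half-relaxed limits and to solutions (paired with themselves), this yields existence,
  -- uniqueness and convergence.
  have hcmp : ∀ {v w : FracHJB.Space N → ℝ → ℝ} {v' w' : FracHJB.Space N → ℝ → ℝ},
      FracHJB.IsRelaxedPair σ T F f u₀ v v' → FracHJB.IsRelaxedPair σ T F f u₀ w w' →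
      ∀ x, ∀ t ∈ Icc 0 T, v x t ≤ w' x t := fun hv hw x t ht =>
    FracHJB.comparison hσ hF hL' hf_cont hv.usc hw.lsc hv.bdd_upper hw.bdd_lower hv.sub hw.super
      (fun x => (hv.upper_zero_le x).trans (hw.le_lower_zero x)) x ht
  have hpair : ∀ {v : FracHJB.Space N → ℝ → ℝ},
      FracHJB.IsBddViscositySolution σ T F f u₀ v → FracHJB.IsRelaxedPair σ T F f u₀ v v :=
    fun hv => ⟨hv.continuousOn.upperSemicontinuousOn, hv.continuousOn.lowerSemicontinuousOn,
      hv.bounded, hv.bounded, hv.sub, hv.super, fun x => (hv.initial x).le,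
      fun x => (hv.initial x).ge⟩
  have hex : ∃ u, FracHJB.IsBddViscositySolution σ T F f u₀ u := by
    -- For existence the step need not divide `T`: it only has to satisfy the CFL bound in product
    -- form and tend to zero, which `τ ≤ h` ensures.
    choose! τ hτ hτh hcfl using
      fun (h : ℝ) (hh : 0 < h) => FracHJB.exists_admissible L N σ hh
    have hτ0 : Tendsto τ (𝓝[>] 0) (𝓝 0) := by
      refine tendsto_of_tendsto_of_tendsto_of_le_of_le' tendsto_const_nhds
        (tendsto_id.mono_left nhdsWithin_le_nhds) ?_ ?_
      · filter_upwards [self_mem_nhdsWithin] with h hh using (hτ h hh).le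
      · filter_upwards [self_mem_nhdsWithin] with h hh using hτh h hh
    have hU : ∀ h, 0 < h → FracHJB.SolvesScheme σ T F f u₀ h (τ h) fun x t =>
        FracHJB.eulerLayer σ F f u₀ h (τ h) ⌊t / τ h⌋₊ x t :=
      fun h hh => FracHJB.solvesScheme_eulerLayer σ T F f u₀ h (hτ h hh)
    obtain ⟨C, hC⟩ := FracHJB.exists_unifBdd hσ hF hL' hf_bdd hu₀_bdd hτ hcfl hU
    have hP := FracHJB.isRelaxedPair hσ hT hF hL' hf_cont hf_bdd hu₀_cont hu₀_bdd hτ hτ0 hcfl hU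
    -- The lower limit is below the upper one by definition, and comparison gives the converse; the
    -- common value is both upper and lower semicontinuous, hence continuous.
    have heq : ∀ x, ∀ t ∈ Icc 0 T, _ := fun x t ht =>
      le_antisymm (hC.lowerLimit_le_upperLimit x ht) (hcmp hP hP x t ht)
    have h0 : (0 : ℝ) ∈ Icc 0 T := ⟨le_rfl, hT.le⟩
    refine ⟨_, continuousOn_iff_lower_upperSemicontinuousOn.2
      ⟨fun p hp a ha => ?_, hP.usc⟩, hP.bdd_upper, fun x =>
      le_antisymm (hP.upper_zero_le x) ((hP.le_lower_zero x).trans (heq x 0 h0).le), hP.sub,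
      hP.super.congr fun x t ht => heq x t (Ioc_subset_Icc_self ht)⟩
    filter_upwards [hP.lsc p hp a (ha.trans_eq (heq p.1 p.2 hp.2).symm), self_mem_nhdsWithin]
      with q hq hqS
    exact lt_of_lt_of_eq hq (heq q.1 q.2 hqS.2)
  obtain ⟨u, hu⟩ := hex
  refine ⟨u, hu, fun v hv x t ht => le_antisymm (hcmp (hpair hv) (hpair hu) x t ht)
    (hcmp (hpair hu) (hpair hv) x t ht), fun τ U hM hcfl hU => ?_⟩
  have hτ : ∀ h, 0 < h → 0 < τ h := fun h hh => by
    obtain ⟨M, hM0, hMτ⟩ := hM h hh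
    rw [hMτ]
    positivity
  have hcfl' : ∀ h, 0 < h → τ h * (L * (FracHJB.cflConst N σ / h ^ σ)) ≤ 1 := fun h hh =>
    FracHJB.cfl_mul_le_one hL hh (hτ h hh) (hcfl h hh)
  have hτ0 := FracHJB.tendsto_timeStep hσ.1 hτ hcfl
  obtain ⟨C, hC⟩ := FracHJB.exists_unifBdd hσ hF hL' hf_bdd hu₀_bdd hτ hcfl' hU
  have hP := FracHJB.isRelaxedPair hσ hT hF hL' hf_cont hf_bdd hu₀_cont hu₀_bdd hτ hτ0 hcfl' hU
  exact hC.tendstoLocallyUniformlyOn hu.continuousOn (hcmp hP (hpair hu)) (hcmp (hpair hu) hP)
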